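/- Let $m\ge 1$ be an integer, let $M$ be a compact smooth manifold without boundary, let $f\in C^\infty(M)$, and let $Z=f^{-1}(0)$ be a nonempty embedded hypersurface with $df\neq 0$ at every point of $Z$. Let ${}^{b^m}TM$ be the vector bundle whose sections are the smooth vector fields $v$ such that $v(f)=a f^m$ for some $a\in C^\infty(M)$. Let $\omega$ be a $b^m$-symplectic form on $M$, that is, a smooth section of $\Lambda^2({}^{b^m}T^*M)$ that is closed and is nondegenerate on every fibre of ${}^{b^m}TM$ (including the fibres over $Z$). Theorem. There are $\varepsilon>0$, an identification of $U=\{|f|<\varepsilon\}$ with $(-\varepsilon,\varepsilon)\times Z$ by a diffeomorphism that is $z\mapsto(0,z)$ on $Z$ and whose first component is $f$, a diffeomorphism $\psi:U\to U$ that preserves $Z$ and the $m$-germ of $f$ (that is, $\psi(Z)=Z$ and $f\circ\psi=f+f^{m+1}g$ with $g\in C^\infty(U)$), smooth closed one-forms $\alpha_1,\dots,\alpha_m$ on $Z$, a smooth closed two-form $\beta$ on $Z$, and $0<\delta\le\varepsilon$, such that on the neighborhood $\{|f|<\delta\}=(-\delta,\delta)\times Z$ of $Z$ $$\psi^*\omega=\sum_{j=1}^m\frac{df}{f^j}\wedge\pi^*\alpha_j+\pi^*\beta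 ,$$ where $\pi:U\to Z$ is the projection. This holds equivariantly: if a torus $T$ acts smoothly on $M$ and preserves $f$ (hence $Z$) and $\omega$, then all of this can be chosen so that the identification $U\cong(-\varepsilon,\varepsilon)\times Z$ and $\psi$ are $T$-equivariant ($T$ acting trivially on $(-\varepsilon,\varepsilon)$) and $\alpha_1,\dots,\alpha_m,\beta$ are $T$-invariant. -/

import Mathlib

open Set
open scoped Manifold ContDiff

noncomputable section

/-! ### Differential forms on a manifold without boundary -/

/-- A (not necessarily smooth) differential `k`-form on an `n`-dimensional manifold `X`. -/
abbrev DiffForm (n k : ℕ) (X : Type*) [TopologicalSpace X]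
    [ChartedSpace (EuclideanSpace ℝ (Fin n)) X] : Type _ :=
  (x : X) → TangentSpace (𝓡 n) x [⋀^Fin k]→L[ℝ] ℝ

namespace DiffForm

variable {n k : ℕ} {X : Type*} [TopologicalSpace X] [ChartedSpace (EuclideanSpace ℝ (Fin n)) X]

/-- The expression of a form in the chart around `x₀`: its pullback under the inverse chart. -/
def inChart (α : DiffForm n k X) (x₀ : X) :
    EuclideanSpace ℝ (Fin n) → EuclideanSpace ℝ (Fin n) [⋀^Fin k]→L[ℝ] ℝ := fun y =>
  (α ((extChartAt (𝓡 n) x₀).symm y)).compContinuousLinearMap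
    (mfderiv (𝓡 n) (𝓡 n) (extChartAt (𝓡 n) x₀).symm y)

/-- Smoothness: all the chart expressions are smooth. -/
def IsSmooth (α : DiffForm n k X) : Prop :=
  ∀ x₀ : X, ContDiffOn ℝ ∞ (α.inChart x₀) (extChartAt (𝓡 n) x₀).target

/-- Closedness on an open set `S`: the exterior derivative vanishes there, in every chart. -/
def IsClosedOn (α : DiffForm n k X) (S : Set X) : Prop :=
  ∀ x₀ : X, ∀ y ∈ (extChartAt (𝓡 n) x₀).target, (extChartAt (𝓡 n) x₀).symm y ∈ S →
    extDeriv (α.inChart x₀) y = 0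

/-- Invariance of a form under a self-map `φ`, i.e. `φ^* α = α`, at the points of `S`. -/
def IsInvariantOn (α : DiffForm n k X) (φ : X → X) (S : Set X) : Prop :=
  ∀ x ∈ S, (α (φ x)).compContinuousLinearMap (mfderiv (𝓡 n) (𝓡 n) φ x) = α x

end DiffForm

/-! ### The `b^m`-tangent bundle and `b^m`-forms -/

section Bm

variable {n : ℕ} {M : Type*} [TopologicalSpace M] [ChartedSpace (EuclideanSpace ℝ (Fin n)) M]
  [IsManifold (𝓡 n) ∞ M]

/-- The differential of a real function as a covector. -/
def differential (f : M → ℝ) (p : M) : TangentSpace (𝓡 n) p →L[ℝ] ℝ :=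
  mvfderiv (𝓡 n) f p

/-- The fibre at `p` of the `b^m`-tangent bundle of `(M, f)`.  A vector field `X` is a section of
the `b^m`-tangent bundle iff `X(f)` vanishes to order `m` on `Z = {f = 0}`, i.e.
`X(f) = a f^m` with `a` smooth; such a section is recorded as the pair `(X, a)`.  Off `Z` the
number `a` is determined by the vector, so the fibre is `T_p M`; on `Z` the fibre is
`T_p Z × ℝ`, the second factor being spanned by the section `f^m ∂/∂f`. -/
def bmTangent (f : M → ℝ) (m : ℕ) (p : M) : Submodule ℝ (TangentSpace (𝓡 n) p × ℝ) where
  carrier := {u | differential f p u.1 = u.2 * f p ^ m}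
  zero_mem' := by simp
  add_mem' := by
    intro u v hu hv
    simp only [mem_ofPred_eq, Prod.fst_add, Prod.snd_add, map_add] at *
    rw [hu, hv]; ring
  smul_mem' := by
    intro c u hu
    simp only [mem_ofPred_eq, Prod.smul_fst, Prod.smul_snd, map_smul, smul_eq_mul] at *
    rw [hu]; ring

/-- A smooth section of the `b^m`-tangent bundle: a smooth vector field `X` together with the
smooth function `a` such that `X(f) = a f^m`. -/
structure BmVectorField (f : M → ℝ) (m : ℕ) where
  /-- the vector field -/
  X : (p : M) → TangentSpace (𝓡 n) p
  /-- the quotient of `X(f)` by `f^m` -/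
  a : M → ℝ
  smooth_X : ContMDiff (𝓡 n) (𝓡 n).tangent ∞ (fun p => (⟨p, X p⟩ : TangentBundle (𝓡 n) M))
  smooth_a : ContMDiff (𝓡 n) 𝓘(ℝ, ℝ) ∞ a
  mem : ∀ p, (X p, a p) ∈ bmTangent f m p

/-- The value of a `b^m`-vector field at `p`, as an element of the fibre. -/
def BmVectorField.val {f : M → ℝ} {m : ℕ} (V : BmVectorField (n := n) f m) (p : M) :
    bmTangent (n := n) f m p :=
  ⟨(V.X p, V.a p), V.mem p⟩

/-- A (not necessarily smooth) `b^m`-form of degree two: a section of the second exterior power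
of the dual of the `b^m`-tangent bundle. -/
abbrev BmTwoForm (n : ℕ) {M : Type*} [TopologicalSpace M]
    [ChartedSpace (EuclideanSpace ℝ (Fin n)) M] (f : M → ℝ) (m : ℕ) : Type _ :=
  (p : M) → bmTangent (n := n) f m p [⋀^Fin 2]→L[ℝ] ℝ

/-- Off `Z = {f = 0}`, the inverse of the isomorphism from the fibre of the `b^m`-tangent bundle
to `T_p M`, namely `v ↦ (v, df(v) / f^m)`.  (Junk value `0` at the points of `Z`.) -/
def bmLift (f : M → ℝ) (m : ℕ) (p : M) : TangentSpace (𝓡 n) p →L[ℝ] bmTangent (n := n) f m p := by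
  classical
  exact if h : f p ≠ 0 then
    ((ContinuousLinearMap.id ℝ (TangentSpace (𝓡 n) p)).prod
      ((f p ^ m)⁻¹ • differential f p)).codRestrict (bmTangent f m p) (by
        intro v
        change differential f p v = ((f p ^ m)⁻¹ * differential f p v) * f p ^ m
        have h' : f p ^ m ≠ 0 := pow_ne_zero m h
        field_simp)
  else 0

namespace BmTwoForm

variable {f : M → ℝ} {m : ℕ}

/-- The ordinary two-form that a `b^m`-form defines on the complement of `Z = {f = 0}`. -/
def restrict (Ω : BmTwoForm n f m) : DiffForm n 2 M :=
  fun p => (Ω p).compContinuousLinearMap (bmLift f m p)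

/-- Smoothness: `Ω(V, W)` is a smooth function for all `b^m`-vector fields `V`, `W`. -/
def IsSmooth (Ω : BmTwoForm n f m) : Prop :=
  ∀ V W : BmVectorField (n := n) f m,
    ContMDiff (𝓡 n) 𝓘(ℝ, ℝ) ∞ (fun p => Ω p ![V.val p, W.val p])

/-- Nondegeneracy on every fibre of the `b^m`-tangent bundle, the fibres over `Z` included. -/
def IsNondegenerate (Ω : BmTwoForm n f m) : Prop :=
  ∀ p : M, ∀ u : bmTangent (n := n) f m p, (∀ w : bmTangent (n := n) f m p, Ω p ![u, w] = 0) → u = 0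

/-- `Ω` is a `b^m`-symplectic form: smooth, nondegenerate and closed.  The differential of a
`b^m`-form is again a `b^m`-form, so that it vanishes iff it vanishes off the hypersurface. -/
structure IsSymplectic (Ω : BmTwoForm n f m) : Prop where
  smooth : Ω.IsSmooth
  nondegenerate : Ω.IsNondegenerate
  closed : Ω.restrict.IsClosedOn {p | f p ≠ 0}

end BmTwoForm

end Bm

/-! ### The normal form near the hypersurface -/

section NormalForm

variable {d : ℕ} {M : Type*} [TopologicalSpace M] [ChartedSpace (EuclideanSpace ℝ (Fin (d + 1))) M]
  [IsManifold (𝓡 (d + 1)) ∞ M]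
  {Z : Type*} [TopologicalSpace Z] [ChartedSpace (EuclideanSpace ℝ (Fin d)) Z]

variable (d) in
/-- `Z`, embedded in `M` by `ι`, is a hypersurface at which `f` has a transverse zero: it is the
zero set of `f`, and `df ≠ 0` at each of its points. -/
structure IsTransverseZero (ι : Z → M) (f : M → ℝ) : Prop where
  smooth : ContMDiff (𝓡 (d + 1)) 𝓘(ℝ, ℝ) ∞ f
  embedding : Manifold.IsSmoothEmbedding (𝓡 d) (𝓡 (d + 1)) ∞ ι
  range_eq : range ι = {p | f p = 0}
  transverse : ∀ z : Z, differential (n := d + 1) f (ι z) ≠ 0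

/-- The value at the point `p` of the form
`∑_{j=1}^m (df / f^j) ∧ π^* α_j + π^* β`, evaluated on the vectors `v`, `w`. -/
def laurentForm (f : M → ℝ) (m : ℕ) (π : M → Z) (α : ℕ → DiffForm d 1 Z) (β : DiffForm d 2 Z)
    (p : M) (v w : TangentSpace (𝓡 (d + 1)) p) : ℝ :=
  (∑ j ∈ Finset.Icc 1 m, (f p ^ j)⁻¹ *
    (differential f p v * α j (π p) ![mfderiv (𝓡 (d + 1)) (𝓡 d) π p w]
      - differential f p w * α j (π p) ![mfderiv (𝓡 (d + 1)) (𝓡 d) π p v]))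
  + β (π p) ![mfderiv (𝓡 (d + 1)) (𝓡 d) π p v, mfderiv (𝓡 (d + 1)) (𝓡 d) π p w]

variable (d) in
/-- A normal form of the `b^m`-form `Ω` near `Z`.  The diffeomorphism `ψ` of `U = (-ε, ε) × Z` puts
`Ω` into normal form on a possibly smaller neighbourhood `(-δ, δ) × Z`. -/
structure BmNormalForm (ι : Z → M) (f : M → ℝ) (m : ℕ) (Ω : BmTwoForm (d + 1) f m) where
  /-- the width of the neighbourhood `U = {|f| < ε}` of `Z` -/
  ε : ℝ
  ε_pos : 0 < ε
  /-- the identification of `U` with `(-ε, ε) × Z` -/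
  tube : PartialDiffeomorph (𝓡 (d + 1)) (𝓘(ℝ, ℝ).prod (𝓡 d)) M (ℝ × Z) ∞
  tube_source : tube.source = {p | |f p| < ε}
  tube_target : tube.target = Ioo (-ε) ε ×ˢ univ
  tube_fst : ∀ p ∈ tube.source, (tube p).1 = f p
  tube_zero : ∀ z : Z, tube (ι z) = (0, z)
  /-- the diffeomorphism of `U` -/
  ψ : PartialDiffeomorph (𝓡 (d + 1)) (𝓡 (d + 1)) M M ∞
  ψ_source : ψ.source = {p | |f p| < ε}
  ψ_target : ψ.target = {p | |f p| < ε}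
  /-- `ψ` preserves `Z` -/
  ψ_image : ψ '' range ι = range ι
  /-- `ψ` preserves the `m`-germ of `f`: the functions `f ∘ ψ` and `f` have the same `m`-jet
  along `Z` -/
  ψ_germ : ∃ g : M → ℝ, ContMDiffOn (𝓡 (d + 1)) 𝓘(ℝ, ℝ) ∞ g {p | |f p| < ε} ∧
    ∀ p, |f p| < ε → f (ψ p) = f p + f p ^ (m + 1) * g p
  /-- the one-forms `α_1, …, α_m` on `Z` (the other indices are not used) -/
  α : ℕ → DiffForm d 1 Z
  /-- the two-form on `Z` -/
  β : DiffForm d 2 Z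
  α_smooth : ∀ j ∈ Finset.Icc 1 m, (α j).IsSmooth
  α_closed : ∀ j ∈ Finset.Icc 1 m, (α j).IsClosedOn univ
  β_smooth : β.IsSmooth
  β_closed : β.IsClosedOn univ
  /-- the width of the neighbourhood `{|f| < δ} = (-δ, δ) × Z` on which `ψ^* Ω` is normal -/
  δ : ℝ
  δ_pos : 0 < δ
  δ_le : δ ≤ ε
  /-- `ψ^* Ω = ∑_{j=1}^m (df / f^j) ∧ π^* α_j + π^* β` on `(-δ, δ) × Z`, where `π` is the
  projection to `Z`.  An equality of `b^m`-forms is one on the dense complement of `Z`. -/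
  normal : ∀ p, |f p| < δ → f p ≠ 0 → ∀ v w : TangentSpace (𝓡 (d + 1)) p,
    Ω.restrict (ψ p) ![mfderiv (𝓡 (d + 1)) (𝓡 (d + 1)) ψ p v,
        mfderiv (𝓡 (d + 1)) (𝓡 (d + 1)) ψ p w] =
      laurentForm f m (fun q => (tube q).2) α β p v w

/-- The torus of dimension `k`. -/
abbrev Torus (k : ℕ) : Type := Fin k → Circle

/-- A smooth action of a torus on `M`. -/
def IsSmoothTorusAction (n k : ℕ) (M : Type*) [TopologicalSpace M]
    [ChartedSpace (EuclideanSpace ℝ (Fin n)) M] [MulAction (Torus k) M] : Prop :=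
  ContMDiff ((ModelWithCorners.pi (fun _ : Fin k => 𝓡 1)).prod (𝓡 n)) (𝓡 n) ∞
    (fun x : Torus k × M => x.1 • x.2)

/-- A normal form is equivariant for an action of a group `T` on `M` and on `Z`: the product
structure of `U` and the diffeomorphism `ψ` are equivariant, and the forms `α_j`, `β` are
invariant. -/
structure BmNormalForm.IsEquivariant {ι : Z → M} {f : M → ℝ} {m : ℕ} {Ω : BmTwoForm (d + 1) f m}
    (N : BmNormalForm d ι f m Ω) (T : Type*) [Group T] [MulAction T M] [MulAction T Z] : Prop where
  tube : ∀ (g : T) (p : M), |f p| < N.ε → N.tube (g • p) = ((N.tube p).1, g • (N.tube p).2)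
  ψ : ∀ (g : T) (p : M), |f p| < N.ε → N.ψ (g • p) = g • N.ψ p
  α : ∀ (g : T), ∀ j ∈ Finset.Icc 1 m, (N.α j).IsInvariantOn (fun z => g • z) univ
  β : ∀ g : T, N.β.IsInvariantOn (fun z => g • z) univ

end NormalForm

end

open scoped Topology Manifold ContDiff
open Set

universe u

noncomputable section
set_option linter.unusedSectionVars false
set_option maxSynthPendingDepth 4

/-! ### Smoothness of composition operators and of local flows -/

section Nemytskii

variable {K : Type*} [TopologicalSpace K] [CompactSpace K]
  {E : Type*} [NormedAddCommGroup E] [NormedSpace ℝ E]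
  {F : Type*} [NormedAddCommGroup F] [NormedSpace ℝ F]

/-- Pointwise evaluation of a continuous family of operators on a continuous family of vectors. -/
def ContinuousMap.pointwiseApply : C(K, E →L[ℝ] F) →L[ℝ] C(K, E) →L[ℝ] C(K, F) :=
  LinearMap.mkContinuous₂
    (LinearMap.mk₂ ℝ (fun (A : C(K, E →L[ℝ] F)) (h : C(K, E)) =>
        (⟨fun k => A k (h k), A.continuous.clm_apply h.continuous⟩ : C(K, F)))
      (fun _ _ _ => by ext; simp) (fun _ _ _ => by ext; simp)
      (fun _ _ _ => by ext; simp) (fun _ _ _ => by ext; simp)) 1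
    (fun A h => by
      rw [one_mul]
      refine (ContinuousMap.norm_le _ (by positivity)).2 fun k => ?_
      exact (A k).le_of_opNorm_le_of_le (A.norm_coe_le_norm k) (h.norm_coe_le_norm k))

@[simp] lemma ContinuousMap.pointwiseApply_apply (A : C(K, E →L[ℝ] F)) (h : C(K, E)) (k : K) :
    ContinuousMap.pointwiseApply A h k = A k (h k) := rfl

lemma hasFDerivAt_postcomp {X : C(E, F)} {X' : C(E, E →L[ℝ] F)}
    (hX : ∀ x, HasFDerivAt X (X' x) x) (γ : C(K, E)) :
    HasFDerivAt (fun γ : C(K, E) => X.comp γ) (ContinuousMap.pointwiseApply (X'.comp γ)) γ := by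
  rw [hasFDerivAt_iff_isLittleO_nhds_zero, Asymptotics.isLittleO_iff]
  intro c hc
  have hcont := (ContinuousMap.continuous_postcomp (X := K) X').continuousAt (x := γ)
  have hnhds : {η : C(K, E) | dist (X'.comp η) (X'.comp γ) < c} ∈ 𝓝 γ :=
    hcont (Metric.ball_mem_nhds (X'.comp γ) hc)
  obtain ⟨δ, hδ, H⟩ := Metric.mem_nhds_iff.1 hnhds
  filter_upwards [Metric.ball_mem_nhds (0 : C(K, E)) hδ] with h hh
  refine (ContinuousMap.norm_le _ (by positivity)).2 fun k => ?_
  have hh' : ‖h‖ < δ := by simpa using hh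
  have key : ∀ y ∈ segment ℝ (γ k) (γ k + h k), ‖X' y - X' (γ k)‖ ≤ c := by
    intro y hy
    rw [segment_eq_image'] at hy
    obtain ⟨τ, hτ, rfl⟩ := hy
    have h1 : dist (γ + τ • h) γ < δ := by
      rw [dist_eq_norm, add_sub_cancel_left, norm_smul, Real.norm_of_nonneg hτ.1]
      nlinarith [norm_nonneg h, hτ.2]
    have h2 : dist (X'.comp (γ + τ • h)) (X'.comp γ) ≤ c := (H h1).le
    have h3 := (ContinuousMap.dist_apply_le_dist k).trans h2
    rw [dist_eq_norm] at h3
    simpa using h3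
  have h4 := (convex_segment (γ k) (γ k + h k)).norm_image_sub_le_of_norm_hasFDerivWithin_le'
    (f := X) (f' := fun y => X' y) (φ := X' (γ k)) (C := c)
    (fun y _ => (hX y).hasFDerivWithinAt) key (left_mem_segment _ _ _) (right_mem_segment _ _ _)
  simp only [add_sub_cancel_left] at h4
  have h5 : ‖X (γ k + h k) - X (γ k) - X' (γ k) (h k)‖ ≤ c * ‖h‖ :=
    h4.trans (by gcongr; exact h.norm_coe_le_norm k)
  simpa using h5

lemma contDiff_postcomp_nat {K : Type*} [TopologicalSpace K] [CompactSpace K]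
    {E F : Type u} [NormedAddCommGroup E] [NormedSpace ℝ E]
    [NormedAddCommGroup F] [NormedSpace ℝ F] (n : ℕ) {X : C(E, F)} (hX : ContDiff ℝ n X) :
    ContDiff ℝ n (fun γ : C(K, E) => X.comp γ) := by
  induction n generalizing F with
  | zero => exact contDiff_zero.2 (ContinuousMap.continuous_postcomp X)
  | succ n ih =>
    push_cast at hX ⊢
    rw [contDiff_succ_iff_hasFDerivAt] at hX
    obtain ⟨X', hX', hd⟩ := hX
    rw [contDiff_succ_iff_hasFDerivAt]
    let Y : C(E, E →L[ℝ] F) := ⟨X', hX'.continuous⟩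
    have h1 : ContDiff ℝ n fun γ : C(K, E) => Y.comp γ := ih hX'
    have h2 : ContDiff ℝ n
        fun A : C(K, E →L[ℝ] F) => ContinuousMap.pointwiseApply (K := K) (E := E) (F := F) A :=
      ContinuousLinearMap.contDiff _
    exact ⟨fun γ => ContinuousMap.pointwiseApply (Y.comp γ), h2.comp h1,
      fun γ => hasFDerivAt_postcomp (X' := Y) hd γ⟩

lemma contDiff_postcomp {K : Type*} [TopologicalSpace K] [CompactSpace K]
    {E F : Type u} [NormedAddCommGroup E] [NormedSpace ℝ E]
    [NormedAddCommGroup F] [NormedSpace ℝ F] {X : C(E, F)} (hX : ContDiff ℝ ∞ X) :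
    ContDiff ℝ ∞ (fun γ : C(K, E) => X.comp γ) :=
  contDiff_infty.2 fun n => contDiff_postcomp_nat n (hX.of_le (by exact_mod_cast le_top))

end Nemytskii

section LocalFlow

/-- The implicit function of a smooth equation is smooth in a neighbourhood. -/
lemma eventually_contDiffAt_implicitFunction
    {E₁ E₂ F : Type*} [NormedAddCommGroup E₁] [NormedSpace ℝ E₁] [CompleteSpace E₁]
    [NormedAddCommGroup E₂] [NormedSpace ℝ E₂] [CompleteSpace E₂]
    [NormedAddCommGroup F] [NormedSpace ℝ F] [CompleteSpace F]
    {f : E₁ × E₂ → F} {u : E₁ × E₂} (hf : ContDiff ℝ ∞ f)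
    (hinv : (fderiv ℝ f u ∘L .inr ℝ E₁ E₂).IsInvertible) :
    ∀ᶠ x in 𝓝 u.1,
      ContDiffAt ℝ ∞ ((hf.contDiffAt (x := u)).implicitFunction (by simp) hinv) x := by
  set ψ := (hf.contDiffAt (x := u)).implicitFunction (by simp) hinv
  have hψ : ContDiffAt ℝ ∞ ψ u.1 := hf.contDiffAt.contDiffAt_implicitFunction (by simp) hinv
  have hψu : ψ u.1 = u.2 := hf.contDiffAt.implicitFunction_apply_self (by simp) hinv
  have hsol := (hf.contDiffAt (x := u)).eventually_apply_implicitFunction (by simp) hinv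
  have hone := (hψ.of_le (show (1 : WithTop ℕ∞) ≤ ∞ by exact_mod_cast le_top)).eventually (by simp)
  have hopen : ∀ᶠ v in 𝓝 u, (fderiv ℝ f v ∘L .inr ℝ E₁ E₂).IsInvertible := by
    have hc : Continuous fun v => fderiv ℝ f v ∘L .inr ℝ E₁ E₂ :=
      (hf.continuous_fderiv (by simp)).clm_comp continuous_const
    obtain ⟨e, he⟩ := hinv
    have := hc.continuousAt (x := u) (he ▸ e.nhds)
    exact this
  have hopen' : ∀ᶠ x in 𝓝 u.1, (fderiv ℝ f (x, ψ x) ∘L .inr ℝ E₁ E₂).IsInvertible := by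
    have : Filter.Tendsto (fun x => (x, ψ x)) (𝓝 u.1) (𝓝 u) := by
      have h := (continuousAt_id (x := u.1)).prodMk hψ.continuousAt
      have hu : u = (u.1, ψ u.1) := by rw [hψu]
      rw [hu]
      exact h
    exact this.eventually hopen
  filter_upwards [hsol.eventually_nhds, hone, hopen'] with x hx hx1 hx2
  have h1 := hf.contDiffAt.contDiffAt_implicitFunction (u := (x, ψ x)) (by simp) hx2
  refine h1.congr_of_eventuallyEq ?_
  have h2 := (hf.contDiffAt (x := (x, ψ x))).eventually_apply_eq_iff_implicitFunction
    (by simp) hx2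
  have h3 : Filter.Tendsto (fun x => (x, ψ x)) (𝓝 x) (𝓝 (x, ψ x)) :=
    continuousAt_id.prodMk hx1.continuousAt
  filter_upwards [hx, h3.eventually h2] with y hy hy2
  exact (hy2.1 (hy.trans hx.self_of_nhds.symm)).symm

variable {E : Type*} [NormedAddCommGroup E] [NormedSpace ℝ E]

open MeasureTheory intervalIntegral in
/-- The primitive of a continuous path on the unit interval. -/
def unitPrimitive : C(Icc (0 : ℝ) 1, E) →L[ℝ] C(Icc (0 : ℝ) 1, E) :=
  LinearMap.mkContinuous
    { toFun := fun γ => ⟨fun u => ∫ s in (0 : ℝ)..u, Set.IccExtend zero_le_one γ s, by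
        exact (continuous_primitive (fun a b => (γ.continuous.Icc_extend' ).intervalIntegrable a b)
          0).comp continuous_subtype_val⟩
      map_add' := fun γ η => by
        ext u
        simp only [ContinuousMap.coe_mk, ContinuousMap.add_apply]
        rw [← integral_add ((γ.continuous.Icc_extend').intervalIntegrable _ _)
          ((η.continuous.Icc_extend').intervalIntegrable _ _)]
        rfl
      map_smul' := fun c γ => by
        ext u
        simp only [ContinuousMap.coe_mk, ContinuousMap.smul_apply, RingHom.id_apply]
        rw [← intervalIntegral.integral_smul]
        rfl } 1
    (fun γ => by
      rw [one_mul]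
      refine (ContinuousMap.norm_le _ (norm_nonneg _)).2 fun u => ?_
      have h := norm_integral_le_of_norm_le_const (a := (0 : ℝ)) (b := u) (C := ‖γ‖)
        (f := Set.IccExtend zero_le_one γ) (fun s _ => γ.norm_coe_le_norm _)
      refine h.trans ?_
      rw [sub_zero, abs_of_nonneg u.2.1]
      nlinarith [norm_nonneg γ, u.2.2])

lemma unitPrimitive_apply (γ : C(Icc (0 : ℝ) 1, E)) (u : Icc (0 : ℝ) 1) :
    unitPrimitive γ u = ∫ s in (0 : ℝ)..u, Set.IccExtend zero_le_one γ s := rfl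

/-- Smooth dependence of the solutions of an autonomous differential equation on time and on the
initial value. -/
theorem exists_smooth_local_flow [CompleteSpace E] {X : E → E} (hX : ContDiff ℝ ∞ X) (x₀ : E) :
    ∃ φ : ℝ × E → E, ∃ r > 0, ContDiffOn ℝ ∞ φ (Ioo (-r) r ×ˢ Metric.ball x₀ r) ∧
      ∀ x ∈ Metric.ball x₀ r, φ (0, x) = x ∧
        ∀ t ∈ Ioo (-r) r, HasDerivAt (fun t => φ (t, x)) (X (φ (t, x))) t := by
  set Xc : C(E, E) := ⟨X, hX.continuous⟩
  let cst : E →L[ℝ] C(Icc (0 : ℝ) 1, E) := ContinuousLinearMap.const ℝ (Icc (0 : ℝ) 1)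
  let G : (E × ℝ) × C(Icc (0 : ℝ) 1, E) → C(Icc (0 : ℝ) 1, E) := fun p =>
    p.2 - cst p.1.1 - p.1.2 • unitPrimitive (Xc.comp p.2)
  have hXc : ContDiff ℝ ∞ (fun γ : C(Icc (0 : ℝ) 1, E) => Xc.comp γ) := contDiff_postcomp hX
  have hG : ContDiff ℝ ∞ G := by
    refine (contDiff_snd.sub (cst.contDiff.comp contDiff_fst.fst)).sub ?_
    exact contDiff_fst.snd.smul (unitPrimitive.contDiff.comp (hXc.comp contDiff_snd))
  set u : (E × ℝ) × C(Icc (0 : ℝ) 1, E) := ((x₀, 0), cst x₀)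
  have hGu : G u = 0 := by simp [G, u]
  have hinv : (fderiv ℝ G u ∘L .inr ℝ (E × ℝ) C(Icc (0 : ℝ) 1, E)).IsInvertible := by
    have h1 : HasFDerivAt (fun γ => G ((x₀, 0), γ))
        (fderiv ℝ G u ∘L .inr ℝ (E × ℝ) C(Icc (0 : ℝ) 1, E)) (cst x₀) :=
      ((hG.differentiable (by simp)) u).hasFDerivAt.comp (cst x₀) (hasFDerivAt_prodMk_right _ _)
    have h2 : HasFDerivAt (fun γ => G ((x₀, 0), γ)) (ContinuousLinearMap.id ℝ _) (cst x₀) := by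
      have : (fun γ => G ((x₀, 0), γ)) = fun γ => γ - cst x₀ := by
        funext γ; simp [G]
      rw [this]
      exact (hasFDerivAt_id _).sub_const _
    rw [h1.unique h2]
    exact ContinuousLinearMap.isInvertible_equiv (f := ContinuousLinearEquiv.refl ℝ _)
  have hGu' : ContDiffAt ℝ ∞ G u := hG.contDiffAt
  set Γ := hGu'.implicitFunction (by simp) hinv
  have hΓ : ∀ᶠ x in 𝓝 (x₀, 0), ContDiffAt ℝ ∞ Γ x :=
    eventually_contDiffAt_implicitFunction hG hinv
  have huniq := hGu'.eventually_apply_eq_iff_implicitFunction (by simp) hinv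
  rw [hGu] at huniq
  -- the solution given by the Picard–Lindelöf theorem
  obtain ⟨ε, hε, a, ρ, L, C, hρ, hpl⟩ := IsPicardLindelof.of_contDiffAt_one
    ((hX.contDiffAt (x := x₀)).of_le (show (1 : WithTop ℕ∞) ≤ ∞ by exact_mod_cast le_top))
  obtain ⟨α, hα, hαc⟩ := (hpl 0).exists_forall_mem_closedBall_eq_hasDerivWithinAt_continuousOn
  simp only [zero_sub, zero_add] at hα hαc
  have hderiv : ∀ x ∈ Metric.closedBall x₀ ρ, ∀ t ∈ Ioo (-ε) ε,
      HasDerivAt (fun t => α (x, t)) (X (α (x, t))) t := fun x hx t ht =>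
    ((hα x hx).2 t (Ioo_subset_Icc_self ht)).hasDerivAt (Icc_mem_nhds ht.1 ht.2)
  have hcont : ContinuousAt α (x₀, 0) := hαc.continuousAt
    (prod_mem_nhds (Metric.closedBall_mem_nhds _ hρ) (Icc_mem_nhds (by linarith) hε))
  have hα0 : α (x₀, 0) = x₀ := (hα x₀ (Metric.mem_closedBall_self (by exact_mod_cast hρ.le))).1
  obtain ⟨η, hη, hball⟩ := Metric.eventually_nhds_iff_ball.1 huniq
  obtain ⟨σ, hσ, hclose⟩ := Metric.continuousAt_iff.1 hcont (η / 2) (by linarith)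
  obtain ⟨τ, hτ, hsm⟩ := Metric.eventually_nhds_iff_ball.1 hΓ
  set r := min (min σ τ) (min (min ε ρ) η)
  have hr : 0 < r := by simp only [r, lt_min_iff]; exact ⟨⟨hσ, hτ⟩, ⟨hε, by exact_mod_cast hρ⟩, hη⟩
  have hrσ : r ≤ σ := (min_le_left _ _).trans (min_le_left _ _)
  have hrτ : r ≤ τ := (min_le_left _ _).trans (min_le_right _ _)
  have hrε : r ≤ ε := (min_le_right _ _).trans ((min_le_left _ _).trans (min_le_left _ _))
  have hrρ : r ≤ ρ := (min_le_right _ _).trans ((min_le_left _ _).trans (min_le_right _ _))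
  have hrη : r ≤ η := (min_le_right _ _).trans (min_le_right _ _)
  have one_mem : (1 : ℝ) ∈ Icc (0 : ℝ) 1 := ⟨zero_le_one, le_rfl⟩
  have key : ∀ t ∈ Ioo (-r) r, ∀ x ∈ Metric.ball x₀ r,
      Γ (x, t) ⟨1, one_mem⟩ = α (x, t) := by
    intro t ht x hx
    have hx' : x ∈ Metric.closedBall x₀ ρ := Metric.ball_subset_closedBall
      (Metric.ball_subset_ball hrρ hx)
    have htabs : |t| < r := abs_lt.2 ht
    have hmul : ∀ u ∈ Icc (0 : ℝ) 1, |t * u| < r := fun u hu => by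
      rw [abs_mul, abs_of_nonneg hu.1]
      nlinarith [abs_nonneg t, hu.2]
    have hd : ∀ u ∈ Icc (0 : ℝ) 1, HasDerivAt (fun u => α (x, t * u))
        (t • X (α (x, t * u))) u := fun u hu => by
      have h1 := hderiv x hx' (t * u) (abs_lt.1 ((hmul u hu).trans_le hrε))
      have h2 : HasDerivAt (fun u : ℝ => t * u) t u := by
        simpa using (hasDerivAt_id u).const_mul t
      exact h1.scomp u h2
    let γ : C(Icc (0 : ℝ) 1, E) := ⟨fun u => α (x, t * u), by
      have : ContinuousOn (fun u : ℝ => α (x, t * u)) (Icc 0 1) :=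
        fun u hu => (hd u hu).continuousAt.continuousWithinAt
      exact this.domRestrict⟩
    have hγ : G ((x, t), γ) = 0 := by
      ext u
      have hint := intervalIntegral.integral_eq_sub_of_hasDerivAt (a := 0) (b := (u : ℝ))
        (f := fun u => α (x, t * u)) (f' := fun u => t • X (α (x, t * u)))
        (fun s hs => by
          rw [uIcc_of_le u.2.1] at hs
          exact hd s ⟨hs.1, hs.2.trans u.2.2⟩)
        (by
          apply ContinuousOn.intervalIntegrable
          rw [uIcc_of_le u.2.1]
          intro s hs
          exact ((hX.continuous.continuousAt.comp
            (hd s ⟨hs.1, hs.2.trans u.2.2⟩).continuousAt).const_smul t).continuousWithinAt)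
      have hext : ∫ s in (0 : ℝ)..u, Set.IccExtend zero_le_one (Xc.comp γ) s
          = ∫ s in (0 : ℝ)..u, X (α (x, t * s)) := by
        refine intervalIntegral.integral_congr fun s hs => ?_
        rw [uIcc_of_le u.2.1] at hs
        rw [Set.IccExtend_of_mem _ _ (⟨hs.1, hs.2.trans u.2.2⟩ : s ∈ Icc (0 : ℝ) 1)]
        rfl
      rw [intervalIntegral.integral_smul, mul_zero, (hα x hx').1] at hint
      change γ u - x - t • unitPrimitive (Xc.comp γ) u = 0
      rw [unitPrimitive_apply, hext, hint]
      change α (x, t * u) - x - (α (x, t * u) - x) = 0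
      simp
    have hmem : ((x, t), γ) ∈ Metric.ball u η := by
      rw [Metric.mem_ball, Prod.dist_eq, Prod.dist_eq]
      refine max_lt (max_lt ((Metric.mem_ball.1 hx).trans_le hrη) ?_) ?_
      · change dist t 0 < η
        simpa using htabs.trans_le hrη
      · refine lt_of_le_of_lt (b := η / 2) ?_ (by linarith)
        refine (ContinuousMap.dist_le (by linarith)).2 fun u => ?_
        have : dist (x, t * (u : ℝ)) (x₀, (0 : ℝ)) < σ := by
          rw [Prod.dist_eq]
          exact max_lt ((Metric.mem_ball.1 hx).trans_le hrσ)
            (by simpa using (hmul u u.2).trans_le hrσ)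
        have := (hclose this).le
        rw [hα0] at this
        exact this
    have := (hball _ hmem).1 hγ
    change Γ (x, t) = γ at this
    rw [this]
    change α (x, t * 1) = α (x, t)
    rw [mul_one]
  refine ⟨fun p => Γ (p.2, p.1) ⟨1, one_mem⟩, r, hr, ?_, fun x hx => ⟨?_, fun t ht => ?_⟩⟩
  · rintro ⟨t, x⟩ ⟨ht, hx⟩
    have h1 : ContDiffAt ℝ ∞ Γ (x, t) := hsm _ (by
      rw [Metric.mem_ball, Prod.dist_eq]
      exact max_lt ((Metric.mem_ball.1 hx).trans_le hrτ)
        (by simpa using (abs_lt.2 ht).trans_le hrτ))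
    have h2 : ContDiffAt ℝ ∞ (fun p : ℝ × E => Γ (p.2, p.1)) (t, x) :=
      h1.comp (f := fun p : ℝ × E => (p.2, p.1)) (t, x) (contDiffAt_snd.prodMk contDiffAt_fst)
    exact ((ContinuousMap.evalCLM ℝ (⟨1, one_mem⟩ : Icc (0 : ℝ) 1)).contDiff.contDiffAt.comp
      _ h2).contDiffWithinAt
  · simp only
    rw [key 0 ⟨by linarith, hr⟩ x hx]
    exact (hα x (Metric.ball_subset_closedBall (Metric.ball_subset_ball hrρ hx))).1
  · simp only
    rw [key t ht x hx]
    refine (hderiv x (Metric.ball_subset_closedBall (Metric.ball_subset_ball hrρ hx)) t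
      ⟨by linarith [ht.1], by linarith [ht.2]⟩).congr_of_eventuallyEq ?_
    filter_upwards [Ioo_mem_nhds ht.1 ht.2] with s hs using key s hs x hx

end LocalFlow

/-! ### Smoothness of parametric integrals and of difference quotients -/

section ParametricIntegral

open MeasureTheory

variable {A : Type*} [TopologicalSpace A] [MeasurableSpace A] [OpensMeasurableSpace A]
  {B : Type*} [NormedAddCommGroup B] [NormedSpace ℝ B] {q : B → A}

lemma continuousAt_uncurry_of_isOpenQuotientMap {E G : Type*} [TopologicalSpace E]
    [TopologicalSpace G] (hq : IsOpenQuotientMap q) {F : A → E → G} {b : B} {y : E}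
    (h : ContinuousAt (fun p : B × E => F (q p.1) p.2) (b, y)) :
    ContinuousAt (fun p : A × E => F p.1 p.2) (q b, y) := by
  have ho : IsOpenQuotientMap (Prod.map q (id : E → E)) := hq.prodMap .id
  exact (ho.continuousAt_comp_iff (g := fun p : A × E => F p.1 p.2) (x := (b, y))).1 h

lemma contDiffAt_fderiv_param {E G : Type*} [NormedAddCommGroup E] [NormedSpace ℝ E]
    [NormedAddCommGroup G] [NormedSpace ℝ G] {F : B → E → G} {b : B} {y : E}
    (h : ContDiffAt ℝ ∞ (fun p : B × E => F p.1 p.2) (b, y)) :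
    ContDiffAt ℝ ∞ (fun p : B × E => fderiv ℝ (F p.1) p.2) (b, y) := by
  refine ContDiffAt.fderiv (f := fun (p : B × E) (z : E) => F p.1 z) (g := Prod.snd)
    (n := ∞) ?_ contDiffAt_snd (by simp)
  exact h.comp (f := fun p : (B × E) × E => (p.1.1, p.2)) ((b, y), y)
    (contDiffAt_fst.fst.prodMk contDiffAt_snd)

/-- Differentiation under the integral sign, over a compact set of parameters. -/
lemma hasFDerivAt_setIntegral_param {E G : Type*} [NormedAddCommGroup E] [NormedSpace ℝ E]
    [NormedAddCommGroup G] [NormedSpace ℝ G] {μ : Measure A} [IsFiniteMeasureOnCompacts μ]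
    {K : Set A} (hK : IsCompact K) (hKm : MeasurableSet K)
    (hq : IsOpenQuotientMap q) {F : A → E → G} {U : Set E} (hU : IsOpen U)
    (hF : ∀ b, q b ∈ K → ∀ y ∈ U, ContDiffAt ℝ ∞ (fun p : B × E => F (q p.1) p.2) (b, y))
    {y : E} (hy : y ∈ U) :
    HasFDerivAt (fun y => ∫ a in K, F a y ∂μ) (∫ a in K, fderiv ℝ (F a) y ∂μ) y := by
  have hcF : ∀ a ∈ K, ∀ y ∈ U, ContinuousAt (fun p : A × E => F p.1 p.2) (a, y) := by
    intro a ha y hy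
    obtain ⟨b, rfl⟩ := hq.surjective a
    exact continuousAt_uncurry_of_isOpenQuotientMap hq (hF b ha y hy).continuousAt
  have hcF' : ∀ a ∈ K, ∀ y ∈ U, ContinuousAt (fun p : A × E => fderiv ℝ (F p.1) p.2) (a, y) := by
    intro a ha y hy
    obtain ⟨b, rfl⟩ := hq.surjective a
    exact continuousAt_uncurry_of_isOpenQuotientMap (F := fun a y => fderiv ℝ (F a) y) hq
      (contDiffAt_fderiv_param (F := fun b => F (q b)) (hF b ha y hy)).continuousAt
  have hon : ∀ y ∈ U, ContinuousOn (fun a => F a y) K := fun y hy a ha =>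
    (ContinuousAt.comp (f := fun a => (a, y)) (hcF a ha y hy)
      (Continuous.prodMk_left _).continuousAt).continuousWithinAt
  have hon' : ContinuousOn (fun a => fderiv ℝ (F a) y) K := fun a ha =>
    (ContinuousAt.comp (f := fun a => (a, y)) (hcF' a ha y hy)
      (Continuous.prodMk_left _).continuousAt).continuousWithinAt
  obtain ⟨C, hC⟩ := hK.exists_bound_of_continuousOn hon'
  have hbound : ∀ᶠ z in 𝓝 y, ∀ a ∈ K, ‖fderiv ℝ (F a) z‖ < C + 1 := by
    refine hK.eventually_forall_of_forall_eventually fun a ha => ?_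
    have h1 := (hcF' a ha y hy).norm.eventually_lt (continuousAt_const (y := C + 1))
      (by simpa using (hC a ha).trans_lt (lt_add_one C))
    exact (continuous_swap.tendsto (y, a)).eventually h1
  refine hasFDerivAt_integral_of_dominated_of_fderiv_le (F := fun y a => F a y)
    (F' := fun y a => fderiv ℝ (F a) y) (bound := fun _ => C + 1)
    (s := {z | z ∈ U ∧ ∀ a ∈ K, ‖fderiv ℝ (F a) z‖ < C + 1})
    ((hU.eventually_mem hy).and hbound) ?_ ?_ ?_ ?_ ?_ ?_
  · filter_upwards [hU.eventually_mem hy] with z hz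
    exact (hon z hz).aestronglyMeasurable_of_isCompact hK hKm
  · exact (hon y hy).integrableOn_compact' hK hKm
  · exact hon'.aestronglyMeasurable_of_isCompact hK hKm
  · filter_upwards [ae_restrict_mem hKm] with a ha z hz using (hz.2 a ha).le
  · exact integrableOn_const hK.measure_lt_top.ne
  · filter_upwards [ae_restrict_mem hKm] with a ha z hz
    obtain ⟨b, rfl⟩ := hq.surjective a
    have h1 : ContDiffAt ℝ ∞ (F (q b)) z := (hF b ha z hz.1).comp (f := fun z => (b, z)) z
      (contDiffAt_const.prodMk contDiffAt_id)
    exact (h1.differentiableAt (by simp)).hasFDerivAt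

/-- The integral over a compact set of parameters of a jointly smooth function is smooth.  The
parameter space is presented as an open quotient of a normed space. -/
theorem contDiffOn_setIntegral_param {E G : Type u} [NormedAddCommGroup E] [NormedSpace ℝ E]
    [NormedAddCommGroup G] [NormedSpace ℝ G] {μ : Measure A} [IsFiniteMeasureOnCompacts μ]
    {K : Set A} (hK : IsCompact K) (hKm : MeasurableSet K)
    (hq : IsOpenQuotientMap q) {F : A → E → G} {U : Set E} (hU : IsOpen U)
    (hF : ∀ b, q b ∈ K → ∀ y ∈ U, ContDiffAt ℝ ∞ (fun p : B × E => F (q p.1) p.2) (b, y)) :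
    ContDiffOn ℝ ∞ (fun y => ∫ a in K, F a y ∂μ) U := by
  rw [contDiffOn_infty]
  intro n
  induction n generalizing G with
  | zero =>
    refine contDiffOn_zero.2 fun y hy => ?_
    exact (hasFDerivAt_setIntegral_param hK hKm hq hU hF hy).continuousAt.continuousWithinAt
  | succ n ih =>
    push_cast
    rw [contDiffOn_succ_iff_fderiv_of_isOpen hU]
    refine ⟨fun y hy => (hasFDerivAt_setIntegral_param hK hKm hq hU hF
      hy).differentiableAt.differentiableWithinAt, by simp, ?_⟩
    refine ContDiffOn.congr (ih (F := fun a y => fderiv ℝ (F a) y) fun b hb y hy => ?_)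
      fun y hy => (hasFDerivAt_setIntegral_param hK hKm hq hU hF hy).fderiv
    exact contDiffAt_fderiv_param (F := fun b => F (q b)) (hF b hb y hy)

/-- The integral over the unit interval of a jointly smooth function is smooth. -/
theorem contDiffOn_unitIntegral {E G : Type u} [NormedAddCommGroup E] [NormedSpace ℝ E]
    [NormedAddCommGroup G] [NormedSpace ℝ G] {F : ℝ → E → G} {U : Set E} (hU : IsOpen U)
    (hF : ∀ s ∈ Icc (0 : ℝ) 1, ∀ y ∈ U, ContDiffAt ℝ ∞ (fun p : ℝ × E => F p.1 p.2) (s, y)) :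
    ContDiffOn ℝ ∞ (fun y => ∫ s in (0 : ℝ)..1, F s y) U := by
  have h := contDiffOn_setIntegral_param (μ := volume) isCompact_Icc measurableSet_Icc
    IsOpenQuotientMap.id hU hF
  refine h.congr fun y _ => ?_
  rw [intervalIntegral.integral_of_le zero_le_one, integral_Icc_eq_integral_Ioc]

lemma hasFDerivAt_unitIntegral {E G : Type*} [NormedAddCommGroup E] [NormedSpace ℝ E]
    [NormedAddCommGroup G] [NormedSpace ℝ G] {F : ℝ → E → G} {U : Set E} (hU : IsOpen U)
    (hF : ∀ s ∈ Icc (0 : ℝ) 1, ∀ y ∈ U, ContDiffAt ℝ ∞ (fun p : ℝ × E => F p.1 p.2) (s, y))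
    {y : E} (hy : y ∈ U) :
    HasFDerivAt (fun y => ∫ s in (0 : ℝ)..1, F s y) (∫ s in (0 : ℝ)..1, fderiv ℝ (F s) y) y := by
  have h := hasFDerivAt_setIntegral_param (μ := volume) isCompact_Icc measurableSet_Icc
    IsOpenQuotientMap.id hU hF hy
  simp only [intervalIntegral.integral_of_le zero_le_one, ← integral_Icc_eq_integral_Ioc]
  exact h

end ParametricIntegral

section Hadamard

variable {X G : Type u} [NormedAddCommGroup X] [NormedSpace ℝ X]
  [NormedAddCommGroup G] [NormedSpace ℝ G]

lemma dslope_zero_eq_integral [CompleteSpace G] {f : ℝ → G} {ε t : ℝ} (hf : ContDiffOn ℝ ∞ f (Ioo (-ε) ε))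
    (ht : t ∈ Ioo (-ε) ε) : dslope f 0 t = ∫ s in (0 : ℝ)..1, deriv f (s * t) := by
  have hmem : ∀ s ∈ Icc (0 : ℝ) 1, s * t ∈ Ioo (-ε) ε := fun s hs => by
    rw [mem_Ioo, ← abs_lt] at ht ⊢
    rw [abs_mul, abs_of_nonneg hs.1]
    nlinarith [abs_nonneg t, hs.2]
  have hd : ∀ s ∈ Icc (0 : ℝ) 1, HasDerivAt f (deriv f (s * t)) (s * t) := fun s hs =>
    ((hf.contDiffAt (isOpen_Ioo.mem_nhds (hmem s hs))).differentiableAt (by simp)).hasDerivAt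
  rcases eq_or_ne t 0 with rfl | h0
  · simp
  · have hint := intervalIntegral.integral_eq_sub_of_hasDerivAt (a := 0) (b := 1)
      (f := fun s => f (s * t)) (f' := fun s => t • deriv f (s * t))
      (fun s hs => by
        rw [uIcc_of_le zero_le_one] at hs
        have h2 : HasDerivAt (fun s : ℝ => s * t) t s := by simpa using (hasDerivAt_id s).mul_const t
        exact (hd s hs).scomp s h2)
      (by
        apply ContinuousOn.intervalIntegrable
        rw [uIcc_of_le zero_le_one]
        have h1 : ContinuousOn (deriv f) (Ioo (-ε) ε) :=
          hf.continuousOn_deriv_of_isOpen isOpen_Ioo (by simp)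
        exact continuousOn_const.smul (h1.comp (by fun_prop) hmem))
    rw [intervalIntegral.integral_smul, one_mul, zero_mul] at hint
    rw [dslope_of_ne _ h0, slope_def_module, sub_zero, ← hint, smul_smul, inv_mul_cancel₀ h0,
      one_smul]

/-- Hadamard's lemma with parameters. -/
theorem contDiffOn_dslope_param [CompleteSpace G] {f : ℝ × X → G} {ε : ℝ} {U : Set X} (hU : IsOpen U)
    (hf : ContDiffOn ℝ ∞ f (Ioo (-ε) ε ×ˢ U)) :
    ContDiffOn ℝ ∞ (fun p : ℝ × X => dslope (fun s => f (s, p.2)) 0 p.1) (Ioo (-ε) ε ×ˢ U) := by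
  have hopen : IsOpen (Ioo (-ε) ε ×ˢ U) := isOpen_Ioo.prod hU
  have hf1 : ContDiffOn ℝ ∞ (fun p => fderiv ℝ f p (1, 0)) (Ioo (-ε) ε ×ˢ U) :=
    (hf.fderiv_of_isOpen hopen (by simp)).clm_apply contDiffOn_const
  have h := contDiffOn_unitIntegral (F := fun s (p : ℝ × X) => fderiv ℝ f (s * p.1, p.2) (1, 0))
    hopen (by
      rintro s hs ⟨t, x⟩ ⟨ht, hx⟩
      have hmem : (s * t, x) ∈ Ioo (-ε) ε ×ˢ U := by
        refine ⟨?_, hx⟩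
        simp only [mem_Ioo, ← abs_lt] at ht ⊢
        rw [abs_mul, abs_of_nonneg hs.1]
        nlinarith [abs_nonneg t, hs.2]
      refine ContDiffAt.comp (g := fun p => fderiv ℝ f p (1, 0))
        (f := fun p : ℝ × (ℝ × X) => (p.1 * p.2.1, p.2.2)) (s, (t, x))
        (hf1.contDiffAt (hopen.mem_nhds hmem)) ?_
      exact (contDiffAt_fst.mul contDiffAt_snd.fst).prodMk contDiffAt_snd.snd)
  refine h.congr ?_
  rintro ⟨t, x⟩ ⟨ht, hx⟩
  have hsec : ContDiffOn ℝ ∞ (fun s => f (s, x)) (Ioo (-ε) ε) :=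
    hf.comp (contDiffOn_id.prodMk contDiffOn_const) fun s hs => ⟨hs, hx⟩
  simp only
  rw [dslope_zero_eq_integral hsec ht]
  refine intervalIntegral.integral_congr fun s hs => ?_
  rw [uIcc_of_le zero_le_one] at hs
  have hmem : s * t ∈ Ioo (-ε) ε := by
    simp only [mem_Ioo, ← abs_lt] at ht ⊢
    rw [abs_mul, abs_of_nonneg hs.1]
    nlinarith [abs_nonneg t, hs.2]
  have h0 : DifferentiableAt ℝ f (s * t, x) :=
    (hf.contDiffAt (hopen.mem_nhds (show (s * t, x) ∈ _ from ⟨hmem, hx⟩))).differentiableAt (by simp)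
  have h1 := h0.hasFDerivAt.comp_hasDerivAt (f := fun s => (s, x)) (s * t)
    ((hasDerivAt_id (s * t)).prodMk (hasDerivAt_const (s * t) x))
  exact h1.deriv

lemma sub_eq_smul_dslope_zero (f : ℝ → G) (t : ℝ) : f t = f 0 + t • dslope f 0 t := by
  have := sub_smul_dslope f 0 t
  rw [sub_zero] at this
  rw [this]; abel

end Hadamard

section FiniteDim

/-- A map to a finite dimensional space is smooth if its values under an injective linear map are. -/
lemma contDiffOn_of_injective_comp {X G ι : Type*} [NormedAddCommGroup X] [NormedSpace ℝ X]
    [NormedAddCommGroup G] [NormedSpace ℝ G] [Finite ι] (L : ι → G →ₗ[ℝ] ℝ)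
    (hL : ∀ x, (∀ i, L i x = 0) → x = 0) {f : X → G} {s : Set X} {n : WithTop ℕ∞}
    (hf : ∀ i, ContDiffOn ℝ n (fun x => L i (f x)) s) : ContDiffOn ℝ n f s := by
  have := Fintype.ofFinite ι
  obtain ⟨R, hR⟩ := (LinearMap.pi L).exists_leftInverse_of_injective (by
    rw [LinearMap.ker_eq_bot']
    intro x hx
    exact hL x fun i => congrFun hx i)
  have h1 : ContDiffOn ℝ n (fun x i => L i (f x)) s := contDiffOn_pi.2 hf
  have h2 := (LinearMap.toContinuousLinearMap R).contDiff.comp_contDiffOn h1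
  refine h2.congr fun x _ => ?_
  exact (LinearMap.congr_fun hR (f x)).symm

end FiniteDim

/-! ### Vector fields on manifolds and their flows -/

namespace PartialDiffeomorph

variable {E : Type*} [NormedAddCommGroup E] [NormedSpace ℝ E]
  {F : Type*} [NormedAddCommGroup F] [NormedSpace ℝ F]
  {H₁ : Type*} [TopologicalSpace H₁] {H₂ : Type*} [TopologicalSpace H₂]
  {I : ModelWithCorners ℝ E H₁} {J : ModelWithCorners ℝ F H₂}
  {M : Type*} [TopologicalSpace M] [ChartedSpace H₁ M]
  {N : Type*} [TopologicalSpace N] [ChartedSpace H₂ N]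

lemma contMDiffAt (Φ : PartialDiffeomorph I J M N ∞) {x : M} (hx : x ∈ Φ.source) :
    ContMDiffAt I J ∞ Φ x := Φ.contMDiffOn_toFun.contMDiffAt (Φ.open_source.mem_nhds hx)

lemma mdifferentiableAt' (Φ : PartialDiffeomorph I J M N ∞) {x : M} (hx : x ∈ Φ.source) :
    MDifferentiableAt I J Φ x := Φ.mdifferentiableAt (by simp) hx

lemma symm_apply_apply (Φ : PartialDiffeomorph I J M N ∞) {x : M} (hx : x ∈ Φ.source) :
    Φ.symm (Φ x) = x := Φ.left_inv hx

lemma apply_symm_apply (Φ : PartialDiffeomorph I J M N ∞) {y : N} (hy : y ∈ Φ.target) :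
    Φ (Φ.symm y) = y := Φ.right_inv hy

lemma mfderiv_symm_comp (Φ : PartialDiffeomorph I J M N ∞) {x : M} (hx : x ∈ Φ.source) :
    (mfderiv J I Φ.symm (Φ x)).comp (mfderiv I J Φ x) = ContinuousLinearMap.id ℝ _ := by
  have h := mfderiv_comp x (Φ.symm.mdifferentiableAt' (x := Φ x) (Φ.map_source hx))
    (Φ.mdifferentiableAt' hx)
  rw [← h]
  have h2 : (Φ.symm ∘ Φ) =ᶠ[𝓝 x] id := by
    filter_upwards [Φ.open_source.mem_nhds hx] with y hy using Φ.left_inv hy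
  rw [h2.mfderiv_eq, mfderiv_id]

lemma mfderiv_comp_symm (Φ : PartialDiffeomorph I J M N ∞) {x : M} (hx : x ∈ Φ.source) :
    (mfderiv I J Φ x).comp (mfderiv J I Φ.symm (Φ x)) = ContinuousLinearMap.id ℝ _ := by
  have hx' : MDifferentiableAt I J Φ (Φ.symm (Φ x)) := by
    rw [Φ.symm_apply_apply hx]; exact Φ.mdifferentiableAt' hx
  have h := mfderiv_comp (Φ x) hx' (Φ.symm.mdifferentiableAt' (x := Φ x) (Φ.map_source hx))
  have h2 : (Φ ∘ Φ.symm) =ᶠ[𝓝 (Φ x)] id := by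
    filter_upwards [Φ.open_target.mem_nhds (Φ.map_source hx)] with y hy using Φ.right_inv hy
  rw [h2.mfderiv_eq, mfderiv_id, Φ.symm_apply_apply hx] at h
  exact h.symm

lemma isInvertible_mfderiv (Φ : PartialDiffeomorph I J M N ∞) {x : M} (hx : x ∈ Φ.source) :
    (mfderiv I J Φ x).IsInvertible :=
  .of_inverse (Φ.mfderiv_comp_symm hx) (Φ.mfderiv_symm_comp hx)

lemma mfderiv_symm_apply (Φ : PartialDiffeomorph I J M N ∞) {x : M} (hx : x ∈ Φ.source)
    (v : TangentSpace I x) : mfderiv J I Φ.symm (Φ x) (mfderiv I J Φ x v) = v :=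
  DFunLike.congr_fun (Φ.mfderiv_symm_comp hx) v

lemma mfderiv_apply_symm (Φ : PartialDiffeomorph I J M N ∞) {x : M} (hx : x ∈ Φ.source)
    (v : TangentSpace J (Φ x)) : mfderiv I J Φ x (mfderiv J I Φ.symm (Φ x) v) = v :=
  DFunLike.congr_fun (Φ.mfderiv_comp_symm hx) v

end PartialDiffeomorph

section Chart

variable {E : Type*} [NormedAddCommGroup E] [NormedSpace ℝ E]
  {H : Type*} [TopologicalSpace H] (I : ModelWithCorners ℝ E H) [I.Boundaryless]
  {P : Type*} [TopologicalSpace P] [ChartedSpace H P] [IsManifold I ∞ P]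

/-- The inverse of the preferred extended chart, as a partial diffeomorphism. -/
def chartParam (p₀ : P) : PartialDiffeomorph 𝓘(ℝ, E) I E P ∞ where
  toPartialEquiv := (extChartAt I p₀).symm
  open_source := isOpen_extChartAt_target p₀
  open_target := isOpen_extChartAt_source p₀
  contMDiffOn_toFun := contMDiffOn_extChartAt_symm p₀
  contMDiffOn_invFun := by
    have h := contMDiffOn_extChartAt (I := I) (n := ∞) (x := p₀)
    rwa [← extChartAt_source I] at h

lemma chartParam_coe (p₀ : P) : (chartParam I p₀ : E → P) = (extChartAt I p₀).symm := rfl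

lemma chartParam_source (p₀ : P) : (chartParam I p₀).source = (extChartAt I p₀).target := rfl

end Chart

section VectorField

variable {E : Type*} [NormedAddCommGroup E] [NormedSpace ℝ E] [CompleteSpace E]
  {H : Type*} [TopologicalSpace H] {I : ModelWithCorners ℝ E H}
  {P : Type*} [TopologicalSpace P] [ChartedSpace H P] [IsManifold I ∞ P]
  {F : Type*} [NormedAddCommGroup F] [NormedSpace ℝ F] [CompleteSpace F]

/-- A vector field is smooth if its expression in a local parametrization is. -/
lemma contMDiffAt_vectorField_of_param {X : (p : P) → TangentSpace I p}
    (k : PartialDiffeomorph 𝓘(ℝ, F) I F P ∞) {x₀ : F} (hx₀ : x₀ ∈ k.source) {Y : F → F}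
    (hY : ContDiffAt ℝ ∞ Y x₀)
    (hXY : ∀ᶠ x in 𝓝 x₀, X (k x) = mfderiv 𝓘(ℝ, F) I k x (Y x)) :
    ContMDiffAt I I.tangent ∞ (fun p => (⟨p, X p⟩ : TangentBundle I P)) (k x₀) := by
  have hk : k x₀ ∈ k.symm.source := k.map_source hx₀
  have h1 : ContMDiffAt 𝓘(ℝ, F) 𝓘(ℝ, F).tangent ∞
      (fun x => (⟨x, Y x⟩ : TangentBundle 𝓘(ℝ, F) F)) (k.symm (k x₀)) := by
    rw [k.symm_apply_apply hx₀]
    exact contMDiffAt_vectorSpace_iff_contDiffAt.2 hY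
  have h2 := ContMDiffAt.mpullback_vectorField_preimage (f := k.symm) (x₀ := k x₀) (n := ∞)
    h1 (k.symm.contMDiffAt hk) (k.symm.isInvertible_mfderiv hk) (by simp)
  refine h2.congr_of_eventuallyEq ?_
  have h3 : Filter.Tendsto k.symm (𝓝 (k x₀)) (𝓝 x₀) := by
    have := (k.symm.contMDiffAt hk).continuousAt
    rw [ContinuousAt, k.symm_apply_apply hx₀] at this
    exact this
  filter_upwards [h3.eventually hXY, k.open_target.mem_nhds hk] with p hp hpt
  have h4 : k (k.symm p) = p := k.apply_symm_apply hpt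
  have hps : k.symm p ∈ k.source := k.map_target hpt
  change (⟨p, X p⟩ : TangentBundle I P)
    = ⟨p, (mfderiv I 𝓘(ℝ, F) k.symm p).inverse (Y (k.symm p))⟩
  have h5 := k.mfderiv_comp_symm hps
  have h6 := k.mfderiv_symm_comp hps
  rw [h4] at hp h5 h6
  rw [ContinuousLinearMap.inverse_eq h6 h5]
  exact congrArg (fun v => (⟨p, v⟩ : TangentBundle I P)) hp

/-- The expression of a smooth vector field in a local parametrization is smooth. -/
lemma contDiffAt_param_of_vectorField {X : (p : P) → TangentSpace I p}
    (k : PartialDiffeomorph 𝓘(ℝ, F) I F P ∞) {x₀ : F} (hx₀ : x₀ ∈ k.source)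
    (hX : ContMDiffAt I I.tangent ∞ (fun p => (⟨p, X p⟩ : TangentBundle I P)) (k x₀)) :
    ContDiffAt ℝ ∞ (fun x => (VectorField.mpullback 𝓘(ℝ, F) I k X x : F)) x₀ :=
  contMDiffAt_vectorSpace_iff_contDiffAt.1 (ContMDiffAt.mpullback_vectorField_preimage (n := ∞)
    hX (k.contMDiffAt hx₀) (k.isInvertible_mfderiv hx₀) (by simp))

lemma mfderiv_mpullback (X : (p : P) → TangentSpace I p)
    (k : PartialDiffeomorph 𝓘(ℝ, F) I F P ∞) {x : F} (hx : x ∈ k.source) :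
    mfderiv 𝓘(ℝ, F) I k x (VectorField.mpullback 𝓘(ℝ, F) I k X x) = X (k x) := by
  rw [VectorField.mpullback_apply]
  obtain ⟨e, he⟩ := k.isInvertible_mfderiv hx
  rw [← he, ContinuousLinearMap.inverse_equiv]
  exact e.apply_symm_apply _

end VectorField

section Flow

variable {E : Type*} [NormedAddCommGroup E] [NormedSpace ℝ E] [FiniteDimensional ℝ E]
  {H : Type*} [TopologicalSpace H] {I : ModelWithCorners ℝ E H} [I.Boundaryless]
  {P : Type*} [TopologicalSpace P] [ChartedSpace H P] [IsManifold I ∞ P]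

/-- Existence of a smooth local flow around each point. -/
lemma exists_local_flow {X : (p : P) → TangentSpace I p}
    (hX : ContMDiff I I.tangent ∞ (fun p => (⟨p, X p⟩ : TangentBundle I P))) (p₀ : P) :
    ∃ r > 0, ∃ N : Set P, IsOpen N ∧ p₀ ∈ N ∧ ∃ φ : ℝ → P → P,
      ContMDiffOn (𝓘(ℝ, ℝ).prod I) I ∞ (fun x : ℝ × P => φ x.1 x.2) (Ioo (-r) r ×ˢ N) ∧
      ∀ p ∈ N, φ 0 p = p ∧ IsMIntegralCurveOn (fun t => φ t p) X (Ioo (-r) r) := by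
  have := FiniteDimensional.complete ℝ E
  set k := chartParam I p₀
  set x₀ : E := extChartAt I p₀ p₀
  have hx₀ : x₀ ∈ k.source := mem_extChartAt_target p₀
  have hkx₀ : k x₀ = p₀ := extChartAt_to_inv p₀
  obtain ⟨R, hR, hRk⟩ := Metric.isOpen_iff.1 k.open_source x₀ hx₀
  let ρ : ContDiffBump x₀ := ⟨R / 4, R / 2, by linarith, by linarith⟩
  let Xk : E → E := VectorField.mpullback 𝓘(ℝ, E) I k X
  have hXk : ∀ x ∈ k.source, ContDiffAt ℝ ∞ Xk x := fun x hx =>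
    contDiffAt_param_of_vectorField k hx (hX (k x))
  have hY : ContDiff ℝ ∞ (fun x => ρ x • Xk x) := by
    rw [contDiff_iff_contDiffAt]
    intro x
    by_cases hx : x ∈ k.source
    · exact ρ.contDiff.contDiffAt.smul (hXk x hx)
    · have hx' : x ∉ tsupport ρ := fun h => hx (hRk (by
        rw [ρ.tsupport_eq] at h
        exact Metric.closedBall_subset_ball (by change R / 2 < R; linarith) h))
      have h0 : (fun x => ρ x • Xk x) =ᶠ[𝓝 x] fun _ => 0 := by
        filter_upwards [notMem_tsupport_iff_eventuallyEq.1 hx'] with y hy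
        rw [hy]; simp
      exact contDiffAt_const.congr_of_eventuallyEq h0
  obtain ⟨φ, r₁, hr₁, hφ, hφd⟩ := exists_smooth_local_flow hY x₀
  have hopen : IsOpen (Ioo (-r₁) r₁ ×ˢ Metric.ball x₀ r₁) := isOpen_Ioo.prod Metric.isOpen_ball
  have hmem₀ : ((0 : ℝ), x₀) ∈ Ioo (-r₁) r₁ ×ˢ Metric.ball x₀ r₁ :=
    ⟨⟨by linarith, hr₁⟩, Metric.mem_ball_self hr₁⟩
  have hφc : ContinuousAt φ (0, x₀) := (hφ.contDiffAt (hopen.mem_nhds hmem₀)).continuousAt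
  have hφ0 : φ (0, x₀) = x₀ := (hφd x₀ (Metric.mem_ball_self hr₁)).1
  obtain ⟨r₂, hr₂, hclose⟩ := Metric.continuousAt_iff.1 hφc (R / 4) (by linarith)
  set r := min (min r₁ r₂) (R / 4)
  have hr : 0 < r := by simp only [r, lt_min_iff]; exact ⟨⟨hr₁, hr₂⟩, by linarith⟩
  have hrr₁ : r ≤ r₁ := (min_le_left _ _).trans (min_le_left _ _)
  have hrr₂ : r ≤ r₂ := (min_le_left _ _).trans (min_le_right _ _)
  have hrR : r ≤ R / 4 := min_le_right _ _
  have hstay : ∀ t ∈ Ioo (-r) r, ∀ x ∈ Metric.ball x₀ r, φ (t, x) ∈ Metric.ball x₀ (R / 4) := by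
    intro t ht x hx
    have : dist (t, x) ((0 : ℝ), x₀) < r₂ := by
      rw [Prod.dist_eq]
      exact max_lt (by simpa using (abs_lt.2 ht).trans_le hrr₂) ((Metric.mem_ball.1 hx).trans_le hrr₂)
    have := hclose this
    rwa [hφ0] at this
  have hballk : Metric.ball x₀ (R / 4) ⊆ k.source :=
    (Metric.ball_subset_ball (by linarith)).trans hRk
  have hN : IsOpen (k.target ∩ k.symm ⁻¹' Metric.ball x₀ r) :=
    k.symm.toOpenPartialHomeomorph.isOpen_inter_preimage Metric.isOpen_ball
  refine ⟨r, hr, k.target ∩ k.symm ⁻¹' Metric.ball x₀ r, hN,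
    ⟨hkx₀ ▸ k.map_source hx₀, ?_⟩, fun t p => k (φ (t, k.symm p)), ?_, ?_⟩
  · change k.symm p₀ ∈ Metric.ball x₀ r
    rw [← hkx₀, k.symm_apply_apply hx₀]
    exact Metric.mem_ball_self hr
  · have h1 : ContMDiffOn (𝓘(ℝ, ℝ).prod I) 𝓘(ℝ, ℝ × E) ∞ (fun x : ℝ × P => (x.1, k.symm x.2))
        (Ioo (-r) r ×ˢ (k.target ∩ k.symm ⁻¹' Metric.ball x₀ r)) := by
      refine ContMDiffOn.prodMk_space contMDiff_fst.contMDiffOn ?_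
      exact k.symm.contMDiffOn_toFun.comp contMDiff_snd.contMDiffOn fun x hx => hx.2.1
    have h2 := (hφ.contMDiffOn).comp h1 (fun x hx =>
      ⟨⟨by linarith [hx.1.1], by linarith [hx.1.2]⟩, Metric.ball_subset_ball hrr₁ hx.2.2⟩)
    exact k.contMDiffOn_toFun.comp h2 fun x hx => hballk (hstay _ hx.1 _ hx.2.2)
  · rintro p ⟨hp, hpr⟩
    have hpr₁ : k.symm p ∈ Metric.ball x₀ r₁ := Metric.ball_subset_ball hrr₁ hpr
    refine ⟨?_, fun t ht => ?_⟩
    · change k (φ (0, k.symm p)) = p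
      rw [(hφd _ hpr₁).1, k.apply_symm_apply hp]
    · have hb := hstay t ht _ hpr
      have hd := (hφd _ hpr₁).2 t ⟨by linarith [ht.1], by linarith [ht.2]⟩
      have hρ1 : ρ (φ (t, k.symm p)) = 1 :=
        ρ.one_of_mem_closedBall (Metric.ball_subset_closedBall hb)
      simp only [hρ1, one_smul] at hd
      have h1 := (k.mdifferentiableAt' (hballk hb)).hasMFDerivAt.comp t
        (hasMFDerivAt_iff_hasFDerivAt.2 hd.hasFDerivAt)
      refine HasMFDerivAt.hasMFDerivWithinAt ?_
      have h3 : (ContinuousLinearMap.smulRight (1 : ℝ →L[ℝ] ℝ) (X (k (φ (t, k.symm p)))) :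
            ℝ →L[ℝ] E) = (mfderiv 𝓘(ℝ, E) I k (φ (t, k.symm p))).comp
            (ContinuousLinearMap.toSpanSingleton ℝ (Xk (φ (t, k.symm p)))) := by
        refine ContinuousLinearMap.ext_ring ?_
        change (1 : ℝ) • (X (k (φ (t, k.symm p))) : E)
          = mfderiv 𝓘(ℝ, E) I k (φ (t, k.symm p)) ((1 : ℝ) • Xk (φ (t, k.symm p)))
        rw [one_smul, one_smul]
        exact (mfderiv_mpullback X k (hballk hb)).symm
      exact (congrArg (HasMFDerivAt 𝓘(ℝ, ℝ) I (fun t => k (φ (t, k.symm p))) t) h3).mpr h1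

variable [T2Space P]

/-- A smooth vector field with compact support on a Hausdorff manifold without boundary has a
smooth global flow. -/
theorem exists_smooth_flow {X : (p : P) → TangentSpace I p}
    (hX : ContMDiff I I.tangent ∞ (fun p => (⟨p, X p⟩ : TangentBundle I P)))
    {K : Set P} (hK : IsCompact K) (hXK : ∀ p ∉ K, X p = 0) :
    ∃ φ : ℝ → P → P, (∀ p, φ 0 p = p) ∧ (∀ p, IsMIntegralCurve (fun t => φ t p) X) ∧
      (∀ s t p, φ (s + t) p = φ s (φ t p)) ∧
      ContMDiff (𝓘(ℝ, ℝ).prod I) I ∞ (fun x : ℝ × P => φ x.1 x.2) := by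
  have := FiniteDimensional.complete ℝ E
  have hX1 : ContMDiff I I.tangent 1 (fun p => (⟨p, X p⟩ : TangentBundle I P)) :=
    hX.of_le (by exact_mod_cast le_top)
  choose r hr N hN hpN φl hφl hφlc using exists_local_flow hX
  obtain ⟨T, hT⟩ := hK.elim_finite_subcover N hN (fun p _ => mem_iUnion.2 ⟨p, hpN p⟩)
  obtain ⟨ε, hε, hεr⟩ : ∃ ε > 0, ∀ p ∈ T, ε ≤ r p := by
    rcases T.eq_empty_or_nonempty with rfl | hne
    · exact ⟨1, one_pos, by simp⟩
    · obtain ⟨q, hq, hmin⟩ := T.exists_min_image r hne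
      exact ⟨r q, hr q, hmin⟩
  have hconst : ∀ p ∉ K, IsMIntegralCurve (fun _ : ℝ => p) X := fun p hp =>
    isMIntegralCurve_const (hXK p hp)
  have hcover : ∀ p ∈ K, ∃ q ∈ T, p ∈ N q := fun p hp => by
    simpa using hT hp
  have hex : ∀ p, ∃ γ : ℝ → P, γ 0 = p ∧ IsMIntegralCurve γ X := by
    refine exists_isMIntegralCurve_of_isMIntegralCurveOn hX1 hε fun p => ?_
    by_cases hp : p ∈ K
    · obtain ⟨q, hq, hpq⟩ := hcover p hp
      exact ⟨_, (hφlc q p hpq).1, (hφlc q p hpq).2.mono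
        (Ioo_subset_Ioo (neg_le_neg (hεr q hq)) (hεr q hq))⟩
    · exact ⟨_, rfl, (hconst p hp).isMIntegralCurveOn _⟩
  choose γ hγ0 hγ using hex
  have hadd : ∀ s t p, γ p (s + t) = γ (γ p t) s := fun s t p => by
    have := isMIntegralCurve_Ioo_eq_of_contMDiff_boundaryless (t₀ := 0) hX1
      ((hγ p).comp_add t) (hγ (γ p t)) (by simp [hγ0])
    exact congrFun this s
  have hsmall : ContMDiffOn (𝓘(ℝ, ℝ).prod I) I ∞ (fun x : ℝ × P => γ x.2 x.1)
      (Ioo (-ε) ε ×ˢ univ) := by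
    rintro ⟨t, p⟩ ⟨ht, -⟩
    refine ContMDiffAt.contMDiffWithinAt ?_
    by_cases hp : p ∈ K
    · obtain ⟨q, hq, hpq⟩ := hcover p hp
      have hsub : Ioo (-ε) ε ⊆ Ioo (-r q) (r q) :=
        Ioo_subset_Ioo (neg_le_neg (hεr q hq)) (hεr q hq)
      have h1 : ContMDiffAt (𝓘(ℝ, ℝ).prod I) I ∞ (fun x : ℝ × P => φl q x.1 x.2) (t, p) :=
        (hφl q).contMDiffAt ((isOpen_Ioo.prod (hN q)).mem_nhds ⟨hsub ht, hpq⟩)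
      refine h1.congr_of_eventuallyEq ?_
      filter_upwards [(isOpen_Ioo.prod (hN q)).mem_nhds
        (show (t, p) ∈ Ioo (-ε) ε ×ˢ N q from ⟨ht, hpq⟩)] with x hx
      exact isMIntegralCurveOn_Ioo_eqOn_of_contMDiff_boundaryless (t₀ := 0)
        ⟨by linarith, hε⟩ hX1 ((hγ x.2).isMIntegralCurveOn _) ((hφlc q x.2 hx.2).2.mono hsub)
        ((hγ0 x.2).trans (hφlc q x.2 hx.2).1.symm) hx.1
    · refine (contMDiffAt_snd (I := 𝓘(ℝ, ℝ)) (J := I)).congr_of_eventuallyEq ?_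
      filter_upwards [(isOpen_univ.prod hK.isClosed.isOpen_compl).mem_nhds
        (show (t, p) ∈ univ ×ˢ Kᶜ from ⟨mem_univ _, hp⟩)] with x hx
      have := isMIntegralCurve_Ioo_eq_of_contMDiff_boundaryless (t₀ := 0) hX1
        (hγ x.2) (hconst x.2 hx.2) (hγ0 x.2)
      exact congrFun this x.1
  refine ⟨fun t p => γ p t, hγ0, hγ, hadd, ?_⟩
  rintro ⟨t₀, p₀⟩
  obtain ⟨n, hn⟩ := exists_nat_gt (|t₀| / ε)
  have hn0 : (0 : ℝ) < n := lt_of_le_of_lt (by positivity) hn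
  have hopen : IsOpen (Ioo (-(n * ε)) (n * ε)) := isOpen_Ioo
  have hstep : ∀ j : ℕ, ContMDiffOn (𝓘(ℝ, ℝ).prod I) I ∞
      (fun x : ℝ × P => γ x.2 (j * (x.1 / n))) (Ioo (-(n * ε)) (n * ε) ×ˢ univ) := by
    intro j
    induction j with
    | zero =>
      refine (contMDiff_snd (I := 𝓘(ℝ, ℝ)) (J := I)).contMDiffOn.congr fun x _ => ?_
      simp [hγ0]
    | succ j ih =>
      have hdiv : ContMDiffOn (𝓘(ℝ, ℝ).prod I) 𝓘(ℝ, ℝ) ∞ (fun x : ℝ × P => x.1 / n)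
          (Ioo (-(n * ε)) (n * ε) ×ˢ univ) :=
        ((contDiff_id.div_const (n : ℝ)).contMDiff.comp contMDiff_fst).contMDiffOn
      have h := hsmall.comp (hdiv.prodMk ih) (fun x hx => ⟨by
        rw [mem_Ioo, ← abs_lt, abs_div, Nat.abs_cast, div_lt_iff₀ hn0, mul_comm]
        exact abs_lt.2 hx.1, mem_univ _⟩)
      refine h.congr fun x _ => ?_
      simp only [Function.comp]
      rw [← hadd]
      congr 1
      push_cast; ring
  have h := (hstep n).contMDiffAt (x := (t₀, p₀)) ((hopen.prod isOpen_univ).mem_nhds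
    ⟨by rw [mem_Ioo, ← abs_lt]; rwa [div_lt_iff₀ hε] at hn, mem_univ _⟩)
  refine h.congr_of_eventuallyEq (Filter.Eventually.of_forall fun x => ?_)
  simp only
  rw [mul_div_cancel₀ _ hn0.ne']

end Flow

/-! ### Iterated difference quotients -/

section TaylorQuot

variable {G : Type u} [NormedAddCommGroup G] [NormedSpace ℝ G]

/-- The coefficients (at `0`) and the remainders of the Taylor expansion at `0`. -/
def taylorQuot (g : ℝ → G) : ℕ → ℝ → G
  | 0 => g
  | j + 1 => dslope (taylorQuot g j) 0

lemma taylorQuot_expand (g : ℝ → G) (m : ℕ) (t : ℝ) :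
    g t = ∑ j ∈ Finset.range m, t ^ j • taylorQuot g j 0 + t ^ m • taylorQuot g m t := by
  induction m with
  | zero => simp [taylorQuot]
  | succ m ih =>
    rw [ih, Finset.sum_range_succ, sub_eq_smul_dslope_zero (taylorQuot g m) t, smul_add, smul_smul,
      ← pow_succ, add_assoc]
    rfl

lemma contDiffOn_taylorQuot_param {X : Type u} [NormedAddCommGroup X] [NormedSpace ℝ X]
    [CompleteSpace G] {f : ℝ × X → G} {ε : ℝ} {U : Set X} (hU : IsOpen U)
    (hf : ContDiffOn ℝ ∞ f (Ioo (-ε) ε ×ˢ U)) (j : ℕ) :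
    ContDiffOn ℝ ∞ (fun p : ℝ × X => taylorQuot (fun s => f (s, p.2)) j p.1)
      (Ioo (-ε) ε ×ˢ U) := by
  induction j with
  | zero => exact hf
  | succ j ih => exact contDiffOn_dslope_param hU ih

lemma contDiffOn_taylorQuot [CompleteSpace G] {g : ℝ → G} {ε : ℝ}
    (hg : ContDiffOn ℝ ∞ g (Ioo (-ε) ε)) (j : ℕ) :
    ContDiffOn ℝ ∞ (taylorQuot g j) (Ioo (-ε) ε) := by
  have h := contDiffOn_taylorQuot_param (X := G) (f := fun p => g p.1) (U := univ) isOpen_univ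
    (hg.comp contDiffOn_fst fun p hp => hp.1) j
  exact h.comp (f := fun t => (t, (0 : G))) (contDiffOn_id.prodMk contDiffOn_const)
    fun t ht => ⟨ht, mem_univ _⟩

lemma taylorQuot_clm [CompleteSpace G] {G' : Type*} [NormedAddCommGroup G'] [NormedSpace ℝ G']
    (L : G →L[ℝ] G') {g : ℝ → G} {ε : ℝ} (hε : 0 < ε) (hg : ContDiffOn ℝ ∞ g (Ioo (-ε) ε)) (j : ℕ) :
    taylorQuot (fun s => L (g s)) j = fun t => L (taylorQuot g j t) := by
  induction j with
  | zero => rfl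
  | succ j ih =>
    funext t
    change dslope (taylorQuot (fun s => L (g s)) j) 0 t = _
    rw [ih]
    exact ContinuousLinearMap.dslope_comp L (taylorQuot g j) 0 t fun _ =>
      ((contDiffOn_taylorQuot hg j).contDiffAt (Ioo_mem_nhds (by linarith) hε)).differentiableAt
        (by simp)

lemma taylorQuot_congr {g g' : ℝ → G} {ε : ℝ} (hε : 0 < ε) (h : EqOn g g' (Ioo (-ε) ε)) (j : ℕ) :
    EqOn (taylorQuot g j) (taylorQuot g' j) (Ioo (-ε) ε) := by
  induction j with
  | zero => exact h
  | succ j ih =>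
    have h0 : taylorQuot g j =ᶠ[𝓝 0] taylorQuot g' j :=
      ih.eventuallyEq_of_mem (Ioo_mem_nhds (by linarith) hε)
    intro t ht
    change dslope _ 0 t = dslope _ 0 t
    rcases eq_or_ne t 0 with rfl | hne
    · rw [dslope_same, dslope_same, h0.deriv_eq]
    · rw [dslope_of_ne _ hne, dslope_of_ne _ hne, slope_def_module, slope_def_module, ih ht,
        h0.self_of_nhds]

lemma eq_of_eqOn_ne_zero {T : Type*} [TopologicalSpace T] [T2Space T] {f g : ℝ → T} {ε : ℝ}
    (hf : ContinuousOn f (Ioo (-ε) ε)) (hg : ContinuousOn g (Ioo (-ε) ε))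
    (h : ∀ t ∈ Ioo (-ε) ε, t ≠ 0 → f t = g t) : EqOn f g (Ioo (-ε) ε) := by
  intro t ht
  by_cases h0 : t = 0
  · subst h0
    have hn : Ioo (-ε) ε ∈ 𝓝 (0 : ℝ) := Ioo_mem_nhds ht.1 ht.2
    have h1 : Filter.Tendsto f (𝓝[≠] 0) (𝓝 (f 0)) := (hf.continuousAt hn).mono_left nhdsWithin_le_nhds
    have h2 : Filter.Tendsto g (𝓝[≠] 0) (𝓝 (g 0)) := (hg.continuousAt hn).mono_left nhdsWithin_le_nhds
    refine tendsto_nhds_unique_of_eventuallyEq h1 h2 ?_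
    filter_upwards [nhdsWithin_le_nhds hn, self_mem_nhdsWithin] with t ht hne using h t ht hne
  · exact h t ht h0

end TaylorQuot

/-! ### Closed `b^m`-forms in coordinates -/

section LocalForms

variable {E : Type u} [NormedAddCommGroup E] [NormedSpace ℝ E]

/-- The exterior derivative along `E` of a family of one-forms, from its total derivative. -/
def curl (D : ℝ × E →L[ℝ] E →L[ℝ] ℝ) (v w : E) : ℝ := D (0, v) w - D (0, w) v

/-- The mean value over `[0, t]` of a family. -/
def meanTo {G : Type*} [NormedAddCommGroup G] [NormedSpace ℝ G] (g : ℝ → G) (t : ℝ) : G :=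
  ∫ s in (0 : ℝ)..1, g (s * t)

lemma mul_mem_Ioo {ε s t : ℝ} (hs : s ∈ Icc (0 : ℝ) 1) (ht : t ∈ Ioo (-ε) ε) :
    s * t ∈ Ioo (-ε) ε := by
  rw [mem_Ioo, ← abs_lt] at ht ⊢
  rw [abs_mul, abs_of_nonneg hs.1]
  nlinarith [abs_nonneg t, hs.2]

lemma contDiffOn_meanTo_param {G : Type u} [NormedAddCommGroup G] [NormedSpace ℝ G]
    {f : ℝ × E → G} {ε : ℝ} {U : Set E} (hU : IsOpen U)
    (hf : ContDiffOn ℝ ∞ f (Ioo (-ε) ε ×ˢ U)) :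
    ContDiffOn ℝ ∞ (fun p : ℝ × E => meanTo (fun s => f (s, p.2)) p.1) (Ioo (-ε) ε ×ˢ U) := by
  have hopen : IsOpen (Ioo (-ε) ε ×ˢ U) := isOpen_Ioo.prod hU
  refine contDiffOn_unitIntegral (F := fun s (p : ℝ × E) => f (s * p.1, p.2)) hopen ?_
  rintro s hs ⟨t, x⟩ ⟨ht, hx⟩
  exact (hf.contDiffAt (hopen.mem_nhds (show (s * t, x) ∈ _ from ⟨mul_mem_Ioo hs ht, hx⟩))).comp
    (f := fun p : ℝ × (ℝ × E) => (p.1 * p.2.1, p.2.2)) (s, (t, x))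
    ((contDiffAt_fst.mul contDiffAt_snd.fst).prodMk contDiffAt_snd.snd)

lemma smul_meanTo {G : Type*} [NormedAddCommGroup G] [NormedSpace ℝ G] [CompleteSpace G]
    {g g' : ℝ → G} {ε : ℝ} (hg : ∀ t ∈ Ioo (-ε) ε, HasDerivAt g (g' t) t)
    (hg' : ContinuousOn g' (Ioo (-ε) ε)) {t : ℝ} (ht : t ∈ Ioo (-ε) ε) :
    t • meanTo g' t = g t - g 0 := by
  have hint := intervalIntegral.integral_eq_sub_of_hasDerivAt (a := 0) (b := 1)
    (f := fun s => g (s * t)) (f' := fun s => t • g' (s * t))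
    (fun s hs => by
      rw [uIcc_of_le zero_le_one] at hs
      have h2 : HasDerivAt (fun s : ℝ => s * t) t s := by simpa using (hasDerivAt_id s).mul_const t
      exact (hg _ (mul_mem_Ioo hs ht)).scomp s h2)
    (by
      apply ContinuousOn.intervalIntegrable
      rw [uIcc_of_le zero_le_one]
      exact continuousOn_const.smul (hg'.comp (by fun_prop) fun s hs => mul_mem_Ioo hs ht))
  rw [intervalIntegral.integral_smul, one_mul, zero_mul] at hint
  exact hint

/-- A family of one-forms and a family of two-forms, depending on a parameter in `(-ε, ε)`, that
are the coefficients of a closed form `t⁻ᵐ dt ∧ A + B`. -/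
structure IsClosedPair (m : ℕ) (ε : ℝ) (U : Set E) (A : ℝ × E → E →L[ℝ] ℝ)
    (B : ℝ × E → E →L[ℝ] E →L[ℝ] ℝ) : Prop where
  smooth_A : ContDiffOn ℝ ∞ A (Ioo (-ε) ε ×ˢ U)
  smooth_B : ContDiffOn ℝ ∞ B (Ioo (-ε) ε ×ˢ U)
  closed_A : ∀ t ∈ Ioo (-ε) ε, t ≠ 0 → ∀ y ∈ U, ∀ v w,
    t ^ m * fderiv ℝ B (t, y) (1, 0) v w = curl (fderiv ℝ A (t, y)) v w
  closed_B : ∀ t ∈ Ioo (-ε) ε, t ≠ 0 → ∀ y ∈ U, ∀ u v w,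
    fderiv ℝ B (t, y) (0, u) v w + fderiv ℝ B (t, y) (0, v) w u
      + fderiv ℝ B (t, y) (0, w) u v = 0

namespace IsClosedPair

variable {m : ℕ} {ε : ℝ} {U : Set E} {A : ℝ × E → E →L[ℝ] ℝ} {B : ℝ × E → E →L[ℝ] E →L[ℝ] ℝ}

/-- The `j`-th remainder of the expansion of the one-forms. -/
def quot (A : ℝ × E → E →L[ℝ] ℝ) (j : ℕ) (p : ℝ × E) : E →L[ℝ] ℝ :=
  taylorQuot (fun s => A (s, p.2)) j p.1

variable (h : IsClosedPair m ε U A B) (hU : IsOpen U)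

include h hU

lemma smooth_quot (j : ℕ) : ContDiffOn ℝ ∞ (quot A j) (Ioo (-ε) ε ×ˢ U) :=
  contDiffOn_taylorQuot_param hU h.smooth_A j

lemma isOpen_dom : IsOpen (Ioo (-ε) ε ×ˢ U) := isOpen_Ioo.prod hU

lemma closed_B' {t : ℝ} (ht : t ∈ Ioo (-ε) ε) {y : E} (hy : y ∈ U) (u v w : E) :
    fderiv ℝ B (t, y) (0, u) v w + fderiv ℝ B (t, y) (0, v) w u
      + fderiv ℝ B (t, y) (0, w) u v = 0 := by
  have hc : ContinuousOn (fun t => fderiv ℝ B (t, y)) (Ioo (-ε) ε) :=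
    (h.smooth_B.continuousOn_fderiv_of_isOpen (isOpen_Ioo.prod hU) (by simp)).comp
      (by fun_prop) fun t ht => ⟨ht, hy⟩
  refine eq_of_eqOn_ne_zero (f := fun t => fderiv ℝ B (t, y) (0, u) v w
    + fderiv ℝ B (t, y) (0, v) w u + fderiv ℝ B (t, y) (0, w) u v) (g := fun _ => 0) ?_
    continuousOn_const (fun t ht h0 => h.closed_B t ht h0 y hy u v w) ht
  fun_prop

lemma curl_quot {j : ℕ} (hj : j ≤ m) {t : ℝ} (ht : t ∈ Ioo (-ε) ε) {y : E} (hy : y ∈ U) (v w : E) :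
    curl (fderiv ℝ (quot A j) (t, y)) v w = t ^ (m - j) * fderiv ℝ B (t, y) (1, 0) v w := by
  have hcB : ContinuousOn (fun t => fderiv ℝ B (t, y)) (Ioo (-ε) ε) :=
    (h.smooth_B.continuousOn_fderiv_of_isOpen (isOpen_Ioo.prod hU) (by simp)).comp
      (by fun_prop) fun t ht => ⟨ht, hy⟩
  have hcA : ∀ j, ContinuousOn (fun t => fderiv ℝ (quot A j) (t, y)) (Ioo (-ε) ε) := fun j =>
    ((h.smooth_quot hU j).continuousOn_fderiv_of_isOpen (isOpen_Ioo.prod hU) (by simp)).comp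
      (by fun_prop) fun t ht => ⟨ht, hy⟩
  induction j generalizing t v w with
  | zero =>
    refine eq_of_eqOn_ne_zero (f := fun t => curl (fderiv ℝ (quot A 0) (t, y)) v w)
      (g := fun t => t ^ (m - 0) * fderiv ℝ B (t, y) (1, 0) v w) ?_ ?_
      (fun t ht h0 => (h.closed_A t ht h0 y hy v w).symm) ht
    · have := hcA 0
      unfold curl
      fun_prop
    · fun_prop
  | succ j ih =>
    refine eq_of_eqOn_ne_zero (f := fun t => curl (fderiv ℝ (quot A (j + 1)) (t, y)) v w)
      (g := fun t => t ^ (m - (j + 1)) * fderiv ℝ B (t, y) (1, 0) v w) ?_ ?_ (fun t ht h0 => ?_) ht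
    · have := hcA (j + 1)
      unfold curl
      fun_prop
    · fun_prop
    have hε : (0 : ℝ) ∈ Ioo (-ε) ε := ⟨by linarith [ht.1, ht.2], by linarith [ht.1, ht.2]⟩
    have hd : ∀ t ∈ Ioo (-ε) ε, DifferentiableAt ℝ (quot A j) (t, y) := fun t ht =>
      ((h.smooth_quot hU j).contDiffAt ((isOpen_Ioo.prod hU).mem_nhds ⟨ht, hy⟩)).differentiableAt
        (by simp)
    -- the derivative of the next remainder along `E`
    have key : ∀ v, fderiv ℝ (quot A (j + 1)) (t, y) (0, v)
        = t⁻¹ • (fderiv ℝ (quot A j) (t, y) (0, v) - fderiv ℝ (quot A j) (0, y) (0, v)) := by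
      intro v
      have hd' : DifferentiableAt ℝ (quot A (j + 1)) (t, y) :=
        ((h.smooth_quot hU (j + 1)).contDiffAt
          ((isOpen_Ioo.prod hU).mem_nhds ⟨ht, hy⟩)).differentiableAt (by simp)
      have sec : ∀ {f : ℝ × E → E →L[ℝ] ℝ} {t : ℝ}, DifferentiableAt ℝ f (t, y) →
          HasFDerivAt (fun x => f (t, x)) ((fderiv ℝ f (t, y)).comp (.inr ℝ ℝ E)) y :=
        fun hf => hf.hasFDerivAt.comp y (hasFDerivAt_prodMk_right _ _)
      have e1 := sec hd'
      have e2 := ((sec (hd t ht)).sub (sec (hd 0 hε))).const_smul t⁻¹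
      have e3 : (fun x => quot A (j + 1) (t, x))
          = fun x => t⁻¹ • (quot A j (t, x) - quot A j (0, x)) := by
        funext x
        change dslope _ 0 t = _
        rw [dslope_of_ne _ h0, slope_def_module, sub_zero]
        rfl
      rw [e3] at e1
      exact DFunLike.congr_fun (e1.unique e2) v
    have i1 := ih (by omega) ht v w
    have i0 := ih (by omega) hε v w
    rw [zero_pow (by omega), zero_mul] at i0
    unfold curl at i1 i0 ⊢
    rw [key, key]
    simp only [smul_apply, sub_apply, smul_eq_mul]
    have hpow : t ^ (m - j) = t * t ^ (m - (j + 1)) := by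
      rw [← pow_succ']; congr 1; omega
    rw [hpow] at i1
    field_simp
    linarith

/-- The mean `ν` of the last remainder. -/
lemma curl_mean {t : ℝ} (ht : t ∈ Ioo (-ε) ε) {y : E} (hy : y ∈ U) (v w : E) :
    t * curl (fderiv ℝ (fun p : ℝ × E => meanTo (fun s => quot A m (s, p.2)) p.1) (t, y)) v w
      = B (t, y) v w - B (0, y) v w := by
  have hopen := h.isOpen_dom hU
  have hF : ∀ s ∈ Icc (0 : ℝ) 1, ∀ p ∈ Ioo (-ε) ε ×ˢ U, ContDiffAt ℝ ∞
      (fun q : ℝ × (ℝ × E) => quot A m (q.1 * q.2.1, q.2.2)) (s, p) := by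
    rintro s hs ⟨t, x⟩ ⟨ht, hx⟩
    exact ((h.smooth_quot hU m).contDiffAt (hopen.mem_nhds
      (show (s * t, x) ∈ _ from ⟨mul_mem_Ioo hs ht, hx⟩))).comp
      (f := fun p : ℝ × (ℝ × E) => (p.1 * p.2.1, p.2.2)) (s, (t, x))
      ((contDiffAt_fst.mul contDiffAt_snd.fst).prodMk contDiffAt_snd.snd)
  have hmem : (t, y) ∈ Ioo (-ε) ε ×ˢ U := ⟨ht, hy⟩
  have hder := (hasFDerivAt_unitIntegral (F := fun s (p : ℝ × E) => quot A m (s * p.1, p.2))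
    hopen hF hmem).fderiv
  have hD : ∀ s ∈ Icc (0 : ℝ) 1, ∀ v, fderiv ℝ (fun p : ℝ × E => quot A m (s * p.1, p.2)) (t, y)
      (0, v) = fderiv ℝ (quot A m) (s * t, y) (0, v) := by
    intro s hs v
    have h1 : DifferentiableAt ℝ (quot A m) (s * t, y) := ((h.smooth_quot hU m).contDiffAt
      (hopen.mem_nhds ⟨mul_mem_Ioo hs ht, hy⟩)).differentiableAt (by simp)
    have h2 : HasFDerivAt (fun p : ℝ × E => (s * p.1, p.2))
        ((s • ContinuousLinearMap.fst ℝ ℝ E).prod (ContinuousLinearMap.snd ℝ ℝ E)) (t, y) :=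
      (hasFDerivAt_fst.const_mul s).prodMk hasFDerivAt_snd
    have h3 := (h1.hasFDerivAt.comp (t, y) h2).fderiv
    simp only [Function.comp_def] at h3
    rw [h3]
    simp
  have hcont : ContinuousOn (fun s => fderiv ℝ (fun p : ℝ × E => quot A m (s * p.1, p.2)) (t, y))
      (Icc 0 1) := by
    intro s hs
    have h1 := contDiffAt_fderiv_param (F := fun s (p : ℝ × E) => quot A m (s * p.1, p.2))
      (hF s hs (t, y) hmem)
    exact (h1.continuousAt.comp (f := fun s => (s, (t, y)))
      (Continuous.prodMk_left _).continuousAt).continuousWithinAt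
  have hint : IntervalIntegrable (fun s => fderiv ℝ (fun p : ℝ × E => quot A m (s * p.1, p.2))
      (t, y)) MeasureTheory.volume 0 1 :=
    ContinuousOn.intervalIntegrable (by rwa [uIcc_of_le zero_le_one])
  have hintv : ∀ v, IntervalIntegrable (fun s => fderiv ℝ (fun p : ℝ × E =>
      quot A m (s * p.1, p.2)) (t, y) (0, v)) MeasureTheory.volume 0 1 := fun v =>
    ContinuousOn.intervalIntegrable (by rw [uIcc_of_le zero_le_one]; fun_prop)
  have hintvw : ∀ v w, IntervalIntegrable (fun s => fderiv ℝ (fun p : ℝ × E =>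
      quot A m (s * p.1, p.2)) (t, y) (0, v) w) MeasureTheory.volume 0 1 := fun v w =>
    ContinuousOn.intervalIntegrable (by rw [uIcc_of_le zero_le_one]; fun_prop)
  have happ : ∀ v w, (∫ s in (0 : ℝ)..1, fderiv ℝ (fun p : ℝ × E => quot A m (s * p.1, p.2))
      (t, y)) (0, v) w = ∫ s in (0 : ℝ)..1,
        fderiv ℝ (fun p : ℝ × E => quot A m (s * p.1, p.2)) (t, y) (0, v) w := by
    intro v w
    rw [ContinuousLinearMap.intervalIntegral_apply hint,
      ContinuousLinearMap.intervalIntegral_apply (hintv v)]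
  have hBd : ∀ t ∈ Ioo (-ε) ε, HasDerivAt (fun t => B (t, y) v w)
      (fderiv ℝ B (t, y) (1, 0) v w) t := by
    intro t ht
    have h1 : DifferentiableAt ℝ B (t, y) := (h.smooth_B.contDiffAt
      (hopen.mem_nhds ⟨ht, hy⟩)).differentiableAt (by simp)
    have h2 := h1.hasFDerivAt.comp_hasDerivAt (f := fun t => (t, y)) t
      ((hasDerivAt_id t).prodMk (hasDerivAt_const t y))
    have h3 := (ContinuousLinearMap.apply ℝ ℝ w).hasFDerivAt.comp_hasDerivAt t
      ((ContinuousLinearMap.apply ℝ (E →L[ℝ] ℝ) v).hasFDerivAt.comp_hasDerivAt t h2)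
    exact h3
  have hcB : ContinuousOn (fun t => fderiv ℝ B (t, y) (1, 0) v w) (Ioo (-ε) ε) := by
    have : ContinuousOn (fun t => fderiv ℝ B (t, y)) (Ioo (-ε) ε) :=
      (h.smooth_B.continuousOn_fderiv_of_isOpen (isOpen_Ioo.prod hU) (by simp)).comp
        (by fun_prop) fun t ht => ⟨ht, hy⟩
    fun_prop
  have hcurl : curl (fderiv ℝ (fun p : ℝ × E => meanTo (fun s => quot A m (s, p.2)) p.1) (t, y)) v w
      = meanTo (fun t => fderiv ℝ B (t, y) (1, 0) v w) t := by
    unfold meanTo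
    rw [hder, curl, happ, happ, ← intervalIntegral.integral_sub (hintvw v w) (hintvw w v)]
    refine intervalIntegral.integral_congr fun s hs => ?_
    rw [uIcc_of_le zero_le_one] at hs
    simp only
    rw [hD s hs, hD s hs]
    have := h.curl_quot hU le_rfl (mul_mem_Ioo hs ht) hy v w
    rwa [Nat.sub_self, pow_zero, one_mul] at this
  rw [hcurl]
  exact smul_meanTo hBd hcB ht

/-- The derivative in the parameter of `t ν`. -/
lemma hasDerivAt_smul_mean {t : ℝ} (ht : t ∈ Ioo (-ε) ε) {y : E} (hy : y ∈ U) :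
    HasDerivAt (fun t => t • meanTo (fun s => quot A m (s, y)) t) (quot A m (t, y)) t := by
  have hc : ContinuousOn (fun s => quot A m (s, y)) (Ioo (-ε) ε) :=
    (h.smooth_quot hU m).continuousOn.comp (by fun_prop) fun t ht => ⟨ht, hy⟩
  have h0 : (0 : ℝ) ∈ Ioo (-ε) ε := ⟨by linarith [ht.1, ht.2], by linarith [ht.1, ht.2]⟩
  have hprim : ∀ t ∈ Ioo (-ε) ε, HasDerivAt (fun t => ∫ s in (0 : ℝ)..t, quot A m (s, y))
      (quot A m (t, y)) t := by
    intro t ht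
    refine intervalIntegral.integral_hasDerivAt_right ?_
      (hc.stronglyMeasurableAtFilter isOpen_Ioo t ht) (hc.continuousAt (isOpen_Ioo.mem_nhds ht))
    exact (hc.mono (ordConnected_Ioo.uIcc_subset h0 ht)).intervalIntegrable
  refine (hprim t ht).congr_of_eventuallyEq ?_
  filter_upwards [isOpen_Ioo.mem_nhds ht] with t ht
  rw [smul_meanTo hprim hc ht, intervalIntegral.integral_same, sub_zero]

end IsClosedPair

end LocalForms

/-! ### Two-forms in a frame, and the homotopy formula of Moser's method -/

section Frame

variable {E : Type u} [NormedAddCommGroup E] [NormedSpace ℝ E] [FiniteDimensional ℝ E]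

/-- The two-form `dt ∧ a + b` on `ℝ × E`. -/
def frameForm (a : E →L[ℝ] ℝ) (b : E →L[ℝ] E →L[ℝ] ℝ) : ℝ × E →L[ℝ] ℝ × E →L[ℝ] ℝ :=
  (ContinuousLinearMap.fst ℝ ℝ E).smulRight (a.comp (ContinuousLinearMap.snd ℝ ℝ E))
    - ((ContinuousLinearMap.fst ℝ ℝ E).smulRight (a.comp (ContinuousLinearMap.snd ℝ ℝ E))).flip
    + b.bilinearComp (ContinuousLinearMap.snd ℝ ℝ E) (ContinuousLinearMap.snd ℝ ℝ E)

lemma frameForm_apply (a : E →L[ℝ] ℝ) (b : E →L[ℝ] E →L[ℝ] ℝ) (x y : ℝ × E) :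
    frameForm a b x y = x.1 * a y.2 - y.1 * a x.2 + b x.2 y.2 := rfl

lemma frameForm_skew (a : E →L[ℝ] ℝ) {b : E →L[ℝ] E →L[ℝ] ℝ} (hb : ∀ v w, b v w = -b w v)
    (x y : ℝ × E) : frameForm a b x y = -frameForm a b y x := by
  rw [frameForm_apply, frameForm_apply, hb x.2 y.2]; ring

variable (E) in
/-- `frameForm` as a linear map. -/
def frameFormL : ((E →L[ℝ] ℝ) × (E →L[ℝ] E →L[ℝ] ℝ)) →L[ℝ] (ℝ × E →L[ℝ] ℝ × E →L[ℝ] ℝ) :=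
  LinearMap.toContinuousLinearMap
    { toFun := fun p => frameForm p.1 p.2
      map_add' := fun p q => by
        ext x <;> simp [frameForm_apply]; ring
      map_smul' := fun c p => by
        ext x <;> simp [frameForm_apply] }

lemma frameFormL_apply (p : (E →L[ℝ] ℝ) × (E →L[ℝ] E →L[ℝ] ℝ)) :
    frameFormL E p = frameForm p.1 p.2 := rfl

end Frame

section Moser

variable {F : Type*} [NormedAddCommGroup F] [NormedSpace ℝ F]

/-- The homotopy formula of Moser's method, at a point. -/
lemma hasDerivAt_moser {ω₀ ω₁ : F → F →L[ℝ] F →L[ℝ] ℝ} {μ : F → F →L[ℝ] ℝ} {X : F → F}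
    {g : ℝ × F → F} {s : ℝ} {x : F} (hg : ContDiffAt ℝ ∞ g (s, x))
    (h0 : DifferentiableAt ℝ ω₀ (g (s, x))) (h1 : DifferentiableAt ℝ ω₁ (g (s, x)))
    (hμ : DifferentiableAt ℝ μ (g (s, x))) (hX : DifferentiableAt ℝ X (g (s, x)))
    (hgX : ∀ᶠ x' in 𝓝 x, HasDerivAt (fun s => g (s, x')) (X (g (s, x'))) s)
    (hrel : ∀ᶠ y in 𝓝 (g (s, x)), ∀ w, ((1 - s) • ω₀ y + s • ω₁ y) (X y) w = -μ y w)
    (skew₀ : ∀ᶠ y in 𝓝 (g (s, x)), ∀ v w, ω₀ y v w = -ω₀ y w v)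
    (skew₁ : ∀ᶠ y in 𝓝 (g (s, x)), ∀ v w, ω₁ y v w = -ω₁ y w v)
    (closed₀ : ∀ u v w, fderiv ℝ ω₀ (g (s, x)) u v w + fderiv ℝ ω₀ (g (s, x)) v w u
      + fderiv ℝ ω₀ (g (s, x)) w u v = 0)
    (closed₁ : ∀ u v w, fderiv ℝ ω₁ (g (s, x)) u v w + fderiv ℝ ω₁ (g (s, x)) v w u
      + fderiv ℝ ω₁ (g (s, x)) w u v = 0)
    (hη : ∀ v w, fderiv ℝ μ (g (s, x)) v w - fderiv ℝ μ (g (s, x)) w v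
      = ω₁ (g (s, x)) v w - ω₀ (g (s, x)) v w) (v w : F) :
    HasDerivAt (fun r => ((1 - r) • ω₀ (g (r, x)) + r • ω₁ (g (r, x)))
      (fderiv ℝ (fun x => g (r, x)) x v) (fderiv ℝ (fun x => g (r, x)) x w)) 0 s := by
  set y := g (s, x) with hy
  set Ω : F → F →L[ℝ] F →L[ℝ] ℝ := fun y => (1 - s) • ω₀ y + s • ω₁ y with hΩ
  set D := fderiv ℝ g with hD
  have hline : HasDerivAt (fun r : ℝ => (r, x)) ((1 : ℝ), (0 : F)) s :=
    (hasDerivAt_id s).prodMk (hasDerivAt_const s x)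
  have hgd : HasFDerivAt g (D (s, x)) (s, x) := (hg.differentiableAt (by simp)).hasFDerivAt
  have hDd : HasFDerivAt D (fderiv ℝ D (s, x)) (s, x) :=
    ((hg.fderiv_right (m := ∞) (by simp)).differentiableAt (by simp)).hasFDerivAt
  have hgs : HasDerivAt (fun r => g (r, x)) (X y) s := hgX.self_of_nhds
  have hgs' : D (s, x) (1, 0) = X y := (hgd.comp_hasDerivAt s hline).unique hgs
  -- the mixed partial derivatives
  have hmix : ∀ v, fderiv ℝ D (s, x) (1, 0) (0, v) = fderiv ℝ X y (D (s, x) (0, v)) := by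
    intro v
    have hsymm : IsSymmSndFDerivAt ℝ g (s, x) := hg.isSymmSndFDerivAt (by
      rw [minSmoothness_of_isRCLikeNormedField]; exact WithTop.coe_le_coe.2 le_top)
    rw [hsymm.eq]
    have hin : HasFDerivAt (fun x' : F => (s, x')) (ContinuousLinearMap.inr ℝ ℝ F) x :=
      hasFDerivAt_prodMk_right s x
    have e1 : HasFDerivAt (fun x' => D (s, x') (1, 0))
        (((ContinuousLinearMap.apply ℝ F ((1 : ℝ), (0 : F))).comp (fderiv ℝ D (s, x))).comp
          (ContinuousLinearMap.inr ℝ ℝ F)) x :=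
      ((ContinuousLinearMap.apply ℝ F ((1 : ℝ), (0 : F))).hasFDerivAt.comp (s, x) hDd).comp x hin
    have e2 : HasFDerivAt (fun x' => X (g (s, x')))
        ((fderiv ℝ X y).comp ((D (s, x)).comp (ContinuousLinearMap.inr ℝ ℝ F))) x :=
      hX.hasFDerivAt.comp x (hgd.comp x hin)
    have e3 : (fun x' => D (s, x') (1, 0)) =ᶠ[𝓝 x] fun x' => X (g (s, x')) := by
      have hev : ∀ᶠ p in 𝓝 (s, x), DifferentiableAt ℝ g p :=
        ((hg.of_le (m := 1) (by exact_mod_cast le_top)).eventually (by simp)).mono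
          fun p hp => hp.differentiableAt (by simp)
      have hev' : ∀ᶠ x' in 𝓝 x, DifferentiableAt ℝ g (s, x') :=
        (Continuous.prodMk_right s).continuousAt.eventually hev
      filter_upwards [hev', hgX] with x' hx' hx''
      exact (hx'.hasFDerivAt.comp_hasDerivAt (f := fun r => (r, x')) s
        ((hasDerivAt_id s).prodMk (hasDerivAt_const s x'))).unique hx''
    exact DFunLike.congr_fun (e1.unique (e2.congr_of_eventuallyEq e3)) v
  -- the derivatives along the curve
  have hV : ∀ v, HasDerivAt (fun r => fderiv ℝ (fun x => g (r, x)) x v)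
      (fderiv ℝ X y (D (s, x) (0, v))) s := by
    intro v
    have e1 := (ContinuousLinearMap.apply ℝ F ((0 : ℝ), v)).hasFDerivAt.comp_hasDerivAt s
      (hDd.comp_hasDerivAt s hline)
    have e2 : HasDerivAt (fun r => D (r, x) (0, v)) (fderiv ℝ X y (D (s, x) (0, v))) s := by
      rw [← hmix v]; exact e1
    refine e2.congr_of_eventuallyEq ?_
    have hev : ∀ᶠ p in 𝓝 (s, x), DifferentiableAt ℝ g p :=
      ((hg.of_le (m := 1) (by exact_mod_cast le_top)).eventually (by simp)).mono
        fun p hp => hp.differentiableAt (by simp)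
    have hev' : ∀ᶠ r in 𝓝 s, DifferentiableAt ℝ g (r, x) :=
      (Continuous.prodMk_left x).continuousAt.eventually hev
    filter_upwards [hev'] with r hr
    have e3 := (hr.hasFDerivAt.comp x (hasFDerivAt_prodMk_right r x)).fderiv
    exact DFunLike.congr_fun e3 v
  have hgx : fderiv ℝ (fun x => g (s, x)) x = (D (s, x)).comp (ContinuousLinearMap.inr ℝ ℝ F) :=
    (hgd.comp x (hasFDerivAt_prodMk_right s x)).fderiv
  set V := D (s, x) (0, v) with hVdef
  set W := D (s, x) (0, w) with hWdef
  have hW0 : HasDerivAt (fun r => (1 - r) • ω₀ (g (r, x)) + r • ω₁ (g (r, x)))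
      ((ω₁ y - ω₀ y) + fderiv ℝ Ω y (X y)) s := by
    have a0 := h0.hasFDerivAt.comp_hasDerivAt s hgs
    have a1 := h1.hasFDerivAt.comp_hasDerivAt s hgs
    have b0 := ((hasDerivAt_id s).const_sub 1).smul a0
    have b1 := (hasDerivAt_id s).smul a1
    have hf : fderiv ℝ Ω y = (1 - s) • fderiv ℝ ω₀ y + s • fderiv ℝ ω₁ y :=
      ((h0.hasFDerivAt.const_smul (1 - s)).add (h1.hasFDerivAt.const_smul s)).fderiv
    rw [hf]
    refine HasDerivAt.congr_deriv (b0.add b1) ?_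
    simp only [id, Function.comp_apply, add_apply, smul_apply]
    rw [← hy]
    module
  have hmain := (hW0.clm_apply (hV v)).clm_apply (hV w)
  refine hmain.congr_deriv ?_
  rw [hgx]
  change ((ω₁ y - ω₀ y + fderiv ℝ Ω y (X y)) V + Ω y (fderiv ℝ X y V)) W
    + Ω y V (fderiv ℝ X y W) = 0
  -- differentiate the relation
  have hΩd : DifferentiableAt ℝ Ω y := (h0.const_smul (1 - s)).add (h1.const_smul s)
  have hreld : ∀ V W, fderiv ℝ Ω y V (X y) W + Ω y (fderiv ℝ X y V) W = -fderiv ℝ μ y V W := by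
    intro V W
    have e1 : HasFDerivAt (fun y => Ω y (X y)) _ y := hΩd.hasFDerivAt.clm_apply hX.hasFDerivAt
    have e2 : (fun y => Ω y (X y)) =ᶠ[𝓝 y] fun y => -μ y := by
      filter_upwards [hrel] with y' hy'
      ext w
      exact hy' w
    have e3 := e1.unique (hμ.hasFDerivAt.neg.congr_of_eventuallyEq e2)
    have e4 := DFunLike.congr_fun (DFunLike.congr_fun e3 V) W
    simp only [add_apply, ContinuousLinearMap.flip_apply,
      ContinuousLinearMap.comp_apply, neg_apply] at e4
    linarith
  have hskew : ∀ᶠ y in 𝓝 y, ∀ v w, Ω y v w = -Ω y w v := by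
    filter_upwards [skew₀, skew₁] with y k0 k1 v w
    simp only [hΩ, add_apply, smul_apply, smul_eq_mul]
    rw [k0 v w, k1 v w]; ring
  have hskewd : ∀ U v w, fderiv ℝ Ω y U v w = -fderiv ℝ Ω y U w v := by
    intro U v w
    have e : ∀ v w, HasFDerivAt (fun y => Ω y v w)
        ((ContinuousLinearMap.apply ℝ ℝ w).comp
          ((ContinuousLinearMap.apply ℝ (F →L[ℝ] ℝ) v).comp (fderiv ℝ Ω y))) y := fun v w =>
      (ContinuousLinearMap.apply ℝ ℝ w).hasFDerivAt.comp y
        ((ContinuousLinearMap.apply ℝ (F →L[ℝ] ℝ) v).hasFDerivAt.comp y hΩd.hasFDerivAt)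
    have e2 : (fun y => Ω y v w) =ᶠ[𝓝 y] fun y => -Ω y w v := by
      filter_upwards [hskew] with y hy using hy v w
    exact DFunLike.congr_fun ((e v w).unique ((e w v).neg.congr_of_eventuallyEq e2)) U
  have hclosed : ∀ u v w, fderiv ℝ Ω y u v w + fderiv ℝ Ω y v w u + fderiv ℝ Ω y w u v = 0 := by
    intro u v w
    have hf : fderiv ℝ Ω y = (1 - s) • fderiv ℝ ω₀ y + s • fderiv ℝ ω₁ y :=
      ((h0.hasFDerivAt.const_smul (1 - s)).add (h1.hasFDerivAt.const_smul s)).fderiv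
    rw [hf]
    simp only [add_apply, smul_apply, smul_eq_mul]
    linear_combination (1 - s) * closed₀ u v w + s * closed₁ u v w
  have k1 := hreld V W
  have k2 := hreld W V
  have k3 := hclosed (X y) V W
  have k4 := hskew.self_of_nhds V (fderiv ℝ X y W)
  have k5 := hskewd V W (X y)
  have k6 := hη V W
  simp only [add_apply, sub_apply] at *
  linarith

end Moser

section LocalForms

variable {E : Type u} [NormedAddCommGroup E] [NormedSpace ℝ E] [FiniteDimensional ℝ E]
  {m : ℕ} {ε : ℝ} {U : Set E} {A : ℝ × E → E →L[ℝ] ℝ} {B : ℝ × E → E →L[ℝ] E →L[ℝ] ℝ}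

/-- The two-form `t⁻ᵐ dt ∧ A + B`. -/
def singularForm (m : ℕ) (A : ℝ × E → E →L[ℝ] ℝ) (B : ℝ × E → E →L[ℝ] E →L[ℝ] ℝ) (p : ℝ × E) :
    ℝ × E →L[ℝ] ℝ × E →L[ℝ] ℝ :=
  frameForm ((p.1 ^ m)⁻¹ • A p) (B p)

namespace IsClosedPair

variable (h : IsClosedPair m ε U A B) (hU : IsOpen U)

include h hU

lemma fderiv_singularForm {t : ℝ} (ht : t ∈ Ioo (-ε) ε) (h0 : t ≠ 0) {y : E} (hy : y ∈ U) :
    ∃ κ : ℝ, DifferentiableAt ℝ (singularForm m A B) (t, y) ∧ ∀ X,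
      fderiv ℝ (singularForm m A B) (t, y) X
        = frameForm ((t ^ m)⁻¹ • fderiv ℝ A (t, y) X + (κ * X.1) • A (t, y))
          (fderiv ℝ B (t, y) X) := by
  have hmem := (h.isOpen_dom hU).mem_nhds (show (t, y) ∈ Ioo (-ε) ε ×ˢ U from ⟨ht, hy⟩)
  have hA := ((h.smooth_A.contDiffAt hmem).differentiableAt (by simp)).hasFDerivAt
  have hB := ((h.smooth_B.contDiffAt hmem).differentiableAt (by simp)).hasFDerivAt
  obtain ⟨κ, hc⟩ : ∃ κ : ℝ, HasDerivAt (fun t : ℝ => (t ^ m)⁻¹) κ t :=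
    ⟨_, (hasDerivAt_pow m t).fun_inv (pow_ne_zero m h0)⟩
  have hc' : HasFDerivAt (fun p : ℝ × E => (p.1 ^ m)⁻¹)
      (κ • ContinuousLinearMap.fst ℝ ℝ E) (t, y) :=
    HasDerivAt.comp_hasFDerivAt (h₂ := fun t : ℝ => (t ^ m)⁻¹) (t, y) hc
      (hasFDerivAt_fst (p := (t, y)))
  refine ⟨κ, ?_⟩
  have he : singularForm m A B = fun p => frameFormL E ((p.1 ^ m)⁻¹ • A p, B p) :=
    funext fun p => (frameFormL_apply ((p.1 ^ m)⁻¹ • A p, B p)).symm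
  have hs := hc'.smul hA
  have hp := hs.prodMk hB
  have hf := (frameFormL E).hasFDerivAt.comp (t, y) hp
  rw [he]
  refine ⟨hf.differentiableAt, fun X => ?_⟩
  have h1 := DFunLike.congr_fun hf.fderiv X
  refine h1.trans ?_
  rw [ContinuousLinearMap.comp_apply, frameFormL_apply]
  rfl

lemma closed_singularForm {t : ℝ} (ht : t ∈ Ioo (-ε) ε) (h0 : t ≠ 0) {y : E} (hy : y ∈ U)
    (u v w : ℝ × E) :
    fderiv ℝ (singularForm m A B) (t, y) u v w + fderiv ℝ (singularForm m A B) (t, y) v w u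
      + fderiv ℝ (singularForm m A B) (t, y) w u v = 0 := by
  obtain ⟨κ, -, hκ⟩ := h.fderiv_singularForm hU ht h0 hy
  rw [hκ, hκ, hκ]
  have hsplit : ∀ {G : Type u} [NormedAddCommGroup G] [NormedSpace ℝ G] (L : ℝ × E →L[ℝ] G)
      (c : ℝ) (v : E), L (c, v) = c • L (1, 0) + L (0, v) := by
    intro G _ _ L c v
    rw [← map_smul, ← map_add]
    simp
  obtain ⟨c₁, v₁⟩ := u
  obtain ⟨c₂, v₂⟩ := v
  obtain ⟨c₃, v₃⟩ := w
  have k1 := h.closed_A t ht h0 y hy v₂ v₃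
  have k2 := h.closed_A t ht h0 y hy v₃ v₁
  have k3 := h.closed_A t ht h0 y hy v₁ v₂
  have k4 := h.closed_B t ht h0 y hy v₁ v₂ v₃
  have hp : t ^ m ≠ 0 := pow_ne_zero m h0
  unfold curl at k1 k2 k3
  simp only [frameForm_apply, add_apply, smul_apply, smul_eq_mul]
  rw [hsplit (fderiv ℝ A (t, y)) c₁ v₁, hsplit (fderiv ℝ A (t, y)) c₂ v₂,
    hsplit (fderiv ℝ A (t, y)) c₃ v₃, hsplit (fderiv ℝ B (t, y)) c₁ v₁,
    hsplit (fderiv ℝ B (t, y)) c₂ v₂, hsplit (fderiv ℝ B (t, y)) c₃ v₃]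
  simp only [add_apply, smul_apply, smul_eq_mul]
  have hi : t ^ m * (t ^ m)⁻¹ = 1 := mul_inv_cancel₀ hp
  generalize (t ^ m)⁻¹ = i at *
  linear_combination i * (c₁ * k1 + c₂ * k2 + c₃ * k3) + k4
    - (c₁ * fderiv ℝ B (t, y) (1, 0) v₂ v₃ + c₂ * fderiv ℝ B (t, y) (1, 0) v₃ v₁
      + c₃ * fderiv ℝ B (t, y) (1, 0) v₁ v₂) * hi

/-- The truncation of the expansion is again closed. -/
lemma truncate : IsClosedPair m ε U (fun p => A p - p.1 ^ m • quot A m p) (fun p => B (0, p.2)) where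
  smooth_A := h.smooth_A.sub ((contDiffOn_fst.pow m).smul (h.smooth_quot hU m))
  smooth_B := by
    by_cases hε : 0 < ε
    · exact h.smooth_B.comp (contDiffOn_const.prodMk contDiffOn_snd) fun p hp =>
        ⟨⟨by simpa using hε, hε⟩, hp.2⟩
    · rw [Ioo_eq_empty (by linarith), empty_prod]
      exact contDiffOn_empty
  closed_A := by
    intro t ht h0 y hy v w
    have hmem := (h.isOpen_dom hU).mem_nhds (show (t, y) ∈ Ioo (-ε) ε ×ˢ U from ⟨ht, hy⟩)
    have hε : (0 : ℝ) ∈ Ioo (-ε) ε := ⟨by linarith [ht.1, ht.2], by linarith [ht.1, ht.2]⟩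
    have hmem0 := (h.isOpen_dom hU).mem_nhds (show ((0 : ℝ), y) ∈ Ioo (-ε) ε ×ˢ U from ⟨hε, hy⟩)
    have hA := ((h.smooth_A.contDiffAt hmem).differentiableAt (by simp)).hasFDerivAt
    have hQ := (((h.smooth_quot hU m).contDiffAt hmem).differentiableAt (by simp)).hasFDerivAt
    have hB := ((h.smooth_B.contDiffAt hmem0).differentiableAt (by simp)).hasFDerivAt
    have e1 : fderiv ℝ (fun p : ℝ × E => B (0, p.2)) (t, y) (1, 0) = 0 := by
      have := (hB.comp (t, y) (f := fun p : ℝ × E => ((0 : ℝ), p.2))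
        ((hasFDerivAt_const _ _).prodMk hasFDerivAt_snd)).fderiv
      simp only [Function.comp_def] at this
      rw [this]
      exact (fderiv ℝ B (0, y)).map_zero
    have hc : HasFDerivAt (fun p : ℝ × E => p.1 ^ m)
        (deriv (fun t : ℝ => t ^ m) t • ContinuousLinearMap.fst ℝ ℝ E) (t, y) :=
      HasDerivAt.comp_hasFDerivAt (h₂ := fun t : ℝ => t ^ m) (t, y)
        (differentiableAt_pow m).hasDerivAt (hasFDerivAt_fst (p := (t, y)))
    have e2 := (hA.sub (hc.smul hQ)).fderiv
    change fderiv ℝ (fun p => A p - p.1 ^ m • quot A m p) (t, y) = _ at e2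
    rw [e1, e2]
    have k1 := h.closed_A t ht h0 y hy v w
    have k2 := h.curl_quot hU le_rfl ht hy v w
    rw [Nat.sub_self, pow_zero, one_mul] at k2
    unfold curl at k1 k2 ⊢
    simp only [add_apply, sub_apply, smul_apply, ContinuousLinearMap.smulRight_apply,
      ContinuousLinearMap.coe_fst', smul_eq_mul, zero_apply, mul_zero, zero_smul, add_zero]
    linear_combination t ^ m * k2 + k1
  closed_B := by
    intro t ht h0 y hy u v w
    have hε : (0 : ℝ) ∈ Ioo (-ε) ε := ⟨by linarith [ht.1, ht.2], by linarith [ht.1, ht.2]⟩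
    have hmem0 := (h.isOpen_dom hU).mem_nhds (show ((0 : ℝ), y) ∈ Ioo (-ε) ε ×ˢ U from ⟨hε, hy⟩)
    have hB := ((h.smooth_B.contDiffAt hmem0).differentiableAt (by simp)).hasFDerivAt
    have e1 := (hB.comp (t, y) (f := fun p : ℝ × E => ((0 : ℝ), p.2))
        ((hasFDerivAt_const _ _).prodMk hasFDerivAt_snd)).fderiv
    simp only [Function.comp_def] at e1
    rw [e1]
    exact h.closed_B' hU hε hy u v w

/-- The primitive of the difference between the form and its truncation. -/
lemma curl_primitive {t : ℝ} (ht : t ∈ Ioo (-ε) ε) (h0 : t ≠ 0) {y : E} (hy : y ∈ U) :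
    DifferentiableAt ℝ (fun p : ℝ × E => (p.1 • meanTo (fun s => quot A m (s, p.2)) p.1).comp
      (ContinuousLinearMap.snd ℝ ℝ E)) (t, y) ∧ ∀ v w : ℝ × E,
    fderiv ℝ (fun p : ℝ × E => (p.1 • meanTo (fun s => quot A m (s, p.2)) p.1).comp
      (ContinuousLinearMap.snd ℝ ℝ E)) (t, y) v w
      - fderiv ℝ (fun p : ℝ × E => (p.1 • meanTo (fun s => quot A m (s, p.2)) p.1).comp
      (ContinuousLinearMap.snd ℝ ℝ E)) (t, y) w v
      = singularForm m A B (t, y) v w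
        - singularForm m (fun p => A p - p.1 ^ m • quot A m p) (fun p => B (0, p.2)) (t, y) v w := by
  have hmem := (h.isOpen_dom hU).mem_nhds (show (t, y) ∈ Ioo (-ε) ε ×ˢ U from ⟨ht, hy⟩)
  set ν : ℝ × E → E →L[ℝ] ℝ := fun p => meanTo (fun s => quot A m (s, p.2)) p.1 with hν
  have hνd : HasFDerivAt ν (fderiv ℝ ν (t, y)) (t, y) :=
    (((contDiffOn_meanTo_param hU (h.smooth_quot hU m)).contDiffAt hmem).differentiableAt
      (by simp)).hasFDerivAt
  have hμ : HasFDerivAt (fun p : ℝ × E => p.1 • ν p) _ (t, y) := hasFDerivAt_fst.smul hνd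
  set D := fderiv ℝ (fun p : ℝ × E => p.1 • ν p) (t, y) with hD
  have hμ' : HasFDerivAt (fun p : ℝ × E => p.1 • ν p) D (t, y) :=
    hμ.differentiableAt.hasFDerivAt
  have hfull : HasFDerivAt (fun p : ℝ × E => (p.1 • ν p).comp (ContinuousLinearMap.snd ℝ ℝ E))
      (((ContinuousLinearMap.compL ℝ (ℝ × E) E ℝ).flip (ContinuousLinearMap.snd ℝ ℝ E)).comp D)
      (t, y) :=
    ((ContinuousLinearMap.compL ℝ (ℝ × E) E ℝ).flip
      (ContinuousLinearMap.snd ℝ ℝ E)).hasFDerivAt.comp (t, y) hμ'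
  refine ⟨hfull.differentiableAt, fun v w => ?_⟩
  rw [hfull.fderiv]
  obtain ⟨c₁, v₁⟩ := v
  obtain ⟨c₂, v₂⟩ := w
  have hsplit : ∀ (c : ℝ) (v : E), D (c, v) = c • D (1, 0) + D (0, v) := by
    intro c v
    rw [← map_smul, ← map_add]
    simp
  have hDt : D (1, 0) = quot A m (t, y) := by
    have e := hμ'.comp_hasDerivAt (f := fun t => (t, y)) t
      ((hasDerivAt_id t).prodMk (hasDerivAt_const t y))
    exact e.unique (h.hasDerivAt_smul_mean hU ht hy)
  have hDy : ∀ v, D (0, v) = t • fderiv ℝ ν (t, y) (0, v) := by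
    intro v
    rw [hμ'.unique hμ]
    simp
  have k := h.curl_mean hU ht hy v₁ v₂
  unfold curl at k
  change D (c₁, v₁) v₂ - D (c₂, v₂) v₁ = _
  rw [hsplit, hsplit c₂, hDt, hDy, hDy]
  have hi : (t ^ m)⁻¹ * t ^ m = 1 := inv_mul_cancel₀ (pow_ne_zero m h0)
  simp only [singularForm, frameForm_apply, add_apply, sub_apply, smul_apply, smul_eq_mul]
  linear_combination k - (c₁ * quot A m (t, y) v₂ - c₂ * quot A m (t, y) v₁) * hi

end IsClosedPair

end LocalForms

/-! ### Moser's vector field, fibrewise -/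

section Nondegenerate

variable {F : Type*} [NormedAddCommGroup F] [NormedSpace ℝ F] [FiniteDimensional ℝ F]

/-- A bilinear form without left kernel. -/
def IsNondeg (β : F →L[ℝ] F →L[ℝ] ℝ) : Prop := ∀ u, (∀ w, β u w = 0) → u = 0

lemma IsNondeg.exists_equiv {β : F →L[ℝ] F →L[ℝ] ℝ} (hβ : IsNondeg β) :
    ∃ e : F ≃L[ℝ] (F →L[ℝ] ℝ), (e : F →L[ℝ] F →L[ℝ] ℝ) = β := by
  have hinj : Function.Injective β.toLinearMap := by
    rw [← LinearMap.ker_eq_bot, LinearMap.ker_eq_bot']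
    intro u hu
    exact hβ u fun w => DFunLike.congr_fun hu w
  have hdim : Module.finrank ℝ F = Module.finrank ℝ (F →L[ℝ] ℝ) := by
    rw [← (LinearMap.toContinuousLinearMap (𝕜 := ℝ) (E := F) (F' := ℝ)).finrank_eq]
    exact Subspace.dual_finrank_eq.symm
  exact ⟨(LinearEquiv.ofInjectiveOfFinrankEq β.toLinearMap hinj hdim).toContinuousLinearEquiv,
    by ext; rfl⟩

lemma isNondeg_of_equiv (e : F ≃L[ℝ] (F →L[ℝ] ℝ)) : IsNondeg (e : F →L[ℝ] F →L[ℝ] ℝ) := by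
  intro u hu
  have : e u = 0 := by ext w; exact hu w
  simpa using this

lemma IsNondeg.apply_inverse {β : F →L[ℝ] F →L[ℝ] ℝ} (hβ : IsNondeg β) (l : F →L[ℝ] ℝ) (w : F) :
    β (β.inverse l) w = l w := by
  obtain ⟨e, rfl⟩ := hβ.exists_equiv
  rw [ContinuousLinearMap.inverse_equiv]
  exact DFunLike.congr_fun (e.apply_symm_apply l) w

lemma IsNondeg.eq_of_apply {β : F →L[ℝ] F →L[ℝ] ℝ} (hβ : IsNondeg β) {u v : F}
    (h : ∀ w, β u w = β v w) : u = v := by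
  refine sub_eq_zero.1 (hβ _ fun w => ?_)
  rw [map_sub, sub_apply, h, sub_self]

lemma IsNondeg.eventually {β : F →L[ℝ] F →L[ℝ] ℝ} (hβ : IsNondeg β) :
    ∀ᶠ γ in 𝓝 β, IsNondeg γ := by
  have := FiniteDimensional.complete ℝ F
  obtain ⟨e, rfl⟩ := hβ.exists_equiv
  filter_upwards [ContinuousLinearEquiv.nhds e] with γ hγ
  obtain ⟨e', rfl⟩ := hγ
  exact isNondeg_of_equiv e'

lemma IsNondeg.contDiffAt_inverse {β : F →L[ℝ] F →L[ℝ] ℝ} (hβ : IsNondeg β) :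
    ContDiffAt ℝ ∞ (ContinuousLinearMap.inverse : (F →L[ℝ] F →L[ℝ] ℝ) → _) β := by
  have := FiniteDimensional.complete ℝ F
  obtain ⟨e, rfl⟩ := hβ.exists_equiv
  exact contDiffAt_map_inverse e

end Nondegenerate

section Fibre

variable {E : Type u} [NormedAddCommGroup E] [NormedSpace ℝ E] [FiniteDimensional ℝ E]

/-- The interpolation between the truncation of a `bᵐ`-form and the form, in the frame
`tᵐ ∂/∂t, ∂/∂y`. -/
def midForm (m : ℕ) (a : ℝ → E →L[ℝ] ℝ) (b : ℝ → E →L[ℝ] E →L[ℝ] ℝ) (s t : ℝ) :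
    ℝ × E →L[ℝ] ℝ × E →L[ℝ] ℝ :=
  frameForm (a t - ((1 - s) * t ^ m) • taylorQuot a m t) ((1 - s) • b 0 + s • b t)

/-- The primitive of the difference, divided by `t`. -/
def meanForm (m : ℕ) (a : ℝ → E →L[ℝ] ℝ) (t : ℝ) : E →L[ℝ] ℝ := meanTo (taylorQuot a m) t

/-- Moser's vector field in the frame `tᵐ⁺¹ ∂/∂t, t ∂/∂y`. -/
def moserVec (m : ℕ) (a : ℝ → E →L[ℝ] ℝ) (b : ℝ → E →L[ℝ] E →L[ℝ] ℝ) (s t : ℝ) : ℝ × E :=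
  -(midForm m a b s t).inverse ((meanForm m a t).comp (ContinuousLinearMap.snd ℝ ℝ E))

lemma midForm_moserVec {m : ℕ} {a : ℝ → E →L[ℝ] ℝ} {b : ℝ → E →L[ℝ] E →L[ℝ] ℝ} {s t : ℝ}
    (h : IsNondeg (midForm m a b s t)) (w : ℝ × E) :
    midForm m a b s t (moserVec m a b s t) w = -meanForm m a t w.2 := by
  rw [moserVec, map_neg, neg_apply, h.apply_inverse]
  rfl

lemma midForm_zero {m : ℕ} (hm : m ≠ 0) (a : ℝ → E →L[ℝ] ℝ) (b : ℝ → E →L[ℝ] E →L[ℝ] ℝ) (s : ℝ) :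
    midForm m a b s 0 = frameForm (a 0) (b 0) := by
  rw [midForm, zero_pow hm, mul_zero, zero_smul, sub_zero, ← add_smul]
  simp

variable {E' : Type u} [NormedAddCommGroup E'] [NormedSpace ℝ E'] [FiniteDimensional ℝ E']
  {ε : ℝ} {a : ℝ → E →L[ℝ] ℝ} {b : ℝ → E →L[ℝ] E →L[ℝ] ℝ}
  {a' : ℝ → E' →L[ℝ] ℝ} {b' : ℝ → E' →L[ℝ] E' →L[ℝ] ℝ} {L : E' →L[ℝ] E} {s t : ℝ}

lemma taylorQuot_comp (m : ℕ) (hs : ContDiffOn ℝ ∞ a (Ioo (-ε) ε))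
    (ha : ∀ t ∈ Ioo (-ε) ε, a' t = (a t).comp L) (ht : t ∈ Ioo (-ε) ε) :
    taylorQuot a' m t = (taylorQuot a m t).comp L := by
  have hε : 0 < ε := by linarith [ht.1, ht.2]
  have h1 := taylorQuot_congr (g' := fun t => (a t).comp L) hε ha m ht
  rw [h1]
  exact congrFun (taylorQuot_clm ((ContinuousLinearMap.compL ℝ E' E ℝ).flip L) hε hs m) t

lemma meanForm_comp (m : ℕ) (hs : ContDiffOn ℝ ∞ a (Ioo (-ε) ε))
    (ha : ∀ t ∈ Ioo (-ε) ε, a' t = (a t).comp L) (ht : t ∈ Ioo (-ε) ε) :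
    meanForm m a' t = (meanForm m a t).comp L := by
  have hint : IntervalIntegrable (fun s => taylorQuot a m (s * t)) MeasureTheory.volume 0 1 := by
    apply ContinuousOn.intervalIntegrable
    rw [uIcc_of_le zero_le_one]
    exact (contDiffOn_taylorQuot hs m).continuousOn.comp (by fun_prop) fun s hs => mul_mem_Ioo hs ht
  have h1 := ((ContinuousLinearMap.compL ℝ E' E ℝ).flip L).intervalIntegral_comp_comm hint
  refine Eq.trans ?_ h1
  refine intervalIntegral.integral_congr fun s hs' => ?_
  rw [uIcc_of_le zero_le_one] at hs'
  exact taylorQuot_comp m hs ha (mul_mem_Ioo hs' ht)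

lemma midForm_comp (m : ℕ) (hs : ContDiffOn ℝ ∞ a (Ioo (-ε) ε))
    (ha : ∀ t ∈ Ioo (-ε) ε, a' t = (a t).comp L)
    (hb : ∀ t ∈ Ioo (-ε) ε, b' t = (b t).bilinearComp L L) (ht : t ∈ Ioo (-ε) ε) (x y : ℝ × E') :
    midForm m a' b' s t x y = midForm m a b s t (x.1, L x.2) (y.1, L y.2) := by
  have h0 : (0 : ℝ) ∈ Ioo (-ε) ε := ⟨by linarith [ht.1, ht.2], by linarith [ht.1, ht.2]⟩
  simp only [midForm, frameForm_apply, ha t ht, hb t ht, hb 0 h0, taylorQuot_comp m hs ha ht]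
  rfl

lemma moserVec_comp (m : ℕ) (hs : ContDiffOn ℝ ∞ a (Ioo (-ε) ε))
    (ha : ∀ t ∈ Ioo (-ε) ε, a' t = (a t).comp L)
    (hb : ∀ t ∈ Ioo (-ε) ε, b' t = (b t).bilinearComp L L) (ht : t ∈ Ioo (-ε) ε)
    (hL : Function.Surjective L) (h : IsNondeg (midForm m a b s t))
    (h' : IsNondeg (midForm m a' b' s t)) :
    moserVec m a b s t = ((moserVec m a' b' s t).1, L (moserVec m a' b' s t).2) := by
  refine h.eq_of_apply fun w => ?_
  obtain ⟨w₂, hw⟩ := hL w.2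
  have e : w = ((w.1, w₂).1, L (w.1, w₂).2) := by rw [hw]
  rw [e, ← midForm_comp m hs ha hb ht, midForm_moserVec h', midForm_moserVec h,
    meanForm_comp m hs ha ht]
  rfl

lemma isNondeg_midForm_comp (m : ℕ) (hs : ContDiffOn ℝ ∞ a (Ioo (-ε) ε))
    (ha : ∀ t ∈ Ioo (-ε) ε, a' t = (a t).comp L)
    (hb : ∀ t ∈ Ioo (-ε) ε, b' t = (b t).bilinearComp L L) (ht : t ∈ Ioo (-ε) ε)
    (hL : Function.Bijective L) :
    IsNondeg (midForm m a' b' s t) ↔ IsNondeg (midForm m a b s t) := by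
  constructor
  · intro h u hu
    obtain ⟨u₂, hu₂⟩ := hL.2 u.2
    have e : u = ((u.1, u₂).1, L (u.1, u₂).2) := by rw [hu₂]
    have := h (u.1, u₂) fun w => by
      rw [midForm_comp m hs ha hb ht, ← e]; exact hu _
    rw [Prod.mk_eq_zero] at this
    rw [e, Prod.mk_eq_zero]
    exact ⟨this.1, by simp [this.2]⟩
  · intro h u hu
    have := h (u.1, L u.2) fun w => by
      obtain ⟨w₂, hw⟩ := hL.2 w.2
      have e : w = ((w.1, w₂).1, L (w.1, w₂).2) := by rw [hw]
      rw [e, ← midForm_comp m hs ha hb ht]; exact hu _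
    rw [Prod.mk_eq_zero] at this
    exact Prod.ext this.1 (hL.1 (by rw [this.2]; simp))

end Fibre

section Chart

variable {E : Type u} [NormedAddCommGroup E] [NormedSpace ℝ E] [FiniteDimensional ℝ E]
  {m : ℕ} {ε : ℝ} {U : Set E} {A : ℝ × E → E →L[ℝ] ℝ} {B : ℝ × E → E →L[ℝ] E →L[ℝ] ℝ}

namespace IsClosedPair

variable (h : IsClosedPair m ε U A B) (hU : IsOpen U)

include h hU

lemma contDiffAt_midForm {s t : ℝ} {y : E} (ht : t ∈ Ioo (-ε) ε) (hy : y ∈ U) :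
    ContDiffAt ℝ ∞ (fun x : ℝ × (ℝ × E) => midForm m (fun r => A (r, x.2.2)) (fun r => B (r, x.2.2))
      x.1 x.2.1) (s, (t, y)) := by
  have hmem := (h.isOpen_dom hU).mem_nhds (show (t, y) ∈ Ioo (-ε) ε ×ˢ U from ⟨ht, hy⟩)
  have h0 : (0 : ℝ) ∈ Ioo (-ε) ε := ⟨by linarith [ht.1, ht.2], by linarith [ht.1, ht.2]⟩
  have hmem0 := (h.isOpen_dom hU).mem_nhds (show ((0 : ℝ), y) ∈ Ioo (-ε) ε ×ˢ U from ⟨h0, hy⟩)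
  have hA : ContDiffAt ℝ ∞ (fun x : ℝ × (ℝ × E) => A x.2) (s, (t, y)) :=
    (h.smooth_A.contDiffAt hmem).comp (s, (t, y)) contDiffAt_snd
  have hQ : ContDiffAt ℝ ∞ (fun x : ℝ × (ℝ × E) => quot A m x.2) (s, (t, y)) :=
    ((h.smooth_quot hU m).contDiffAt hmem).comp (s, (t, y)) contDiffAt_snd
  have hB : ContDiffAt ℝ ∞ (fun x : ℝ × (ℝ × E) => B x.2) (s, (t, y)) :=
    (h.smooth_B.contDiffAt hmem).comp (s, (t, y)) contDiffAt_snd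
  have hB0 : ContDiffAt ℝ ∞ (fun x : ℝ × (ℝ × E) => B (0, x.2.2)) (s, (t, y)) :=
    (h.smooth_B.contDiffAt hmem0).comp (f := fun x : ℝ × (ℝ × E) => ((0 : ℝ), x.2.2)) (s, (t, y))
      (contDiffAt_const.prodMk contDiffAt_snd.snd)
  have hs : ContDiffAt ℝ ∞ (fun x : ℝ × (ℝ × E) => 1 - x.1) (s, (t, y)) :=
    contDiffAt_const.sub contDiffAt_fst
  have h1 := ((hA.sub ((hs.mul (contDiffAt_snd.fst.pow m)).smul hQ)).prodMk
    ((hs.smul hB0).add (contDiffAt_fst.smul hB)))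
  refine (((frameFormL E).contDiff.contDiffAt (n := ∞)).comp (s, (t, y)) h1).congr_of_eventuallyEq
    (.of_forall fun x => ?_)
  rw [Function.comp_apply, frameFormL_apply]
  rfl

lemma contDiffAt_moserVec {s t : ℝ} {y : E} (ht : t ∈ Ioo (-ε) ε) (hy : y ∈ U)
    (hnd : IsNondeg (midForm m (fun r => A (r, y)) (fun r => B (r, y)) s t)) :
    ContDiffAt ℝ ∞ (fun x : ℝ × (ℝ × E) => moserVec m (fun r => A (r, x.2.2))
      (fun r => B (r, x.2.2)) x.1 x.2.1) (s, (t, y)) := by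
  have hmem := (h.isOpen_dom hU).mem_nhds (show (t, y) ∈ Ioo (-ε) ε ×ˢ U from ⟨ht, hy⟩)
  have hmid := h.contDiffAt_midForm hU (s := s) ht hy
  have hν : ContDiffAt ℝ ∞ (fun p : ℝ × E => meanForm m (fun r => A (r, p.2)) p.1) (t, y) :=
    (contDiffOn_meanTo_param hU (h.smooth_quot hU m)).contDiffAt hmem
  have hν' : ContDiffAt ℝ ∞ (fun x : ℝ × (ℝ × E) => (meanForm m (fun r => A (r, x.2.2)) x.2.1).comp
      (ContinuousLinearMap.snd ℝ ℝ E)) (s, (t, y)) :=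
    ContDiffAt.clm_comp (hν.comp (s, (t, y)) contDiffAt_snd) contDiffAt_const
  have hinv : ContDiffAt ℝ ∞ (fun x : ℝ × (ℝ × E) => (midForm m (fun r => A (r, x.2.2))
      (fun r => B (r, x.2.2)) x.1 x.2.1).inverse) (s, (t, y)) :=
    ContDiffAt.comp (s, (t, y)) (g := ContinuousLinearMap.inverse) hnd.contDiffAt_inverse hmid
  exact (hinv.clm_apply hν').neg

omit h hU in
lemma singularForm_interpolate {s t : ℝ} (y : E)
    (v w : ℝ × E) :
    ((1 - s) • singularForm m (fun p => A p - p.1 ^ m • quot A m p) (fun p => B (0, p.2)) (t, y)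
      + s • singularForm m A B (t, y)) v w
    = midForm m (fun r => A (r, y)) (fun r => B (r, y)) s t ((t ^ m)⁻¹ * v.1, v.2)
      ((t ^ m)⁻¹ * w.1, w.2) := by
  simp only [singularForm, midForm, frameForm_apply, add_apply, sub_apply, smul_apply, smul_eq_mul,
    quot]
  ring

omit h hU in
/-- The equation that defines Moser's vector field. -/
lemma singularForm_moserVec {s t : ℝ} (h0 : t ≠ 0) (y : E)
    (hnd : IsNondeg (midForm m (fun r => A (r, y)) (fun r => B (r, y)) s t)) (w : ℝ × E) :
    ((1 - s) • singularForm m (fun p => A p - p.1 ^ m • quot A m p) (fun p => B (0, p.2)) (t, y)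
      + s • singularForm m A B (t, y))
        (t ^ (m + 1) * (moserVec m (fun r => A (r, y)) (fun r => B (r, y)) s t).1,
          t • (moserVec m (fun r => A (r, y)) (fun r => B (r, y)) s t).2) w
    = -((t • meanTo (fun s => quot A m (s, y)) t).comp (ContinuousLinearMap.snd ℝ ℝ E)) w := by
  rw [singularForm_interpolate]
  have e : ((t ^ m)⁻¹ * (t ^ (m + 1) * (moserVec m (fun r => A (r, y)) (fun r => B (r, y)) s t).1),
      t • (moserVec m (fun r => A (r, y)) (fun r => B (r, y)) s t).2)
      = t • moserVec m (fun r => A (r, y)) (fun r => B (r, y)) s t := by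
    refine Prod.ext ?_ rfl
    change _ = t * _
    have : t ^ m ≠ 0 := pow_ne_zero m h0
    field_simp
    ring
  change midForm _ _ _ _ _ ((t ^ m)⁻¹ * (t ^ (m + 1) * _), t • _) _ = _
  rw [e, map_smul, smul_apply, midForm_moserVec hnd]
  change t * -_ = -(t * _)
  rw [mul_neg]
  rfl

end IsClosedPair

end Chart

/-! ### Families of forms on a manifold -/

section ProdChart

variable {E : Type*} [NormedAddCommGroup E] [NormedSpace ℝ E]
  {H : Type*} [TopologicalSpace H] (I : ModelWithCorners ℝ E H) [I.Boundaryless]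
  {P : Type*} [TopologicalSpace P] [ChartedSpace H P] [IsManifold I ∞ P]

lemma chartParam_prod_apply (p₀ : ℝ × P) (x : ℝ × E) :
    chartParam (𝓘(ℝ, ℝ).prod I) p₀ x = (x.1, chartParam I p₀.2 x.2) := by
  rw [chartParam_coe, chartParam_coe, extChartAt_prod]
  rfl

lemma chartParam_prod_source (p₀ : ℝ × P) :
    (chartParam (𝓘(ℝ, ℝ).prod I) p₀).source = univ ×ˢ (chartParam I p₀.2).source := by
  rw [chartParam_source, chartParam_source, extChartAt_prod, PartialEquiv.prod_target,
    extChartAt_model_space_eq_id]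
  rfl

variable {I} in
lemma hasMFDerivAt_prod_left {k : E → P} {k' : E →L[ℝ] E} {x : ℝ × E}
    (hk : HasMFDerivAt 𝓘(ℝ, E) I k x.2 k') :
    HasMFDerivAt 𝓘(ℝ, ℝ × E) (𝓘(ℝ, ℝ).prod I) (fun x : ℝ × E => (x.1, k x.2)) x
      ((ContinuousLinearMap.fst ℝ ℝ E).prod (k'.comp (ContinuousLinearMap.snd ℝ ℝ E))) := by
  have h1 : HasMFDerivAt 𝓘(ℝ, ℝ × E) 𝓘(ℝ, ℝ) (Prod.fst : ℝ × E → ℝ) x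
      (ContinuousLinearMap.fst ℝ ℝ E) := hasMFDerivAt_iff_hasFDerivAt.2 hasFDerivAt_fst
  have h2 : HasMFDerivAt 𝓘(ℝ, ℝ × E) 𝓘(ℝ, E) (Prod.snd : ℝ × E → E) x
      (ContinuousLinearMap.snd ℝ ℝ E) := hasMFDerivAt_iff_hasFDerivAt.2 hasFDerivAt_snd
  exact h1.prodMk (HasMFDerivAt.comp x hk h2)

/-- The derivative of the inverse of the preferred chart. -/
def chartDeriv (p₀ : P) (y : E) : E →L[ℝ] E := mfderiv 𝓘(ℝ, E) I (chartParam I p₀) y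

variable {I}

lemma hasMFDerivAt_chartParam {p₀ : P} {y : E} (hy : y ∈ (chartParam I p₀).source) :
    HasMFDerivAt 𝓘(ℝ, E) I (chartParam I p₀) y (chartDeriv (E := E) I p₀ y) :=
  ((chartParam I p₀).mdifferentiableAt' hy).hasMFDerivAt

lemma exists_inverse_chartDeriv {p₀ : P} {y : E} (hy : y ∈ (chartParam I p₀).source) :
    ∃ e : E ≃L[ℝ] E, (e : E →L[ℝ] E) = chartDeriv I p₀ y :=
  (chartParam I p₀).isInvertible_mfderiv hy

lemma bijective_chartDeriv {p₀ : P} {y : E} (hy : y ∈ (chartParam I p₀).source) :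
    Function.Bijective (chartDeriv I p₀ y) := by
  obtain ⟨e, he⟩ := exists_inverse_chartDeriv hy
  rw [← he]
  exact e.bijective

lemma hasMFDerivAt_chartParam_prod {p₀ : ℝ × P} {x : ℝ × E}
    (hx : x.2 ∈ (chartParam I p₀.2).source) :
    HasMFDerivAt 𝓘(ℝ, ℝ × E) (𝓘(ℝ, ℝ).prod I) (chartParam (𝓘(ℝ, ℝ).prod I) p₀) x
      ((ContinuousLinearMap.fst ℝ ℝ E).prod
        ((chartDeriv I p₀.2 x.2).comp (ContinuousLinearMap.snd ℝ ℝ E))) := by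
  have e : (chartParam (𝓘(ℝ, ℝ).prod I) p₀ : ℝ × E → ℝ × P)
      = fun x => (x.1, chartParam I p₀.2 x.2) := funext fun x => chartParam_prod_apply I p₀ x
  rw [e]
  exact hasMFDerivAt_prod_left (hasMFDerivAt_chartParam hx)

lemma chartDeriv_prod {p₀ : ℝ × P} {x : ℝ × E} (hx : x.2 ∈ (chartParam I p₀.2).source) :
    chartDeriv (𝓘(ℝ, ℝ).prod I) p₀ x = (ContinuousLinearMap.fst ℝ ℝ E).prod
        ((chartDeriv I p₀.2 x.2).comp (ContinuousLinearMap.snd ℝ ℝ E)) :=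
  (hasMFDerivAt_chartParam_prod hx).mfderiv

lemma mem_chartParam_source (p₀ : P) : extChartAt I p₀ p₀ ∈ (chartParam I p₀).source :=
  mem_extChartAt_target p₀

lemma chartParam_self (p₀ : P) : chartParam I p₀ (extChartAt I p₀ p₀) = p₀ := extChartAt_to_inv p₀

/-- A function is smooth if its expression in a local parametrization is. -/
lemma contMDiffAt_of_param {G : Type*} [NormedAddCommGroup G] [NormedSpace ℝ G] {f : P → G}
    (k : PartialDiffeomorph 𝓘(ℝ, E) I E P ∞) {x₀ : E} (hx₀ : x₀ ∈ k.source)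
    (hf : ContDiffAt ℝ ∞ (fun x => f (k x)) x₀) : ContMDiffAt I 𝓘(ℝ, G) ∞ f (k x₀) := by
  have hk : k x₀ ∈ k.symm.source := k.map_source hx₀
  have h1 : ContMDiffAt 𝓘(ℝ, E) 𝓘(ℝ, G) ∞ (fun x => f (k x)) (k.symm (k x₀)) := by
    rw [k.symm_apply_apply hx₀]
    exact hf.contMDiffAt
  refine (h1.comp (k x₀) (k.symm.contMDiffAt hk)).congr_of_eventuallyEq ?_
  filter_upwards [k.open_target.mem_nhds hk] with p hp
  exact congrArg f (k.apply_symm_apply hp).symm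

lemma contMDiffAt_of_chartParam {G : Type*} [NormedAddCommGroup G] [NormedSpace ℝ G] {f : P → G}
    (p₀ : P) (hf : ContDiffAt ℝ ∞ (fun x => f (chartParam I p₀ x)) (extChartAt I p₀ p₀)) :
    ContMDiffAt I 𝓘(ℝ, G) ∞ f p₀ := by
  have := contMDiffAt_of_param (chartParam I p₀) (mem_chartParam_source p₀) hf
  rwa [chartParam_self] at this

end ProdChart

section Cutoff

variable {E : Type u} [NormedAddCommGroup E] [NormedSpace ℝ E] [FiniteDimensional ℝ E]
  {Z : Type*} (c χ κ : ℝ → ℝ) (m : ℕ)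

/-- Moser's vector field in a frame, cut off. -/
def cutVec (a : ℝ → Z → E →L[ℝ] ℝ) (b : ℝ → Z → E →L[ℝ] E →L[ℝ] ℝ) (x : ℝ × (ℝ × Z)) : ℝ × E :=
  (c x.1 * χ x.2.1) • moserVec m (fun t => a t x.2.2) (fun t => b t x.2.2) x.1 x.2.1

/-- Moser's time-dependent vector field, cut off, as a vector field on the space-time. -/
def moserField (a : ℝ → Z → E →L[ℝ] ℝ) (b : ℝ → Z → E →L[ℝ] E →L[ℝ] ℝ) (x : ℝ × (ℝ × Z)) :
    ℝ × (ℝ × E) :=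
  (c x.1 * κ x.2.1, (x.2.1 ^ (m + 1) * (cutVec c χ m a b x).1, x.2.1 • (cutVec c χ m a b x).2))

variable {c χ κ m} {ε δ : ℝ} {U : Set E} {A : ℝ × E → E →L[ℝ] ℝ} {B : ℝ × E → E →L[ℝ] E →L[ℝ] ℝ}

lemma IsClosedPair.contDiffAt_cutVec (h : IsClosedPair m ε U A B) (hU : IsOpen U)
    (hc : ContDiff ℝ ∞ c) (hχ : ContDiff ℝ ∞ χ) (hδ : δ < ε)
    (hc0 : ∀ s, 3 < |s| → c s = 0) (hχ0 : ∀ t, δ < |t| → χ t = 0)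
    (hnd : ∀ s, |s| ≤ 3 → ∀ t, |t| ≤ δ → ∀ y ∈ U,
      IsNondeg (midForm m (fun r => A (r, y)) (fun r => B (r, y)) s t))
    (x : ℝ × (ℝ × E)) (hx : x.2.2 ∈ U) :
    ContDiffAt ℝ ∞ (cutVec c χ m (fun t y => A (t, y)) (fun t y => B (t, y))) x := by
  obtain ⟨s, t, y⟩ := x
  by_cases hs : |s| ≤ 3 ∧ |t| ≤ δ
  · have ht : t ∈ Ioo (-ε) ε := by rw [mem_Ioo, ← abs_lt]; linarith [hs.2]
    exact ((hc.contDiffAt.comp (s, (t, y)) contDiffAt_fst).mul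
      (hχ.contDiffAt.comp (s, (t, y)) contDiffAt_snd.fst)).smul
      (h.contDiffAt_moserVec hU ht hx (hnd s hs.1 t hs.2 y hx))
  · have h0 : cutVec c χ m (fun t y => A (t, y)) (fun t y => B (t, y)) =ᶠ[𝓝 (s, (t, y))]
        fun _ => 0 := by
      rw [not_and_or, not_le, not_le] at hs
      rcases hs with hs | hs
      · have : ∀ᶠ x : ℝ × (ℝ × E) in 𝓝 (s, (t, y)), 3 < |x.1| :=
          (continuous_fst.abs.continuousAt (x := (s, (t, y)))).eventually (lt_mem_nhds hs)
        filter_upwards [this] with x hx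
        simp [cutVec, hc0 _ hx]
      · have : ∀ᶠ x : ℝ × (ℝ × E) in 𝓝 (s, (t, y)), δ < |x.2.1| :=
          (continuous_snd.fst.abs.continuousAt (x := (s, (t, y)))).eventually (lt_mem_nhds hs)
        filter_upwards [this] with x hx
        simp [cutVec, hχ0 _ hx]
    exact contDiffAt_const.congr_of_eventuallyEq h0

end Cutoff

section Family

variable {E : Type u} [NormedAddCommGroup E] [NormedSpace ℝ E] [FiniteDimensional ℝ E]
  {H : Type*} [TopologicalSpace H] (I : ModelWithCorners ℝ E H) [I.Boundaryless]
  {Z : Type*} [TopologicalSpace Z] [ChartedSpace H Z] [IsManifold I ∞ Z]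

/-- The one-forms in the chart around `z₀`. -/
def chartA (a : ℝ → Z → E →L[ℝ] ℝ) (z₀ : Z) (p : ℝ × E) : E →L[ℝ] ℝ :=
  (a p.1 (chartParam I z₀ p.2)).comp (chartDeriv I z₀ p.2)

/-- The two-forms in the chart around `z₀`. -/
def chartB (b : ℝ → Z → E →L[ℝ] E →L[ℝ] ℝ) (z₀ : Z) (p : ℝ × E) : E →L[ℝ] E →L[ℝ] ℝ :=
  (b p.1 (chartParam I z₀ p.2)).bilinearComp (chartDeriv I z₀ p.2) (chartDeriv I z₀ p.2)

/-- Families of one-forms `a t` and of two-forms `b t` on `Z`, for `|t| < ε`, that are the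
coefficients of a symplectic `bᵐ`-form `t⁻ᵐ dt ∧ a + b`. -/
structure IsSymplecticFamily (m : ℕ) (ε : ℝ) (a : ℝ → Z → E →L[ℝ] ℝ)
    (b : ℝ → Z → E →L[ℝ] E →L[ℝ] ℝ) : Prop where
  closed : ∀ z₀, IsClosedPair m ε (chartParam I z₀).source (chartA I a z₀) (chartB I b z₀)
  skew : ∀ t ∈ Ioo (-ε) ε, ∀ z v w, b t z v w = -b t z w v
  nondeg : ∀ z, IsNondeg (frameForm (a 0 z) (b 0 z))

namespace IsSymplecticFamily

variable {I} {m : ℕ} {ε δ : ℝ} {a : ℝ → Z → E →L[ℝ] ℝ} {b : ℝ → Z → E →L[ℝ] E →L[ℝ] ℝ}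
  (h : IsSymplecticFamily I m ε a b)

include h

lemma contDiffOn_apply (z : Z) : ContDiffOn ℝ ∞ (fun t => a t z) (Ioo (-ε) ε) := by
  obtain ⟨e, he⟩ := exists_inverse_chartDeriv (mem_chartParam_source (I := I) z)
  have h1 : ContDiffOn ℝ ∞ (fun t => chartA I a z (t, extChartAt I z z)) (Ioo (-ε) ε) :=
    (h.closed z).smooth_A.comp (contDiffOn_id.prodMk contDiffOn_const) fun t ht =>
      ⟨ht, mem_chartParam_source z⟩
  refine (h1.clm_comp (contDiffOn_const (c := (e.symm : E →L[ℝ] E)))).congr fun t _ => ?_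
  ext v
  simp only [chartA, chartParam_self, ContinuousLinearMap.comp_apply, ← he]
  simp

lemma isNondeg_chart_iff {z₀ : Z} {y : E} (hy : y ∈ (chartParam I z₀).source) {s t : ℝ}
    (ht : t ∈ Ioo (-ε) ε) :
    IsNondeg (midForm m (fun r => chartA I a z₀ (r, y)) (fun r => chartB I b z₀ (r, y)) s t)
      ↔ IsNondeg (midForm m (fun r => a r (chartParam I z₀ y)) (fun r => b r (chartParam I z₀ y))
        s t) :=
  isNondeg_midForm_comp (a := fun r => a r (chartParam I z₀ y))
    (b := fun r => b r (chartParam I z₀ y)) (L := chartDeriv I z₀ y) m (h.contDiffOn_apply _)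
    (fun _ _ => rfl) (fun _ _ => rfl) ht (bijective_chartDeriv hy)

lemma moserVec_chart {z₀ : Z} {y : E} (hy : y ∈ (chartParam I z₀).source) {s t : ℝ}
    (ht : t ∈ Ioo (-ε) ε)
    (hnd : IsNondeg (midForm m (fun r => a r (chartParam I z₀ y))
      (fun r => b r (chartParam I z₀ y)) s t)) :
    moserVec m (fun r => a r (chartParam I z₀ y)) (fun r => b r (chartParam I z₀ y)) s t
      = ((moserVec m (fun r => chartA I a z₀ (r, y)) (fun r => chartB I b z₀ (r, y)) s t).1,
        chartDeriv I z₀ y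
          (moserVec m (fun r => chartA I a z₀ (r, y)) (fun r => chartB I b z₀ (r, y)) s t).2) :=
  moserVec_comp (a := fun r => a r (chartParam I z₀ y))
    (b := fun r => b r (chartParam I z₀ y)) (L := chartDeriv I z₀ y) m (h.contDiffOn_apply _)
    (fun _ _ => rfl) (fun _ _ => rfl) ht
    (bijective_chartDeriv hy).2 hnd ((h.isNondeg_chart_iff hy ht).2 hnd)

lemma exists_isNondeg [CompactSpace Z] (hm : m ≠ 0) (hε : 0 < ε) :
    ∃ δ > 0, δ < ε ∧ ∀ s, |s| ≤ 3 → ∀ t, |t| ≤ δ → ∀ z,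
      IsNondeg (midForm m (fun r => a r z) (fun r => b r z) s t) := by
  have hK : IsCompact (Icc (-3 : ℝ) 3 ×ˢ (univ : Set Z)) := isCompact_Icc.prod isCompact_univ
  have h0 : (0 : ℝ) ∈ Ioo (-ε) ε := ⟨by linarith, hε⟩
  have key : ∀ᶠ t in 𝓝 (0 : ℝ), ∀ q ∈ Icc (-3 : ℝ) 3 ×ˢ (univ : Set Z),
      IsNondeg (midForm m (fun r => a r q.2) (fun r => b r q.2) q.1 t) := by
    refine hK.eventually_forall_of_forall_eventually fun q _ => ?_
    obtain ⟨s, z₀⟩ := q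
    have hy₀ := mem_chartParam_source (I := I) z₀
    have hnd : IsNondeg (midForm m (fun r => chartA I a z₀ (r, extChartAt I z₀ z₀))
        (fun r => chartB I b z₀ (r, extChartAt I z₀ z₀)) s 0) := by
      rw [h.isNondeg_chart_iff hy₀ h0, midForm_zero hm, chartParam_self]
      exact h.nondeg z₀
    have h1 := ((h.closed z₀).contDiffAt_midForm (chartParam I z₀).open_source (s := s) h0
      hy₀).continuousAt.eventually hnd.eventually
    have h2 : ContinuousAt (fun p : ℝ × (ℝ × Z) => (p.2.1, (p.1, extChartAt I z₀ p.2.2)))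
        ((0 : ℝ), (s, z₀)) := by
      have : ContinuousAt (fun p : ℝ × (ℝ × Z) => extChartAt I z₀ p.2.2) ((0 : ℝ), (s, z₀)) :=
        (continuousAt_extChartAt (I := I) z₀).comp (f := fun p : ℝ × (ℝ × Z) => p.2.2)
          continuous_snd.snd.continuousAt
      exact continuous_snd.fst.continuousAt.prodMk (continuousAt_fst.prodMk this)
    have h3 : ∀ᶠ p : ℝ × (ℝ × Z) in 𝓝 ((0 : ℝ), (s, z₀)), p.1 ∈ Ioo (-ε) ε :=
      continuousAt_fst.eventually (Ioo_mem_nhds h0.1 h0.2)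
    have h4 : ∀ᶠ p : ℝ × (ℝ × Z) in 𝓝 ((0 : ℝ), (s, z₀)), p.2.2 ∈ (extChartAt I z₀).source :=
      continuous_snd.snd.continuousAt.eventually (extChartAt_source_mem_nhds z₀)
    filter_upwards [h2.eventually h1, h3, h4] with p hp1 hp2 hp3
    have hy : extChartAt I z₀ p.2.2 ∈ (chartParam I z₀).source :=
      (extChartAt I z₀).map_source hp3
    have hk : chartParam I z₀ (extChartAt I z₀ p.2.2) = p.2.2 := (extChartAt I z₀).left_inv hp3
    have := (h.isNondeg_chart_iff hy hp2).1 hp1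
    rwa [hk] at this
  obtain ⟨δ, hδ, hball⟩ := Metric.eventually_nhds_iff.1 key
  refine ⟨min (δ / 2) (ε / 2), by positivity, (min_le_right _ _).trans_lt (by linarith),
    fun s hs t ht z => ?_⟩
  refine hball (y := t) ?_ (s, z) ⟨abs_le.1 hs, mem_univ _⟩
  rw [Real.dist_eq, sub_zero]
  exact ht.trans_lt ((min_le_left _ _).trans_lt (by linarith))

variable {c χ κ : ℝ → ℝ} (hc : ContDiff ℝ ∞ c) (hχ : ContDiff ℝ ∞ χ) (hδ : δ < ε)
    (hc0 : ∀ s, 3 < |s| → c s = 0) (hχ0 : ∀ t, δ < |t| → χ t = 0)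
    (hnd : ∀ s, |s| ≤ 3 → ∀ t, |t| ≤ δ → ∀ z,
      IsNondeg (midForm m (fun r => a r z) (fun r => b r z) s t))

include hδ hc0 hχ0 hnd

lemma cutVec_chart {z₀ : Z} {x : ℝ × (ℝ × E)} (hx : x.2.2 ∈ (chartParam I z₀).source) :
    cutVec c χ m a b (x.1, (x.2.1, chartParam I z₀ x.2.2))
      = ((cutVec c χ m (fun t y => chartA I a z₀ (t, y)) (fun t y => chartB I b z₀ (t, y)) x).1,
        chartDeriv I z₀ x.2.2
          (cutVec c χ m (fun t y => chartA I a z₀ (t, y)) (fun t y => chartB I b z₀ (t, y)) x).2) := by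
  obtain ⟨s, t, y⟩ := x
  simp only [cutVec]
  by_cases hs : |s| ≤ 3 ∧ |t| ≤ δ
  · have ht : t ∈ Ioo (-ε) ε := by rw [mem_Ioo, ← abs_lt]; linarith [hs.2]
    rw [h.moserVec_chart hx ht (hnd s hs.1 t hs.2 _)]
    simp
  · have h0 : c s * χ t = 0 := by
      rw [not_and_or, not_le, not_le] at hs
      rcases hs with hs | hs
      · rw [hc0 _ hs, zero_mul]
      · rw [hχ0 _ hs, mul_zero]
    rw [h0, zero_smul, zero_smul]
    exact Prod.ext rfl (map_zero _).symm

include hc hχ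

lemma contDiffAt_cutVec_chart {z₀ : Z} {x : ℝ × (ℝ × E)} (hx : x.2.2 ∈ (chartParam I z₀).source) :
    ContDiffAt ℝ ∞ (cutVec c χ m (fun t y => chartA I a z₀ (t, y))
      (fun t y => chartB I b z₀ (t, y))) x := by
  refine (h.closed z₀).contDiffAt_cutVec (chartParam I z₀).open_source hc hχ hδ hc0 hχ0
    (fun s hs t ht y hy => ?_) x hx
  exact (h.isNondeg_chart_iff hy (by rw [mem_Ioo, ← abs_lt]; linarith)).2 (hnd s hs t ht _)

/-- The time component of Moser's vector field is smooth. -/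
lemma contMDiff_cutVec_fst : ContMDiff (𝓘(ℝ, ℝ).prod (𝓘(ℝ, ℝ).prod I)) 𝓘(ℝ, ℝ) ∞
    (fun x : ℝ × (ℝ × Z) => (cutVec c χ m a b x).1) := by
  intro x₀
  refine contMDiffAt_of_chartParam x₀ ?_
  have hmem := mem_chartParam_source (I := 𝓘(ℝ, ℝ).prod (𝓘(ℝ, ℝ).prod I)) x₀
  have hmem' := hmem
  rw [chartParam_prod_source, chartParam_prod_source] at hmem'
  refine (contDiffAt_fst.comp _ (h.contDiffAt_cutVec_chart hc hχ hδ hc0 hχ0 hnd (z₀ := x₀.2.2)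
    hmem'.2.2)).congr_of_eventuallyEq ?_
  filter_upwards [(chartParam (𝓘(ℝ, ℝ).prod (𝓘(ℝ, ℝ).prod I)) x₀).open_source.mem_nhds hmem]
    with x hx
  rw [chartParam_prod_source, chartParam_prod_source] at hx
  rw [chartParam_prod_apply, chartParam_prod_apply,
    h.cutVec_chart hδ hc0 hχ0 hnd (x := x) hx.2.2]
  rfl

omit hc hχ in
lemma moserField_chart {x₀ : ℝ × (ℝ × Z)} {x : ℝ × (ℝ × E)}
    (hx : x.2.2 ∈ (chartParam I x₀.2.2).source) :
    moserField c χ κ m a b (chartParam (𝓘(ℝ, ℝ).prod (𝓘(ℝ, ℝ).prod I)) x₀ x)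
      = chartDeriv (𝓘(ℝ, ℝ).prod (𝓘(ℝ, ℝ).prod I)) x₀ x
        (moserField c χ κ m (fun t y => chartA I a x₀.2.2 (t, y))
          (fun t y => chartB I b x₀.2.2 (t, y)) x) := by
  have hx' : x.2 ∈ (chartParam (𝓘(ℝ, ℝ).prod I) x₀.2).source := by
    rw [chartParam_prod_source]; exact ⟨mem_univ _, hx⟩
  rw [chartDeriv_prod hx', chartDeriv_prod hx, chartParam_prod_apply, chartParam_prod_apply]
  simp only [moserField]
  rw [h.cutVec_chart hδ hc0 hχ0 hnd hx]
  simp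

lemma contMDiff_moserField (hκ : ContDiff ℝ ∞ κ) : ContMDiff (𝓘(ℝ, ℝ).prod (𝓘(ℝ, ℝ).prod I))
    (𝓘(ℝ, ℝ).prod (𝓘(ℝ, ℝ).prod I)).tangent ∞
    (fun x : ℝ × (ℝ × Z) => (⟨x, moserField c χ κ m a b x⟩ :
      TangentBundle (𝓘(ℝ, ℝ).prod (𝓘(ℝ, ℝ).prod I)) (ℝ × (ℝ × Z)))) := by
  have := FiniteDimensional.complete ℝ E
  intro x₀
  have hmem := mem_chartParam_source (I := 𝓘(ℝ, ℝ).prod (𝓘(ℝ, ℝ).prod I)) x₀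
  have hmem' := hmem
  rw [chartParam_prod_source, chartParam_prod_source] at hmem'
  have hcut := h.contDiffAt_cutVec_chart hc hχ hδ hc0 hχ0 hnd (z₀ := x₀.2.2) hmem'.2.2
  have hsm : ContDiffAt ℝ ∞ (moserField c χ κ m (fun t y => chartA I a x₀.2.2 (t, y))
      (fun t y => chartB I b x₀.2.2 (t, y)))
      (extChartAt (𝓘(ℝ, ℝ).prod (𝓘(ℝ, ℝ).prod I)) x₀ x₀) :=
    ((hc.contDiffAt.comp _ contDiffAt_fst).mul (hκ.contDiffAt.comp _ contDiffAt_snd.fst)).prodMk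
      (((contDiffAt_snd.fst.pow (m + 1)).mul hcut.fst).prodMk (contDiffAt_snd.fst.smul hcut.snd))
  have := contMDiffAt_vectorField_of_param
    (X := fun x : ℝ × (ℝ × Z) => (moserField c χ κ m a b x :
      TangentSpace (𝓘(ℝ, ℝ).prod (𝓘(ℝ, ℝ).prod I)) x)) (chartParam _ x₀) hmem hsm ?_
  · rwa [chartParam_self] at this
  filter_upwards [(chartParam (𝓘(ℝ, ℝ).prod (𝓘(ℝ, ℝ).prod I)) x₀).open_source.mem_nhds hmem]
    with x hx
  rw [chartParam_prod_source, chartParam_prod_source] at hx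
  exact h.moserField_chart hδ hc0 hχ0 hnd hx.2.2

end IsSymplecticFamily

end Family

/-! ### The flow of Moser's vector field -/

section PlainDeriv

variable {E : Type*} [NormedAddCommGroup E] [NormedSpace ℝ E]
  {H : Type*} [TopologicalSpace H] (I : ModelWithCorners ℝ E H)
  {P : Type*} [TopologicalSpace P] [ChartedSpace H P]
  {E' : Type*} [NormedAddCommGroup E'] [NormedSpace ℝ E']
  {H' : Type*} [TopologicalSpace H'] (I' : ModelWithCorners ℝ E' H')
  {P' : Type*} [TopologicalSpace P'] [ChartedSpace H' P']

/-- The derivative of a map between manifolds, as a map between the model spaces. -/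
def modelDeriv (f : P → P') (p : P) : E →L[ℝ] E' := mfderiv I I' f p

end PlainDeriv

section IntegralCurve

variable {E : Type*} [NormedAddCommGroup E] [NormedSpace ℝ E]
  {H : Type*} [TopologicalSpace H] {I : ModelWithCorners ℝ E H}
  {P : Type*} [TopologicalSpace P] [ChartedSpace H P]

lemma hasMFDerivAt_prod_curve {u : ℝ → ℝ} {γ : ℝ → P} {s u' : ℝ} {v : TangentSpace I (γ s)}
    (hu : HasDerivAt u u' s)
    (hγ : HasMFDerivAt 𝓘(ℝ, ℝ) I γ s ((1 : ℝ →L[ℝ] ℝ).smulRight v)) :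
    HasMFDerivAt 𝓘(ℝ, ℝ) (𝓘(ℝ, ℝ).prod I) (fun s => (u s, γ s)) s
      ((1 : ℝ →L[ℝ] ℝ).smulRight ((u', v) : ℝ × E)) := by
  have h1 : HasMFDerivAt 𝓘(ℝ, ℝ) 𝓘(ℝ, ℝ) u s ((1 : ℝ →L[ℝ] ℝ).smulRight u') :=
    hasMFDerivAt_iff_hasFDerivAt.2 hu.hasFDerivAt
  exact h1.prodMk hγ

lemma hasDerivAt_fst_of_curve {γ : ℝ → ℝ × P} {s : ℝ} {v : ℝ × E}
    (hγ : HasMFDerivAt 𝓘(ℝ, ℝ) (𝓘(ℝ, ℝ).prod I) γ s ((1 : ℝ →L[ℝ] ℝ).smulRight v)) :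
    HasDerivAt (fun s => (γ s).1) v.1 s := by
  have h1 := (hasMFDerivAt_fst (I := 𝓘(ℝ, ℝ)) (I' := I) (γ s)).comp s hγ
  have h2 : HasFDerivAt (fun s => (γ s).1) ((1 : ℝ →L[ℝ] ℝ).smulRight v.1) s :=
    hasMFDerivAt_iff_hasFDerivAt.1 h1
  exact h2.hasDerivAt.congr_deriv (by simp)

lemma hasMFDerivAt_snd_of_curve {γ : ℝ → ℝ × P} {s : ℝ} {v : ℝ × E}
    (hγ : HasMFDerivAt 𝓘(ℝ, ℝ) (𝓘(ℝ, ℝ).prod I) γ s ((1 : ℝ →L[ℝ] ℝ).smulRight v)) :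
    HasMFDerivAt 𝓘(ℝ, ℝ) I (fun s => (γ s).2) s ((1 : ℝ →L[ℝ] ℝ).smulRight v.2) :=
  (hasMFDerivAt_snd (I := 𝓘(ℝ, ℝ)) (I' := I) (γ s)).comp s hγ

end IntegralCurve

section MoserFlow

variable {E : Type u} [NormedAddCommGroup E] [NormedSpace ℝ E] [FiniteDimensional ℝ E]
  {H : Type*} [TopologicalSpace H] (I : ModelWithCorners ℝ E H) [I.Boundaryless]
  {Z : Type*} [TopologicalSpace Z] [ChartedSpace H Z] [IsManifold I ∞ Z]

/-- The data of Moser's method: cutoff functions, and the flow of the cut off vector field. -/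
structure IsMoserFlow (m : ℕ) (ε δ δ₁ : ℝ) (a : ℝ → Z → E →L[ℝ] ℝ)
    (b : ℝ → Z → E →L[ℝ] E →L[ℝ] ℝ) (c χ κ : ℝ → ℝ)
    (φ : ℝ → ℝ × (ℝ × Z) → ℝ × (ℝ × Z)) : Prop where
  family : IsSymplecticFamily I m ε a b
  smooth_c : ContDiff ℝ ∞ c
  compact_c : HasCompactSupport c
  smooth_χ : ContDiff ℝ ∞ χ
  smooth_κ : ContDiff ℝ ∞ κ
  δ_lt : δ < ε
  δ₁_pos : 0 < δ₁
  δ₁_lt : δ₁ < δ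
  c_zero : ∀ s, 3 < |s| → c s = 0
  χ_zero : ∀ t, δ < |t| → χ t = 0
  c_one : ∀ s, |s| ≤ 2 → c s = 1
  χ_one : ∀ t, |t| ≤ δ₁ → χ t = 1
  κ_one : ∀ t, |t| < ε → κ t = 1
  nondeg : ∀ s, |s| ≤ 3 → ∀ t, |t| ≤ δ → ∀ z,
      IsNondeg (midForm m (fun r => a r z) (fun r => b r z) s t)
  flow_zero : ∀ p, φ 0 p = p
  flow_curve : ∀ p, IsMIntegralCurve (I := 𝓘(ℝ, ℝ).prod (𝓘(ℝ, ℝ).prod I))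
    (fun s => φ s p) (fun x => (moserField c χ κ m a b x : ℝ × (ℝ × E)))
  flow_add : ∀ s t p, φ (s + t) p = φ s (φ t p)
  flow_smooth : ContMDiff (𝓘(ℝ, ℝ).prod (𝓘(ℝ, ℝ).prod (𝓘(ℝ, ℝ).prod I)))
    (𝓘(ℝ, ℝ).prod (𝓘(ℝ, ℝ).prod I)) ∞ (fun x : ℝ × (ℝ × (ℝ × Z)) => φ x.1 x.2)

variable {I} {m : ℕ} {ε δ δ₁ : ℝ} {a : ℝ → Z → E →L[ℝ] ℝ} {b : ℝ → Z → E →L[ℝ] E →L[ℝ] ℝ}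
  {c χ κ : ℝ → ℝ} {φ : ℝ → ℝ × (ℝ × Z) → ℝ × (ℝ × Z)}

lemma IsSymplecticFamily.exists_flow [T2Space Z] [CompactSpace Z] (h : IsSymplecticFamily I m ε a b)
    (hm : m ≠ 0) (hε : 0 < ε) : ∃ δ δ₁ c χ κ φ, IsMoserFlow I m ε δ δ₁ a b c χ κ φ := by
  obtain ⟨δ, hδ, hδε, hnd⟩ := h.exists_isNondeg hm hε
  let c : ContDiffBump (0 : ℝ) := ⟨2, 3, by norm_num, by norm_num⟩
  let χ : ContDiffBump (0 : ℝ) := ⟨δ / 2, δ, by linarith, by linarith⟩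
  let κ : ContDiffBump (0 : ℝ) := ⟨ε, 2 * ε, hε, by linarith⟩
  have hc0 : ∀ s, 3 < |s| → c s = 0 := fun s hs => c.zero_of_le_dist (by
    rw [Real.dist_eq, sub_zero]; exact hs.le)
  have hχ0 : ∀ t, δ < |t| → χ t = 0 := fun s hs => χ.zero_of_le_dist (by
    rw [Real.dist_eq, sub_zero]; exact hs.le)
  have hκ0 : ∀ t, 2 * ε < |t| → κ t = 0 := fun s hs => κ.zero_of_le_dist (by
    rw [Real.dist_eq, sub_zero]; exact hs.le)
  have hX := h.contMDiff_moserField (κ := κ) c.contDiff χ.contDiff hδε hc0 hχ0 hnd κ.contDiff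
  have hK : IsCompact (Icc (-3 : ℝ) 3 ×ˢ (Icc (-(2 * ε)) (2 * ε) ×ˢ (univ : Set Z))) :=
    isCompact_Icc.prod (isCompact_Icc.prod isCompact_univ)
  obtain ⟨φ, h1, h2, h3, h4⟩ := exists_smooth_flow hX hK (fun p hp => by
    change moserField _ _ _ _ _ _ _ = 0
    have : 3 < |p.1| ∨ 2 * ε < |p.2.1| := by
      by_contra hcon
      rw [not_or, not_lt, not_lt] at hcon
      exact hp ⟨abs_le.1 hcon.1, abs_le.1 hcon.2, mem_univ _⟩
    rcases this with h | h
    · simp [moserField, cutVec, hc0 _ h]; rfl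
    · simp [moserField, cutVec, hκ0 _ h, hχ0 _ (show δ < |p.2.1| by linarith)]; rfl)
  refine ⟨δ, δ / 2, c, χ, κ, φ, h, c.contDiff, c.hasCompactSupport, χ.contDiff, κ.contDiff, hδε,
    by linarith, by linarith, hc0, hχ0, fun s hs => c.one_of_mem_closedBall ?_,
    fun s hs => χ.one_of_mem_closedBall ?_, fun s hs => κ.one_of_mem_closedBall ?_, hnd, h1, h2, h3,
    h4⟩
  · rwa [mem_closedBall_zero_iff]
  · rwa [mem_closedBall_zero_iff]
  · rw [mem_closedBall_zero_iff]; exact hs.le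

namespace IsMoserFlow

variable (h : IsMoserFlow I m ε δ δ₁ a b c χ κ φ)

include h

lemma eps_pos : 0 < ε := by linarith [h.δ_lt, h.δ₁_lt, h.δ₁_pos]

lemma flow_unique [T2Space Z] {γ : ℝ → ℝ × (ℝ × Z)}
    (hγ : IsMIntegralCurve (I := 𝓘(ℝ, ℝ).prod (𝓘(ℝ, ℝ).prod I)) γ
      (fun x => (moserField c χ κ m a b x : ℝ × (ℝ × E)))) (s : ℝ) : γ s = φ s (γ 0) := by
  have := FiniteDimensional.complete ℝ E
  have hX := h.family.contMDiff_moserField (κ := κ) h.smooth_c h.smooth_χ h.δ_lt h.c_zero h.χ_zero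
    h.nondeg h.smooth_κ
  exact congrFun (isMIntegralCurve_Ioo_eq_of_contMDiff_boundaryless (t₀ := 0)
    (hX.of_le (by exact_mod_cast le_top)) hγ (h.flow_curve (γ 0)) (h.flow_zero _).symm) s

lemma flow_neg (s : ℝ) (p : ℝ × (ℝ × Z)) : φ (-s) (φ s p) = p := by
  rw [← h.flow_add, neg_add_cancel, h.flow_zero]

omit h in
/-- The flow of a compactly supported field on the line. -/
lemma exists_line_flow (k : ℝ) (hc : ContDiff ℝ ∞ c) (hc0 : ∀ s, 3 < |s| → c s = 0) (σ₀ : ℝ) :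
    ∃ σ : ℝ → ℝ, σ 0 = σ₀ ∧ ∀ s, HasDerivAt σ (c (σ s) * k) s := by
  have hX : ContMDiff 𝓘(ℝ, ℝ) 𝓘(ℝ, ℝ).tangent ∞
      (fun p => (⟨p, c p * k⟩ : TangentBundle 𝓘(ℝ, ℝ) ℝ)) :=
    contMDiff_vectorSpace_iff_contDiff.2 (hc.mul contDiff_const)
  obtain ⟨ψ, h1, h2, -, -⟩ := exists_smooth_flow hX (K := Icc (-3) 3) isCompact_Icc (fun p hp => by
    change c p * k = 0
    rw [hc0 p, zero_mul]
    by_contra hcon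
    exact hp (abs_le.1 (not_lt.1 hcon)))
  refine ⟨fun s => ψ s σ₀, h1 σ₀, fun s => ?_⟩
  have h3 : HasFDerivAt (fun s => ψ s σ₀) ((1 : ℝ →L[ℝ] ℝ).smulRight (c (ψ s σ₀) * k)) s :=
    hasMFDerivAt_iff_hasFDerivAt.1 (h2 σ₀ s)
  exact h3.hasDerivAt.congr_deriv (by simp)

/-- The flow is stationary in space where the field vanishes. -/
lemma flow_fixed [T2Space Z] {t : ℝ} (ht : t = 0 ∨ χ t = 0) (s σ : ℝ) (z : Z) :
    (φ s (σ, (t, z))).2 = (t, z) := by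
  obtain ⟨u, hu0, hu⟩ := exists_line_flow (κ t) h.smooth_c h.c_zero σ
  have hγ : IsMIntegralCurve (I := 𝓘(ℝ, ℝ).prod (𝓘(ℝ, ℝ).prod I)) (fun s => (u s, (t, z)))
      (fun x => (moserField c χ κ m a b x : ℝ × (ℝ × E))) := by
    intro s
    have hconst : HasMFDerivAt 𝓘(ℝ, ℝ) (𝓘(ℝ, ℝ).prod I) (fun _ : ℝ => (t, z)) s
        ((1 : ℝ →L[ℝ] ℝ).smulRight (0 : ℝ × E)) := by
      have h0 : ((1 : ℝ →L[ℝ] ℝ).smulRight (0 : ℝ × E)) = 0 := by ext <;> simp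
      exact (congrArg (HasMFDerivAt 𝓘(ℝ, ℝ) (𝓘(ℝ, ℝ).prod I) (fun _ : ℝ => (t, z)) s) h0).mpr
        (hasMFDerivAt_const (I := 𝓘(ℝ, ℝ)) (I' := 𝓘(ℝ, ℝ).prod I) (t, z) s)
    have h1 := hasMFDerivAt_prod_curve (hu s) hconst
    have h2 : moserField c χ κ m a b (u s, (t, z)) = (c (u s) * κ t, (0 : ℝ × E)) := by
      rcases ht with ht | ht
      · simp [moserField, ht]
      · simp [moserField, cutVec, ht]
    rw [← h2] at h1
    exact h1
  have := h.flow_unique hγ s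
  simp only [hu0] at this
  rw [← this]

lemma eq_of_flow_fixed [T2Space Z] {s : ℝ} {p : ℝ × (ℝ × Z)}
    (hp : (φ s p).2.1 = 0 ∨ χ (φ s p).2.1 = 0) : (φ s p).2 = p.2 := by
  have h1 := h.flow_fixed hp (-s) (φ s p).1 (φ s p).2.2
  have h2 : φ (-s) ((φ s p).1, ((φ s p).2.1, (φ s p).2.2)) = p := h.flow_neg s p
  rw [h2] at h1
  exact h1.symm

lemma flow_mem [T2Space Z] (s : ℝ) {p : ℝ × (ℝ × Z)} (hp : |p.2.1| < ε) : |(φ s p).2.1| < ε := by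
  by_contra hcon
  rw [not_lt] at hcon
  have := h.eq_of_flow_fixed (s := s) (p := p) (.inr (h.χ_zero _ (h.δ_lt.trans_le hcon)))
  rw [this] at hcon
  linarith

lemma flow_ne_zero [T2Space Z] (s : ℝ) {p : ℝ × (ℝ × Z)} (hp : p.2.1 ≠ 0) : (φ s p).2.1 ≠ 0 := by
  intro hcon
  have := h.eq_of_flow_fixed (s := s) (p := p) (.inl hcon)
  rw [this] at hcon
  exact hp hcon

/-- The flow moves with unit speed in time. -/
lemma flow_fst [T2Space Z] {s σ : ℝ} {q : ℝ × Z} (hq : |q.1| < ε) (hσ : |σ| < 2) (hs : |σ + s| < 2) :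
    (φ s (σ, q)).1 = σ + s := by
  have hd : ∀ s, HasDerivAt (fun s => (φ s (σ, q)).1) (c (φ s (σ, q)).1) s := by
    intro s
    refine (hasDerivAt_fst_of_curve (h.flow_curve (σ, q) s)).congr_deriv ?_
    change c _ * κ _ = _
    rw [h.κ_one _ (h.flow_mem s hq), mul_one]
  obtain ⟨K, hK⟩ := h.smooth_c.lipschitzWith_of_hasCompactSupport h.compact_c (by simp)
  rw [abs_lt] at hσ hs
  have := ODE_solution_unique_of_mem_Ioo (v := fun _ => c) (s := fun _ => univ) (K := K)
    (a := -2 - σ) (b := 2 - σ) (t₀ := 0) (f := fun s => (φ s (σ, q)).1) (g := fun s => σ + s)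
    (fun t _ => hK.lipschitzOnWith) ⟨by linarith, by linarith⟩
    (fun t _ => ⟨hd t, mem_univ _⟩) (fun t ht => ⟨?_, mem_univ _⟩) (by simp [h.flow_zero])
  · exact this ⟨by linarith, by linarith⟩
  · rw [h.c_one _ (abs_le.2 ⟨by linarith [ht.1], by linarith [ht.2]⟩)]
    exact (hasDerivAt_id t).const_add σ

/-- The flow commutes with the symmetries of the forms. -/
lemma flow_equivariant [T2Space Z] {f : Z → Z} (hf : MDifferentiable I I f)
    (hsurj : ∀ z, Function.Surjective (modelDeriv I I f z))
    (ha : ∀ t ∈ Ioo (-ε) ε, ∀ z, a t z = (a t (f z)).comp (modelDeriv I I f z))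
    (hb : ∀ t ∈ Ioo (-ε) ε, ∀ z, b t z = (b t (f z)).bilinearComp (modelDeriv I I f z)
      (modelDeriv I I f z))
    (s σ : ℝ) {q : ℝ × Z} (hq : |q.1| < ε) :
    φ s (σ, (q.1, f q.2))
      = ((φ s (σ, q)).1, ((φ s (σ, q)).2.1, f (φ s (σ, q)).2.2)) := by
  have hcut : ∀ x : ℝ × (ℝ × Z), |x.2.1| < ε → cutVec c χ m a b (x.1, (x.2.1, f x.2.2))
      = ((cutVec c χ m a b x).1, (modelDeriv I I f x.2.2) (cutVec c χ m a b x).2) := by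
    rintro ⟨r, t, z⟩ ht
    simp only [cutVec]
    by_cases hs : |r| ≤ 3 ∧ |t| ≤ δ
    · have := moserVec_comp (a := fun t => a t (f z)) (a' := fun t => a t z)
        (b := fun t => b t (f z)) (b' := fun t => b t z) (L := (modelDeriv I I f z)) m
        (h.family.contDiffOn_apply (f z)) (fun t ht => ha t ht z) (fun t ht => hb t ht z)
        (abs_lt.1 ht) (hsurj z) (h.nondeg r hs.1 t hs.2 (f z)) (h.nondeg r hs.1 t hs.2 z)
      rw [this]
      exact Prod.ext rfl ((modelDeriv I I f z).map_smul _ _).symm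
    · have h0 : c r * χ t = 0 := by
        rw [not_and_or, not_le, not_le] at hs
        rcases hs with hs | hs
        · rw [h.c_zero _ hs, zero_mul]
        · rw [h.χ_zero _ hs, mul_zero]
      rw [h0, zero_smul, zero_smul]
      exact Prod.ext rfl (modelDeriv I I f z).map_zero.symm
  have hγ : IsMIntegralCurve (I := 𝓘(ℝ, ℝ).prod (𝓘(ℝ, ℝ).prod I))
      (fun s => ((φ s (σ, q)).1, ((φ s (σ, q)).2.1, f (φ s (σ, q)).2.2)))
      (fun x => (moserField c χ κ m a b x : ℝ × (ℝ × E))) := by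
    intro s
    have h0 := h.flow_curve (σ, q) s
    have h1 := hasMFDerivAt_snd_of_curve h0
    have h2 := hasMFDerivAt_snd_of_curve h1
    have h3 := (hf (φ s (σ, q)).2.2).hasMFDerivAt.comp s h2
    have h4 : (modelDeriv I I f (φ s (σ, q)).2.2).comp
        ((1 : ℝ →L[ℝ] ℝ).smulRight (moserField c χ κ m a b (φ s (σ, q))).2.2)
        = (1 : ℝ →L[ℝ] ℝ).smulRight ((modelDeriv I I f (φ s (σ, q)).2.2)
          (moserField c χ κ m a b (φ s (σ, q))).2.2) := by
      refine ContinuousLinearMap.ext_ring ?_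
      simp
    have h5 : HasMFDerivAt 𝓘(ℝ, ℝ) I (fun s => f (φ s (σ, q)).2.2) s
        ((1 : ℝ →L[ℝ] ℝ).smulRight ((modelDeriv I I f (φ s (σ, q)).2.2)
          (moserField c χ κ m a b (φ s (σ, q))).2.2)) :=
      (congrArg (HasMFDerivAt 𝓘(ℝ, ℝ) I (fun s => f (φ s (σ, q)).2.2) s) h4).mp h3
    have h6 : HasMFDerivAt 𝓘(ℝ, ℝ) (𝓘(ℝ, ℝ).prod (𝓘(ℝ, ℝ).prod I))
        (fun s => ((φ s (σ, q)).1, ((φ s (σ, q)).2.1, f (φ s (σ, q)).2.2))) s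
        ((1 : ℝ →L[ℝ] ℝ).smulRight ((moserField c χ κ m a b (φ s (σ, q))).1,
          ((moserField c χ κ m a b (φ s (σ, q))).2.1, modelDeriv I I f (φ s (σ, q)).2.2
            (moserField c χ κ m a b (φ s (σ, q))).2.2))) :=
      hasMFDerivAt_prod_curve (hasDerivAt_fst_of_curve h0)
        (hasMFDerivAt_prod_curve (hasDerivAt_fst_of_curve h1) h5)
    have h7 : moserField c χ κ m a b ((φ s (σ, q)).1, ((φ s (σ, q)).2.1, f (φ s (σ, q)).2.2))
        = ((moserField c χ κ m a b (φ s (σ, q))).1, ((moserField c χ κ m a b (φ s (σ, q))).2.1,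
          (modelDeriv I I f (φ s (σ, q)).2.2)
            (moserField c χ κ m a b (φ s (σ, q))).2.2)) := by
      simp only [moserField]
      rw [hcut _ (h.flow_mem s hq)]
      exact Prod.ext rfl (Prod.ext rfl ((modelDeriv I I f _).map_smul _ _).symm)
    rw [← h7] at h6
    exact h6
  have := h.flow_unique hγ s
  simp only [h.flow_zero] at this
  exact this.symm

end IsMoserFlow

end MoserFlow

/-! ### Moser's theorem for families on a compact manifold -/

section Moser

variable {E : Type u} [NormedAddCommGroup E] [NormedSpace ℝ E] [FiniteDimensional ℝ E]
  {H : Type*} [TopologicalSpace H] {I : ModelWithCorners ℝ E H} [I.Boundaryless]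
  {Z : Type*} [TopologicalSpace Z] [ChartedSpace H Z] [IsManifold I ∞ Z]

omit [FiniteDimensional ℝ E] in
/-- The value at `(t, z)` of the form `t⁻ᵐ dt ∧ a + b`. -/
def singularAt (m : ℕ) (a : ℝ → Z → E →L[ℝ] ℝ) (b : ℝ → Z → E →L[ℝ] E →L[ℝ] ℝ) (p : ℝ × Z) :
    ℝ × E →L[ℝ] ℝ × E →L[ℝ] ℝ :=
  frameForm ((p.1 ^ m)⁻¹ • a p.1 p.2) (b p.1 p.2)

/-- The Taylor polynomial of degree `m - 1` in `t` of a family of one-forms. -/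
def truncFamily (m : ℕ) (a : ℝ → Z → E →L[ℝ] ℝ) (t : ℝ) (z : Z) : E →L[ℝ] ℝ :=
  a t z - t ^ m • taylorQuot (fun r => a r z) m t

variable {m : ℕ} {ε δ δ₁ : ℝ} {a : ℝ → Z → E →L[ℝ] ℝ} {b : ℝ → Z → E →L[ℝ] E →L[ℝ] ℝ}
  {c χ κ : ℝ → ℝ} {φ : ℝ → ℝ × (ℝ × Z) → ℝ × (ℝ × Z)}

lemma singularForm_chart (m : ℕ) (a : ℝ → Z → E →L[ℝ] ℝ) (b : ℝ → Z → E →L[ℝ] E →L[ℝ] ℝ)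
    {p₀ : ℝ × Z} {x : ℝ × E} (hx : x.2 ∈ (chartParam I p₀.2).source) (v w : ℝ × E) :
    singularForm m (chartA I a p₀.2) (chartB I b p₀.2) x v w
      = singularAt m a b (chartParam (𝓘(ℝ, ℝ).prod I) p₀ x)
        (chartDeriv (𝓘(ℝ, ℝ).prod I) p₀ x v) (chartDeriv (𝓘(ℝ, ℝ).prod I) p₀ x w) := by
  rw [chartDeriv_prod hx, chartParam_prod_apply]
  rfl

lemma IsSymplecticFamily.singularForm_chart_trunc (h : IsSymplecticFamily I m ε a b)
    {p₀ : ℝ × Z} {x : ℝ × E} (hx : x.2 ∈ (chartParam I p₀.2).source) (hx1 : x.1 ∈ Ioo (-ε) ε)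
    (v w : ℝ × E) :
    singularForm m (fun p => chartA I a p₀.2 p - p.1 ^ m • IsClosedPair.quot (chartA I a p₀.2) m p)
      (fun p => chartB I b p₀.2 (0, p.2)) x v w
      = singularAt m (truncFamily m a) (fun _ => b 0) (chartParam (𝓘(ℝ, ℝ).prod I) p₀ x)
        (chartDeriv (𝓘(ℝ, ℝ).prod I) p₀ x v) (chartDeriv (𝓘(ℝ, ℝ).prod I) p₀ x w) := by
  have hq : IsClosedPair.quot (chartA I a p₀.2) m x
      = (taylorQuot (fun r => a r (chartParam I p₀.2 x.2)) m x.1).comp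
        (chartDeriv I p₀.2 x.2) :=
    taylorQuot_comp (a := fun r => a r (chartParam I p₀.2 x.2))
      (L := chartDeriv I p₀.2 x.2) m (h.contDiffOn_apply _) (fun _ _ => rfl) hx1
  rw [chartDeriv_prod hx, chartParam_prod_apply]
  simp only [singularForm, singularAt, hq]
  rfl

namespace IsMoserFlow

variable (h : IsMoserFlow I m ε δ δ₁ a b c χ κ φ)

include h

lemma contMDiff_space (σ : ℝ) : ContMDiff (𝓘(ℝ, ℝ).prod (𝓘(ℝ, ℝ).prod I)) (𝓘(ℝ, ℝ).prod I) ∞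
    (fun x : ℝ × (ℝ × Z) => (φ x.1 (σ, x.2)).2) := by
  refine contMDiff_snd.comp (h.flow_smooth.comp (f := fun x : ℝ × (ℝ × Z) => (x.1, (σ, x.2))) ?_)
  exact contMDiff_fst.prodMk (contMDiff_const.prodMk contMDiff_snd)

lemma hasMFDerivAt_snd [T2Space Z] {s : ℝ} (hs : |s| < 2) {q : ℝ × Z} (hq : |q.1| < ε) :
    HasMFDerivAt 𝓘(ℝ, ℝ) (𝓘(ℝ, ℝ).prod I) (fun r => (φ r (0, q)).2) s
      ((1 : ℝ →L[ℝ] ℝ).smulRight (moserField c χ κ m a b (s, (φ s (0, q)).2)).2) := by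
  have h1 := hasMFDerivAt_snd_of_curve (h.flow_curve (0, q) s)
  have h2 : φ s (0, q) = (s, (φ s (0, q)).2) :=
    Prod.ext (by rw [h.flow_fst hq (by simp) (by simpa using hs), zero_add]) rfl
  have h3 : (moserField c χ κ m a b (φ s (0, q))).2
      = (moserField c χ κ m a b (s, (φ s (0, q)).2)).2 := by rw [← h2]
  exact (congrArg (fun X : ℝ × E => HasMFDerivAt 𝓘(ℝ, ℝ) (𝓘(ℝ, ℝ).prod I)
    (fun r => (φ r (0, q)).2) s ((1 : ℝ →L[ℝ] ℝ).smulRight X)) h3).mp h1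

/-- The pullback of the interpolating form under the flow is constant. -/
lemma hasDerivAt_pullback [T2Space Z] {s : ℝ} (hs : |s| < 2) {q : ℝ × Z} (hq : |q.1| < ε)
    (hq0 : q.1 ≠ 0) (hG : |(φ s (0, q)).2.1| < δ₁) (v w : ℝ × E) :
    HasDerivAt (fun r => ((1 - r) • singularAt m (truncFamily m a) (fun _ => b 0) (φ r (0, q)).2
      + r • singularAt m a b (φ r (0, q)).2)
        (modelDeriv (𝓘(ℝ, ℝ).prod I) (𝓘(ℝ, ℝ).prod I) (fun q => (φ r (0, q)).2) q v)
        (modelDeriv (𝓘(ℝ, ℝ).prod I) (𝓘(ℝ, ℝ).prod I) (fun q => (φ r (0, q)).2) q w)) 0 s := by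
  have hsm := h.contMDiff_space 0
  set J := 𝓘(ℝ, ℝ).prod I with hJ
  set p₁ := (φ s (0, q)).2 with hp₁
  set k₀ := chartParam J q with hk₀
  set k₁ := chartParam J p₁ with hk₁
  set x₀ := extChartAt J q q with hx₀
  set y₁ := extChartAt J p₁ p₁ with hy₁
  have hx₀s : x₀ ∈ k₀.source := mem_chartParam_source q
  have hy₁s : y₁ ∈ k₁.source := mem_chartParam_source p₁
  have hkx₀ : k₀ x₀ = q := chartParam_self q
  have hky₁ : k₁ y₁ = p₁ := chartParam_self p₁
  set A := chartA I a p₁.2 with hA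
  set B := chartB I b p₁.2 with hB
  have hpair : IsClosedPair m ε (chartParam I p₁.2).source A B := h.family.closed p₁.2
  have hU := (chartParam I p₁.2).open_source
  have hsrc : ∀ y ∈ k₁.source, y.2 ∈ (chartParam I p₁.2).source := by
    intro y hy
    rw [hk₁, chartParam_prod_source] at hy
    exact hy.2
  have hfst : ∀ y, (k₁ y).1 = y.1 := fun y => by rw [hk₁, chartParam_prod_apply]
  have hy1 : y₁.1 = p₁.1 := by rw [← hfst, hky₁]
  have hδε : δ₁ < ε := h.δ₁_lt.trans h.δ_lt
  set g : ℝ × (ℝ × E) → ℝ × E := fun x => k₁.symm ((φ x.1 (0, k₀ x.2)).2) with hg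
  have hgy : g (s, x₀) = y₁ := by
    change k₁.symm ((φ s (0, k₀ x₀)).2) = y₁
    rw [hkx₀]
    rfl
  have hp₁t : p₁ ∈ k₁.target := hky₁ ▸ k₁.map_source hy₁s
  set X : ℝ × E → ℝ × E := fun y =>
    (moserField c χ κ m (fun t y => A (t, y)) (fun t y => B (t, y)) (s, y)).2 with hX
  -- the point stays away from the hypersurface
  have hy10 : y₁.1 ≠ 0 := by rw [hy1]; exact h.flow_ne_zero s (p := (0, q)) hq0
  have hy1I : y₁.1 ∈ Ioo (-ε) ε := by
    rw [hy1, mem_Ioo, ← abs_lt]; exact hG.trans hδε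
  have hgood : ∀ᶠ y in 𝓝 y₁, y ∈ k₁.source ∧ y.1 ≠ 0 ∧ |y.1| < δ₁ := by
    refine (k₁.open_source.eventually_mem hy₁s).and (Filter.Eventually.and ?_ ?_)
    · exact (continuousAt_fst (p := y₁)).eventually_ne hy10
    · refine (continuous_fst.abs.continuousAt (x := y₁)).eventually (gt_mem_nhds ?_)
      change |y₁.1| < δ₁
      rwa [hy1]
  have hIoo : ∀ t, |t| < δ₁ → t ∈ Ioo (-ε) ε := fun t ht => abs_lt.1 (ht.trans hδε)
  have hgs : ContDiffAt ℝ ∞ g (s, x₀) := by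
    have h1 : ContMDiffAt 𝓘(ℝ, ℝ × (ℝ × E)) J ∞ (fun x : ℝ × (ℝ × E) => k₀ x.2) (s, x₀) :=
      ContMDiffAt.comp (s, x₀) (k₀.contMDiffAt hx₀s) contDiff_snd.contMDiff.contMDiffAt
    have h2 : ContMDiffAt 𝓘(ℝ, ℝ × (ℝ × E)) (𝓘(ℝ, ℝ).prod J) ∞
        (fun x : ℝ × (ℝ × E) => (x.1, k₀ x.2)) (s, x₀) :=
      contDiff_fst.contMDiff.contMDiffAt.prodMk h1
    have h3 : ContMDiffAt 𝓘(ℝ, ℝ × (ℝ × E)) J ∞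
        (fun x : ℝ × (ℝ × E) => (φ x.1 (0, k₀ x.2)).2) (s, x₀) :=
      ContMDiffAt.comp (g := fun x : ℝ × (ℝ × Z) => (φ x.1 (0, x.2)).2) (s, x₀)
        (hsm (s, k₀ x₀)) h2
    refine ContMDiffAt.contDiffAt (ContMDiffAt.comp (s, x₀) (k₁.symm.contMDiffAt ?_) h3)
    change (φ s (0, k₀ x₀)).2 ∈ k₁.target
    rwa [hkx₀]
  have hGc : ContinuousAt (fun x : ℝ × (ℝ × E) => (φ x.1 (0, k₀ x.2)).2) (s, x₀) := by
    have h1 : ContinuousAt (fun x : ℝ × (ℝ × E) => (x.1, k₀ x.2)) (s, x₀) :=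
      continuousAt_fst.prodMk ((k₀.contMDiffAt hx₀s).continuousAt.comp
        (f := Prod.snd) (x := (s, x₀)) continuousAt_snd)
    exact ContinuousAt.comp (g := fun x : ℝ × (ℝ × Z) => (φ x.1 (0, x.2)).2)
      (hsm.continuous.continuousAt) h1
  have hnd : ∀ t, |t| < δ₁ → ∀ y ∈ (chartParam I p₁.2).source,
      IsNondeg (midForm m (fun r => A (r, y)) (fun r => B (r, y)) s t) := fun t ht y hy =>
    (h.family.isNondeg_chart_iff hy (hIoo t ht)).2 (h.nondeg s (by linarith) t
      (by linarith [h.δ₁_lt]) _)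
  have hXeq : ∀ y : ℝ × E, |y.1| < δ₁ → X y
      = (y.1 ^ (m + 1) * (moserVec m (fun r => A (r, y.2)) (fun r => B (r, y.2)) s y.1).1,
        y.1 • (moserVec m (fun r => A (r, y.2)) (fun r => B (r, y.2)) s y.1).2) := by
    intro y hy
    simp only [hX, moserField, cutVec]
    rw [h.c_one s hs.le, h.χ_one _ hy.le, one_mul, one_smul]
  have hXd : DifferentiableAt ℝ X y₁ := by
    have hcut := h.family.contDiffAt_cutVec_chart h.smooth_c h.smooth_χ h.δ_lt h.c_zero h.χ_zero
      h.nondeg (z₀ := p₁.2) (x := (s, y₁)) (hsrc y₁ hy₁s)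
    have hcut' : ContDiffAt ℝ ∞ (fun y : ℝ × E => cutVec c χ m (fun t y => A (t, y))
        (fun t y => B (t, y)) (s, y)) y₁ :=
      hcut.comp (f := fun y : ℝ × E => (s, y)) y₁ (contDiffAt_const.prodMk contDiffAt_id)
    have : ContDiffAt ℝ ∞ X y₁ :=
      ((contDiffAt_fst.pow (m + 1)).mul hcut'.fst).prodMk (contDiffAt_fst.smul hcut'.snd)
    exact this.differentiableAt (by simp)
  have hskewB : ∀ t ∈ Ioo (-ε) ε, ∀ y, ∀ v w, B (t, y) v w = -B (t, y) w v := fun t ht y v w =>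
    h.family.skew t ht _ _ _
  have h0I : (0 : ℝ) ∈ Ioo (-ε) ε := ⟨by linarith [h.eps_pos], h.eps_pos⟩
  have hy₁2 := hsrc y₁ hy₁s
  have hgX : ∀ᶠ x' in 𝓝 x₀, HasDerivAt (fun s => g (s, x')) (X (g (s, x'))) s := by
    have e1 : ContinuousAt (fun x' => (φ s (0, k₀ x')).2) x₀ :=
      hGc.comp (f := fun x' => (s, x')) (Continuous.prodMk_right s).continuousAt
    have e2 : ∀ᶠ x' in 𝓝 x₀, (φ s (0, k₀ x')).2 ∈ k₁.target :=
      e1.eventually (k₁.open_target.mem_nhds (by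
        change (φ s (0, k₀ x₀)).2 ∈ k₁.target
        rwa [hkx₀]))
    have e3 : ∀ᶠ x' in 𝓝 x₀, |(k₀ x').1| < ε := by
      have : ContinuousAt (fun x' => |(k₀ x').1|) x₀ := by
        have e : (fun x' => |(k₀ x').1|) = fun x' : ℝ × E => |x'.1| :=
          funext fun x' => by rw [hk₀, chartParam_prod_apply]
        rw [e]
        exact continuous_fst.abs.continuousAt
      exact this.eventually (gt_mem_nhds (by
        change |(k₀ x₀).1| < ε
        rwa [hkx₀]))
    filter_upwards [e2, e3] with x' hx' hx'ε
    have f1 := h.hasMFDerivAt_snd hs hx'ε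
    have f2 := (k₁.symm.mdifferentiableAt' (x := (φ s (0, k₀ x')).2) hx').hasMFDerivAt.comp s f1
    have f3 := (hasMFDerivAt_iff_hasFDerivAt.1 f2)
    have hgsrc : g (s, x') ∈ k₁.source := k₁.map_target hx'
    have hkg : k₁ (g (s, x')) = (φ s (0, k₀ x')).2 := k₁.apply_symm_apply hx'
    have f4 : (moserField c χ κ m a b (s, (φ s (0, k₀ x')).2)).2
        = chartDeriv J p₁ (g (s, x')) (X (g (s, x'))) := by
      have := h.family.moserField_chart (κ := κ) h.δ_lt h.c_zero h.χ_zero h.nondeg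
        (x₀ := (s, p₁)) (x := (s, g (s, x'))) (hsrc _ hgsrc)
      have hx'' : (s, g (s, x')).2 ∈ (chartParam J (s, p₁).2).source := hgsrc
      rw [chartDeriv_prod hx'', chartParam_prod_apply] at this
      change moserField c χ κ m a b (s, k₁ (g (s, x'))) = _ at this
      rw [hkg] at this
      exact congrArg Prod.snd this
    have f5 : HasFDerivAt (fun s => g (s, x')) ((1 : ℝ →L[ℝ] ℝ).smulRight (X (g (s, x')))) s := by
      have e : (modelDeriv J 𝓘(ℝ, ℝ × E) k₁.symm (φ s (0, k₀ x')).2).comp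
          ((1 : ℝ →L[ℝ] ℝ).smulRight (moserField c χ κ m a b (s, (φ s (0, k₀ x')).2)).2)
          = (1 : ℝ →L[ℝ] ℝ).smulRight (X (g (s, x'))) := by
        refine ContinuousLinearMap.ext_ring ?_
        simp only [ContinuousLinearMap.comp_apply, ContinuousLinearMap.smulRight_apply,
          one_apply_eq_self, one_smul]
        rw [f4, ← hkg]
        exact k₁.mfderiv_symm_apply hgsrc _
      rw [← e]
      exact f3
    exact f5.hasDerivAt.congr_deriv (by simp)
  have hprim := hpair.curl_primitive hU hy1I hy10 hy₁2
  have htr := hpair.truncate hU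
  have hmain := hasDerivAt_moser (g := g) (s := s) (x := x₀) (X := X)
    (ω₀ := singularForm m (fun p => A p - p.1 ^ m • IsClosedPair.quot A m p)
      (fun p => B (0, p.2)))
    (ω₁ := singularForm m A B)
    (μ := fun p : ℝ × E => (p.1 • meanTo (fun s => IsClosedPair.quot A m (s, p.2)) p.1).comp
      (ContinuousLinearMap.snd ℝ ℝ E)) hgs
    (by rw [hgy]; exact (htr.fderiv_singularForm hU hy1I hy10 hy₁2).choose_spec.1)
    (by rw [hgy]; exact (hpair.fderiv_singularForm hU hy1I hy10 hy₁2).choose_spec.1)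
    (by rw [hgy]; exact hprim.1) (by rw [hgy]; exact hXd) hgX
    (by
      rw [hgy]
      filter_upwards [hgood] with y hy w
      rw [hXeq y hy.2.2]
      exact IsClosedPair.singularForm_moserVec hy.2.1 y.2 (hnd _ hy.2.2 _ (hsrc y hy.1)) w)
    (by
      rw [hgy]
      refine Filter.Eventually.of_forall fun y v w => frameForm_skew _ (hskewB 0 h0I _) v w)
    (by
      rw [hgy]
      filter_upwards [hgood] with y hy v w
      exact frameForm_skew _ (hskewB _ (hIoo _ hy.2.2) _) v w)
    (by rw [hgy]; exact htr.closed_singularForm hU hy1I hy10 hy₁2)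
    (by rw [hgy]; exact hpair.closed_singularForm hU hy1I hy10 hy₁2)
    (by rw [hgy]; exact hprim.2)
  -- transport to the manifold
  obtain ⟨e₀, he₀⟩ := exists_inverse_chartDeriv hx₀s
  refine (hmain (e₀.symm v) (e₀.symm w)).congr_of_eventuallyEq ?_
  have hcurve : ContinuousAt (fun r => (φ r (0, q)).2) s :=
    hsm.continuous.continuousAt.comp (f := fun r => (r, q)) (Continuous.prodMk_left q).continuousAt
  have hev : ∀ᶠ r in 𝓝 s, (φ r (0, q)).2 ∈ k₁.target :=
    hcurve.eventually (k₁.open_target.mem_nhds hp₁t)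
  filter_upwards [hev] with r hr
  have hgr : g (r, x₀) = k₁.symm (φ r (0, q)).2 := by
    change k₁.symm ((φ r (0, k₀ x₀)).2) = _
    rw [hkx₀]
  have hgrs : g (r, x₀) ∈ k₁.source := by rw [hgr]; exact k₁.map_target hr
  have hkgr : k₁ (g (r, x₀)) = (φ r (0, q)).2 := by rw [hgr]; exact k₁.apply_symm_apply hr
  have hg1 : (g (r, x₀)).1 ∈ Ioo (-ε) ε := by
    rw [← hfst, hkgr, mem_Ioo, ← abs_lt]
    exact h.flow_mem r (p := (0, q)) hq
  have hder : ∀ v, chartDeriv J p₁ (g (r, x₀)) (fderiv ℝ (fun x => g (r, x)) x₀ (e₀.symm v))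
      = modelDeriv J J (fun q => (φ r (0, q)).2) q v := by
    intro v
    have d0 := hasMFDerivAt_chartParam hx₀s
    have hGr : ContMDiff J J ∞ (fun q => (φ r (0, q)).2) :=
      hsm.comp (f := fun q : ℝ × Z => (r, q)) (contMDiff_const.prodMk contMDiff_id)
    have d1 : HasMFDerivAt J J (fun q => (φ r (0, q)).2) (k₀ x₀)
        (modelDeriv J J (fun q => (φ r (0, q)).2) (k₀ x₀)) :=
      (hGr.mdifferentiableAt (by simp)).hasMFDerivAt
    have d2 := d1.comp x₀ d0
    have hr' : (φ r (0, k₀ x₀)).2 ∈ k₁.symm.source := by rw [hkx₀]; exact hr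
    have d3 := (k₁.symm.mdifferentiableAt' hr').hasMFDerivAt.comp x₀ d2
    have d4 : HasFDerivAt (fun x => g (r, x))
        ((modelDeriv J 𝓘(ℝ, ℝ × E) k₁.symm (φ r (0, k₀ x₀)).2).comp
          ((modelDeriv J J (fun q => (φ r (0, q)).2) (k₀ x₀)).comp (chartDeriv J q x₀))) x₀ :=
      hasMFDerivAt_iff_hasFDerivAt.1 d3
    rw [d4.fderiv, ContinuousLinearMap.comp_apply, ContinuousLinearMap.comp_apply, ← he₀, hkx₀]
    have : (e₀ : ℝ × E →L[ℝ] ℝ × E) (e₀.symm v) = v := e₀.apply_symm_apply v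
    rw [this, ← hkgr]
    exact k₁.mfderiv_apply_symm hgrs _
  change (1 - r) * singularAt m (truncFamily m a) (fun _ => b 0) (φ r (0, q)).2 _ _
    + r * singularAt m a b (φ r (0, q)).2 _ _
    = (1 - r) * singularForm _ _ _ (g (r, x₀)) _ _ + r * singularForm m A B (g (r, x₀)) _ _
  rw [singularForm_chart m a b (p₀ := p₁) (hsrc _ hgrs),
    h.family.singularForm_chart_trunc (p₀ := p₁) (hsrc _ hgrs) hg1, hder, hder]
  change _ = (1 - r) * singularAt _ _ _ (k₁ (g (r, x₀))) _ _
    + r * singularAt _ _ _ (k₁ (g (r, x₀))) _ _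
  rw [hkgr]

end IsMoserFlow

end Moser

section MoserDiffeo

variable {E : Type} [NormedAddCommGroup E] [NormedSpace ℝ E] [FiniteDimensional ℝ E]
  {H : Type*} [TopologicalSpace H] {I : ModelWithCorners ℝ E H} [I.Boundaryless]
  {Z : Type*} [TopologicalSpace Z] [ChartedSpace H Z] [IsManifold I ∞ Z]
  {m : ℕ} {ε δ δ₁ : ℝ} {a : ℝ → Z → E →L[ℝ] ℝ} {b : ℝ → Z → E →L[ℝ] E →L[ℝ] ℝ}
  {c χ κ : ℝ → ℝ} {φ : ℝ → ℝ × (ℝ × Z) → ℝ × (ℝ × Z)}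

namespace IsMoserFlow

variable (h : IsMoserFlow I m ε δ δ₁ a b c χ κ φ)

/-- The coefficient `g` in the expansion `t + tᵐ⁺¹ g` of the time-one map of Moser's flow. -/
def germ (m : ℕ) (a : ℝ → Z → E →L[ℝ] ℝ) (b : ℝ → Z → E →L[ℝ] E →L[ℝ] ℝ) (c χ : ℝ → ℝ)
    (φ : ℝ → ℝ × (ℝ × Z) → ℝ × (ℝ × Z)) (p : ℝ × Z) : ℝ :=
  ∫ s in (0 : ℝ)..1, dslope (fun t => (φ s (0, (t, p.2))).2.1) 0 p.1 ^ (m + 1)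
    * (cutVec c χ m a b (φ s (0, p))).1

include h

lemma germ_eq [T2Space Z] {p : ℝ × Z} (hp : |p.1| < ε) :
    (φ 1 (0, p)).2.1 = p.1 + p.1 ^ (m + 1) * germ m a b c χ φ p := by
  obtain ⟨t, z⟩ := p
  have hcut : Continuous (fun s => (cutVec c χ m a b (φ s (0, (t, z)))).1) :=
    (h.family.contMDiff_cutVec_fst h.smooth_c h.smooth_χ h.δ_lt h.c_zero h.χ_zero
      h.nondeg).continuous.comp (h.flow_smooth.continuous.comp (Continuous.prodMk_left _))
  have hτ : Continuous (fun s => (φ s (0, (t, z))).2.1) :=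
    (h.contMDiff_space 0).continuous.fst.comp (f := fun s => (s, (t, z))) (Continuous.prodMk_left _)
  have hd : ∀ s ∈ uIcc (0 : ℝ) 1, HasDerivAt (fun s => (φ s (0, (t, z))).2.1)
      ((φ s (0, (t, z))).2.1 ^ (m + 1) * (cutVec c χ m a b (φ s (0, (t, z)))).1) s := by
    intro s _
    exact hasDerivAt_fst_of_curve (hasMFDerivAt_snd_of_curve (h.flow_curve (0, (t, z)) s))
  have hint := intervalIntegral.integral_eq_sub_of_hasDerivAt hd
    ((hτ.pow (m + 1)).mul hcut).continuousOn.intervalIntegrable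
  rw [h.flow_zero] at hint
  have hint' : (φ 1 (0, (t, z))).2.1 = t + ∫ s in (0 : ℝ)..1, (φ s (0, (t, z))).2.1 ^ (m + 1)
      * (cutVec c χ m a b (φ s (0, (t, z)))).1 := by
    rw [hint]; simp
  rw [hint']
  simp only [germ]
  rw [← intervalIntegral.integral_const_mul]
  congr 1
  refine intervalIntegral.integral_congr fun s _ => ?_
  have h0 : (φ s (0, ((0 : ℝ), z))).2.1 = 0 := by rw [h.flow_fixed (.inl rfl)]
  have h1 := sub_eq_smul_dslope_zero (fun t => (φ s (0, (t, z))).2.1) t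
  simp only [h0, zero_add, smul_eq_mul] at h1
  rw [h1]
  ring

lemma contMDiffOn_germ : ContMDiffOn (𝓘(ℝ, ℝ).prod I) 𝓘(ℝ, ℝ) ∞ (germ m a b c χ φ)
    (Ioo (-ε) ε ×ˢ univ) := by
  rintro p₀ ⟨hp₀, -⟩
  refine (contMDiffAt_of_chartParam p₀ ?_).contMDiffWithinAt
  have hmem := mem_chartParam_source (I := 𝓘(ℝ, ℝ).prod I) p₀
  have hmem' := hmem
  rw [chartParam_prod_source] at hmem'
  have hfst : (extChartAt (𝓘(ℝ, ℝ).prod I) p₀ p₀).1 = p₀.1 := by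
    rw [extChartAt_prod]; rfl
  set U := (chartParam I p₀.2).source with hU
  have hUo : IsOpen U := (chartParam I p₀.2).open_source
  have hopen : IsOpen (Ioo (-ε) ε ×ˢ U) := isOpen_Ioo.prod hUo
  have hk : ∀ y ∈ U, ContMDiffAt 𝓘(ℝ, E) I ∞ (chartParam I p₀.2) y := fun y hy =>
    (chartParam I p₀.2).contMDiffAt hy
  have hbase : ∀ (x : ℝ × (ℝ × E)), x.2.2 ∈ U →
      ContMDiffAt 𝓘(ℝ, ℝ × (ℝ × E)) (𝓘(ℝ, ℝ).prod (𝓘(ℝ, ℝ).prod I)) ∞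
        (fun x : ℝ × (ℝ × E) => (x.1, (x.2.1, chartParam I p₀.2 x.2.2))) x := by
    intro x hx
    have h1 : ContMDiffAt 𝓘(ℝ, ℝ × (ℝ × E)) I ∞
        (fun x : ℝ × (ℝ × E) => chartParam I p₀.2 x.2.2) x :=
      ContMDiffAt.comp x (hk _ hx) (contDiff_snd.comp contDiff_snd).contMDiff.contMDiffAt
    exact contDiff_fst.contMDiff.contMDiffAt.prodMk
      ((contDiff_fst.comp contDiff_snd).contMDiff.contMDiffAt.prodMk h1)
  have hτ : ∀ (x : ℝ × (ℝ × E)), x.2.2 ∈ U → ContDiffAt ℝ ∞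
      (fun x : ℝ × (ℝ × E) => (φ x.1 (0, (x.2.1, chartParam I p₀.2 x.2.2))).2.1) x := by
    intro x hx
    refine ContMDiffAt.contDiffAt ?_
    exact ContMDiffAt.comp (g := fun x : ℝ × (ℝ × Z) => (φ x.1 (0, x.2)).2.1) x
      ((contMDiff_fst.comp (h.contMDiff_space 0)) _) (hbase x hx)
  have hslope := contDiffOn_dslope_param (ε := ε) (X := ℝ × E) (U := univ ×ˢ U)
    (f := fun x => (φ x.2.1 (0, (x.1, chartParam I p₀.2 x.2.2))).2.1) (isOpen_univ.prod hUo)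
    (fun x hx => ((hτ (x.2.1, (x.1, x.2.2)) hx.2.2).comp
      (f := fun x : ℝ × (ℝ × E) => (x.2.1, (x.1, x.2.2))) x
      (contDiffAt_snd.fst.prodMk (contDiffAt_fst.prodMk contDiffAt_snd.snd))).contDiffWithinAt)
  have hint := contDiffOn_unitIntegral (U := Ioo (-ε) ε ×ˢ U)
    (F := fun s (x : ℝ × E) =>
      dslope (fun t => (φ s (0, (t, chartParam I p₀.2 x.2))).2.1) 0 x.1 ^ (m + 1)
        * (cutVec c χ m a b (φ s (0, (x.1, chartParam I p₀.2 x.2)))).1) hopen (by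
    rintro s - x hx
    refine ContDiffAt.mul (ContDiffAt.pow ?_ _) ?_
    · exact (hslope.contDiffAt ((isOpen_Ioo.prod (isOpen_univ.prod hUo)).mem_nhds
        (show (x.1, (s, x.2)) ∈ _ from ⟨hx.1, mem_univ _, hx.2⟩))).comp
        (f := fun x : ℝ × (ℝ × E) => (x.2.1, (x.1, x.2.2))) (s, x)
        (contDiffAt_snd.fst.prodMk (contDiffAt_fst.prodMk contDiffAt_snd.snd))
    · refine ContMDiffAt.contDiffAt ?_
      have h1 : ContMDiff (𝓘(ℝ, ℝ).prod (𝓘(ℝ, ℝ).prod I)) (𝓘(ℝ, ℝ).prod (𝓘(ℝ, ℝ).prod I)) ∞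
          (fun x : ℝ × (ℝ × Z) => φ x.1 (0, x.2)) :=
        h.flow_smooth.comp (f := fun x : ℝ × (ℝ × Z) => (x.1, ((0 : ℝ), x.2)))
          (contMDiff_fst.prodMk (contMDiff_const.prodMk contMDiff_snd))
      have h2 := (h.family.contMDiff_cutVec_fst h.smooth_c h.smooth_χ h.δ_lt h.c_zero h.χ_zero
        h.nondeg).comp h1
      exact ContMDiffAt.comp (g := fun x : ℝ × (ℝ × Z) => (cutVec c χ m a b (φ x.1 (0, x.2))).1)
        (s, x) (h2 _) (hbase (s, x) hx.2))
  have := hint.contDiffAt (x := extChartAt (𝓘(ℝ, ℝ).prod I) p₀ p₀)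
    (hopen.mem_nhds ⟨by rw [hfst]; exact hp₀, hmem'.2⟩)
  refine this.congr_of_eventuallyEq (Filter.Eventually.of_forall fun x => ?_)
  exact congrArg (germ m a b c χ φ) (chartParam_prod_apply I p₀ x)

/-- The time-one map of Moser's flow. -/
lemma exists_diffeo [T2Space Z] :
    ∃ ψ : PartialDiffeomorph (𝓘(ℝ, ℝ).prod I) (𝓘(ℝ, ℝ).prod I) (ℝ × Z) (ℝ × Z) ∞,
      (∀ p, ψ p = (φ 1 (0, p)).2) ∧ ψ.source = Ioo (-ε) ε ×ˢ univ
        ∧ ψ.target = Ioo (-ε) ε ×ˢ univ := by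
  have hmem : ∀ s σ (p : ℝ × Z), p ∈ Ioo (-ε) ε ×ˢ (univ : Set Z) →
      (φ s (σ, p)).2 ∈ Ioo (-ε) ε ×ˢ (univ : Set Z) := fun s σ p hp =>
    ⟨abs_lt.1 (h.flow_mem s (p := (σ, p)) (abs_lt.2 hp.1)), mem_univ _⟩
  refine ⟨{ toFun := fun p => (φ 1 (0, p)).2
            invFun := fun p => (φ (-1) (1, p)).2
            source := Ioo (-ε) ε ×ˢ univ
            target := Ioo (-ε) ε ×ˢ univ
            map_source' := fun p hp => hmem _ _ p hp
            map_target' := fun p hp => hmem _ _ p hp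
            left_inv' := fun p hp => ?_
            right_inv' := fun p hp => ?_
            open_source := isOpen_Ioo.prod isOpen_univ
            open_target := isOpen_Ioo.prod isOpen_univ
            contMDiffOn_toFun := ?_
            contMDiffOn_invFun := ?_ }, fun p => rfl, rfl, rfl⟩
  · have h1 : φ 1 (0, p) = (1, (φ 1 (0, p)).2) :=
      Prod.ext (by rw [h.flow_fst (abs_lt.2 hp.1) (by norm_num) (by norm_num), zero_add]) rfl
    change (φ (-1) (1, (φ 1 (0, p)).2)).2 = p
    rw [← h1, h.flow_neg]
  · have h1 : φ (-1) (1, p) = (0, (φ (-1) (1, p)).2) :=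
      Prod.ext (by rw [h.flow_fst (abs_lt.2 hp.1) (by norm_num) (by norm_num)]; norm_num) rfl
    change (φ 1 (0, (φ (-1) (1, p)).2)).2 = p
    rw [← h1]
    have := h.flow_neg (-1) (1, p)
    rw [neg_neg] at this
    rw [this]
  · exact ((h.contMDiff_space 0).comp (f := fun p : ℝ × Z => ((1 : ℝ), p))
      (contMDiff_const.prodMk contMDiff_id)).contMDiffOn
  · exact ((h.contMDiff_space 1).comp (f := fun p : ℝ × Z => ((-1 : ℝ), p))
      (contMDiff_const.prodMk contMDiff_id)).contMDiffOn

lemma exists_stay [T2Space Z] [CompactSpace Z] :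
    ∃ η > 0, ∀ t, |t| < η → ∀ s ∈ Icc (0 : ℝ) 1, ∀ z, |(φ s (0, (t, z))).2.1| < δ₁ := by
  have hK : IsCompact (Icc (0 : ℝ) 1 ×ˢ (univ : Set Z)) := isCompact_Icc.prod isCompact_univ
  have key : ∀ᶠ t in 𝓝 (0 : ℝ), ∀ q ∈ Icc (0 : ℝ) 1 ×ˢ (univ : Set Z),
      |(φ q.1 (0, (t, q.2))).2.1| < δ₁ := by
    refine hK.eventually_forall_of_forall_eventually fun q _ => ?_
    have hc : Continuous (fun x : ℝ × (ℝ × Z) => |(φ x.2.1 (0, (x.1, x.2.2))).2.1|) :=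
      ((h.contMDiff_space 0).continuous.fst.comp
        (f := fun x : ℝ × (ℝ × Z) => (x.2.1, (x.1, x.2.2))) (by fun_prop)).abs
    refine hc.continuousAt.eventually (gt_mem_nhds ?_)
    simp only
    rw [h.flow_fixed (.inl rfl), abs_zero]
    exact h.δ₁_pos
  obtain ⟨η, hη, hball⟩ := Metric.eventually_nhds_iff.1 key
  refine ⟨η, hη, fun t ht s hs z => hball (y := t) ?_ (s, z) ⟨hs, mem_univ _⟩⟩
  rwa [Real.dist_eq, sub_zero]

lemma pullback_eq [T2Space Z] {q : ℝ × Z} (hq : |q.1| < ε) (hq0 : q.1 ≠ 0)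
    (hG : ∀ s ∈ Icc (0 : ℝ) 1, |(φ s (0, q)).2.1| < δ₁) (v w : ℝ × E) :
    singularAt m a b (φ 1 (0, q)).2
      (modelDeriv (𝓘(ℝ, ℝ).prod I) (𝓘(ℝ, ℝ).prod I) (fun q => (φ 1 (0, q)).2) q v)
      (modelDeriv (𝓘(ℝ, ℝ).prod I) (𝓘(ℝ, ℝ).prod I) (fun q => (φ 1 (0, q)).2) q w)
    = singularAt m (truncFamily m a) (fun _ => b 0) q v w := by
  have hd := fun s (hs : s ∈ Icc (0 : ℝ) 1) => h.hasDerivAt_pullback (s := s)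
    (abs_lt.2 ⟨by linarith [hs.1], by linarith [hs.2]⟩) hq hq0 (hG s hs) v w
  have hconst := constant_of_has_deriv_right_zero (a := 0) (b := 1)
    (fun s hs => (hd s hs).continuousAt.continuousWithinAt)
    (fun s hs => (hd s ⟨hs.1, hs.2.le⟩).hasDerivWithinAt) 1 ⟨zero_le_one, le_rfl⟩
  have hid : (fun q : ℝ × Z => (φ 0 (0, q)).2) = id := funext fun q => by rw [h.flow_zero]; rfl
  have hmid : modelDeriv (𝓘(ℝ, ℝ).prod I) (𝓘(ℝ, ℝ).prod I) (id : ℝ × Z → ℝ × Z) q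
      = ContinuousLinearMap.id ℝ (ℝ × E) := mfderiv_id
  rw [hid, hmid, h.flow_zero, sub_self, zero_smul, zero_add, one_smul, sub_zero, one_smul,
    zero_smul, add_zero] at hconst
  exact hconst

end IsMoserFlow

/-- **Moser's theorem**: a symplectic `bᵐ`-form on a neighbourhood of `Z` in `ℝ × Z` is equivalent
to its truncation. -/
theorem IsSymplecticFamily.exists_moser_diffeo [T2Space Z] [CompactSpace Z]
    (h : IsSymplecticFamily I m ε a b) (hm : m ≠ 0) (hε : 0 < ε) :
    ∃ (ψ : PartialDiffeomorph (𝓘(ℝ, ℝ).prod I) (𝓘(ℝ, ℝ).prod I) (ℝ × Z) (ℝ × Z) ∞)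
      (g : ℝ × Z → ℝ) (δ : ℝ), 0 < δ ∧ δ ≤ ε ∧ ψ.source = Ioo (-ε) ε ×ˢ univ ∧
      ψ.target = Ioo (-ε) ε ×ˢ univ ∧ (∀ z, ψ (0, z) = (0, z)) ∧
      ContMDiffOn (𝓘(ℝ, ℝ).prod I) 𝓘(ℝ, ℝ) ∞ g (Ioo (-ε) ε ×ˢ univ) ∧
      (∀ p : ℝ × Z, |p.1| < ε → (ψ p).1 = p.1 + p.1 ^ (m + 1) * g p) ∧
      (∀ p : ℝ × Z, |p.1| < ε → p.1 ≠ 0 → (ψ p).1 ≠ 0) ∧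
      (∀ p : ℝ × Z, |p.1| < δ → p.1 ≠ 0 → ∀ v w : ℝ × E,
        singularAt m a b (ψ p) (modelDeriv (𝓘(ℝ, ℝ).prod I) (𝓘(ℝ, ℝ).prod I) ψ p v)
          (modelDeriv (𝓘(ℝ, ℝ).prod I) (𝓘(ℝ, ℝ).prod I) ψ p w)
        = singularAt m (truncFamily m a) (fun _ => b 0) p v w) ∧
      ∀ f : Z → Z, MDifferentiable I I f → (∀ z, Function.Surjective (modelDeriv I I f z)) →
        (∀ t ∈ Ioo (-ε) ε, ∀ z, a t z = (a t (f z)).comp (modelDeriv I I f z)) →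
        (∀ t ∈ Ioo (-ε) ε, ∀ z,
          b t z = (b t (f z)).bilinearComp (modelDeriv I I f z) (modelDeriv I I f z)) →
        ∀ q : ℝ × Z, |q.1| < ε → ψ (q.1, f q.2) = ((ψ q).1, f (ψ q).2) := by
  obtain ⟨δ, δ₁, c, χ, κ, φ, hφ⟩ := h.exists_flow hm hε
  obtain ⟨ψ, hψ, hs, ht⟩ := hφ.exists_diffeo
  obtain ⟨η, hη, hstay⟩ := hφ.exists_stay
  have hψ' : (ψ : ℝ × Z → ℝ × Z) = fun p => (φ 1 (0, p)).2 := funext hψ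
  refine ⟨ψ, IsMoserFlow.germ m a b c χ φ, min η ε, lt_min hη hε, min_le_right _ _, hs, ht,
    fun z => ?_, hφ.contMDiffOn_germ, fun p hp => ?_, fun p hp hp0 => ?_, fun p hp hp0 v w => ?_,
    fun f hf hsurj ha hb q hq => ?_⟩
  · rw [hψ, hφ.flow_fixed (.inl rfl)]
  · rw [hψ, hφ.germ_eq hp]
  · rw [hψ]
    exact hφ.flow_ne_zero 1 (p := (0, p)) hp0
  · rw [hψ']
    exact hφ.pullback_eq (hp.trans_le (min_le_right _ _)) hp0
      (fun s hs => hstay p.1 (hp.trans_le (min_le_left _ _)) s hs p.2) v w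
  · rw [hψ, hψ, hφ.flow_equivariant hf hsurj ha hb 1 0 hq]

end MoserDiffeo

/-! ### Invariant transverse vector fields -/

section Transverse

variable {E : Type u} [NormedAddCommGroup E] [NormedSpace ℝ E] [FiniteDimensional ℝ E]
  {H : Type*} [TopologicalSpace H] {I : ModelWithCorners ℝ E H} [I.Boundaryless]
  {M : Type*} [TopologicalSpace M] [ChartedSpace H M] [IsManifold I ∞ M]
  {f : M → ℝ}

/-- Smoothness of a vector field. -/
def IsSmoothField (I : ModelWithCorners ℝ E H) [IsManifold I ∞ M] (V : M → E) : Prop :=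
  ContMDiff I I.tangent ∞ (fun p => (⟨p, V p⟩ : TangentBundle I M))

lemma hasFDerivAt_comp_chartParam (hf : ContMDiff I 𝓘(ℝ, ℝ) ∞ f) {p₀ : M} {y : E}
    (hy : y ∈ (chartParam I p₀).source) :
    HasFDerivAt (fun y => f (chartParam I p₀ y))
      ((modelDeriv I 𝓘(ℝ, ℝ) f (chartParam I p₀ y)).comp (chartDeriv I p₀ y)) y := by
  have h1 : HasMFDerivAt I 𝓘(ℝ, ℝ) f (chartParam I p₀ y)
      (modelDeriv I 𝓘(ℝ, ℝ) f (chartParam I p₀ y)) :=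
    (hf.mdifferentiableAt (by simp)).hasMFDerivAt
  exact hasMFDerivAt_iff_hasFDerivAt.1 (h1.comp y (hasMFDerivAt_chartParam hy))

lemma contDiffAt_comp_chartParam {G : Type*} [NormedAddCommGroup G] [NormedSpace ℝ G] {f : M → G}
    (hf : ContMDiff I 𝓘(ℝ, G) ∞ f) {p₀ : M} {y : E} (hy : y ∈ (chartParam I p₀).source) :
    ContDiffAt ℝ ∞ (fun y => f (chartParam I p₀ y)) y :=
  (ContMDiffAt.comp y (hf _) ((chartParam I p₀).contMDiffAt hy)).contDiffAt

/-- The derivative of a smooth function along a smooth vector field is smooth. -/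
lemma contMDiff_modelDeriv_apply (hf : ContMDiff I 𝓘(ℝ, ℝ) ∞ f) {V : M → E}
    (hV : IsSmoothField I V) : ContMDiff I 𝓘(ℝ, ℝ) ∞ (fun p => modelDeriv I 𝓘(ℝ, ℝ) f p (V p)) := by
  have := FiniteDimensional.complete ℝ E
  intro p₀
  refine contMDiffAt_of_chartParam p₀ ?_
  have hmem := mem_chartParam_source (I := I) p₀
  have h1 : ContDiffAt ℝ ∞ (fun y => (VectorField.mpullback 𝓘(ℝ, E) I (chartParam I p₀) V y : E))
      (extChartAt I p₀ p₀) := contDiffAt_param_of_vectorField (chartParam I p₀) hmem (hV _)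
  have h2 := ((contDiffAt_comp_chartParam hf hmem).fderiv_right (m := ∞) (by simp)).clm_apply h1
  refine h2.congr_of_eventuallyEq ?_
  filter_upwards [(chartParam I p₀).open_source.mem_nhds hmem] with y hy
  rw [(hasFDerivAt_comp_chartParam hf hy).fderiv]
  have := mfderiv_mpullback V (chartParam I p₀) hy
  exact (congrArg (modelDeriv I 𝓘(ℝ, ℝ) f (chartParam I p₀ y)) this).symm

lemma IsSmoothField.smul {V : M → E} (hV : IsSmoothField I V) {u : M → ℝ}
    (hu : ContMDiff I 𝓘(ℝ, ℝ) ∞ u) : IsSmoothField I (fun p => u p • V p) := by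
  have := FiniteDimensional.complete ℝ E
  intro p₀
  have hmem := mem_chartParam_source (I := I) p₀
  have h1 : ContDiffAt ℝ ∞ (fun y => (VectorField.mpullback 𝓘(ℝ, E) I (chartParam I p₀) V y : E))
      (extChartAt I p₀ p₀) := contDiffAt_param_of_vectorField (chartParam I p₀) hmem (hV _)
  have h2 := contMDiffAt_vectorField_of_param (X := fun p => (u p • V p : E)) (chartParam I p₀) hmem
    ((contDiffAt_comp_chartParam hu hmem).smul h1) ?_
  · rwa [chartParam_self] at h2
  · filter_upwards [(chartParam I p₀).open_source.mem_nhds hmem] with y hy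
    have h3 : chartDeriv I p₀ y (VectorField.mpullback 𝓘(ℝ, E) I (chartParam I p₀) V y : E)
        = V (chartParam I p₀ y) := mfderiv_mpullback V (chartParam I p₀) hy
    exact (((chartDeriv I p₀ y).map_smul (u (chartParam I p₀ y))
      (VectorField.mpullback 𝓘(ℝ, E) I (chartParam I p₀) V y : E)).trans
        (congrArg (fun v : E => u (chartParam I p₀ y) • v) h3)).symm

lemma convex_pos_of_imp (ℓ : E →L[ℝ] ℝ) (P : Prop) : Convex ℝ {v : E | P → 0 < ℓ v} := by
  intro v hv w hw a b ha hb hab hp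
  have h1 := hv hp
  have h2 := hw hp
  rw [map_add, map_smul, map_smul, smul_eq_mul, smul_eq_mul]
  rcases ha.eq_or_lt with rfl | ha
  · rw [zero_add] at hab
    subst hab
    simpa using h2
  · have := mul_pos ha h1
    have := mul_nonneg hb h2.le
    linarith

/-- Existence of a vector field transverse to a regular level. -/
lemma exists_transverse_field [T2Space M] [CompactSpace M] (hf : ContMDiff I 𝓘(ℝ, ℝ) ∞ f)
    (hreg : ∀ p, f p = 0 → modelDeriv I 𝓘(ℝ, ℝ) f p ≠ 0) :
    ∃ V : M → E, IsSmoothField I V ∧ ∀ p, f p = 0 → 0 < modelDeriv I 𝓘(ℝ, ℝ) f p (V p) := by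
  have := FiniteDimensional.complete ℝ E
  obtain ⟨s, hs⟩ := exists_contMDiffSection_forall_mem_convex_of_local (n := ⊤) I
    (TangentSpace I : M → Type u)
    (fun p => {v : E | f p = 0 → 0 < modelDeriv I 𝓘(ℝ, ℝ) f p v}) (fun p => convex_pos_of_imp (modelDeriv I 𝓘(ℝ, ℝ) f p) (f p = 0)) (fun p₀ => by
      by_cases hp₀ : f p₀ = 0
      · obtain ⟨v₀, hv₀⟩ : ∃ v, 0 < modelDeriv I 𝓘(ℝ, ℝ) f p₀ v := by
          obtain ⟨v, hv⟩ := DFunLike.ne_iff.1 (hreg p₀ hp₀)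
          rcases lt_or_gt_of_ne hv with h | h
          · exact ⟨-v, by rw [map_neg]; simpa using h⟩
          · exact ⟨v, h⟩
        have hmem := mem_chartParam_source (I := I) p₀
        obtain ⟨e, he⟩ := exists_inverse_chartDeriv hmem
        set v := e.symm v₀ with hv
        set k := chartParam I p₀ with hk
        have hc : ContinuousAt (fun y => fderiv ℝ (fun y => f (k y)) y v) (extChartAt I p₀ p₀) :=
          (((contDiffAt_comp_chartParam hf hmem).fderiv_right (m := ∞) (by simp)).clm_apply
            contDiffAt_const).continuousAt
        have hpos : 0 < fderiv ℝ (fun y => f (k y)) (extChartAt I p₀ p₀) v := by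
          rw [(hasFDerivAt_comp_chartParam hf hmem).fderiv, ContinuousLinearMap.comp_apply, ← he,
            chartParam_self]
          have : (e : E →L[ℝ] E) v = v₀ := e.apply_symm_apply v₀
          rwa [this]
        have hev := hc.eventually (lt_mem_nhds hpos)
        have hsymm : Filter.Tendsto k.symm (𝓝 p₀) (𝓝 (extChartAt I p₀ p₀)) :=
          continuousAt_extChartAt p₀
        refine ⟨k.target ∩ {p | 0 < fderiv ℝ (fun y => f (k y)) (k.symm p) v},
          Filter.inter_mem (k.open_target.mem_nhds (mem_extChartAt_source p₀)) (hsymm.eventually hev),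
          fun p => (chartDeriv I p₀ (k.symm p) v : E), fun p hp => ?_, fun p hp _ => ?_⟩
        · have hps := k.map_target hp.1
          have h1 := contMDiffAt_vectorField_of_param
            (X := fun p => (chartDeriv I p₀ (k.symm p) v : E)) k hps
            (Y := fun _ => v) contDiffAt_const ?_
          · have h2 : k (k.symm p) = p := k.apply_symm_apply hp.1
            have h3 : k (k.toPartialEquiv.symm p) = p := h2
            rw [h3] at h1
            exact h1.contMDiffWithinAt
          · filter_upwards [k.open_source.mem_nhds hps] with y hy
            have : k.symm (k y) = y := k.symm_apply_apply hy
            change chartDeriv I p₀ (k.symm (k y)) v = chartDeriv I p₀ y v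
            rw [this]
        · have hps : k.symm p ∈ (chartParam I p₀).source := k.map_target hp.1
          have h1 := hp.2
          rw [mem_ofPred_eq, (hasFDerivAt_comp_chartParam hf hps).fderiv] at h1
          have h2 : k (k.symm p) = p := k.apply_symm_apply hp.1
          rw [← hk, h2] at h1
          exact h1
      · refine ⟨{p | f p ≠ 0}, (hf.continuous.continuousAt.eventually_ne hp₀), fun _ => (0 : E),
          ?_, fun p hp h => absurd h hp⟩
        exact (Bundle.contMDiff_zeroSection ℝ (TangentSpace I : M → Type u)).contMDiffOn)
  exact ⟨fun p => s p, s.contMDiff, fun p hp => hs p hp⟩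

end Transverse

section Average

open MeasureTheory

variable {E : Type u} [NormedAddCommGroup E] [NormedSpace ℝ E] [FiniteDimensional ℝ E]
  {H : Type*} [TopologicalSpace H] {I : ModelWithCorners ℝ E H} [I.Boundaryless]
  {M : Type*} [TopologicalSpace M] [ChartedSpace H M] [IsManifold I ∞ M]
  {T : Type*} [Group T] [MulAction T M]
  {B : Type*} [NormedAddCommGroup B] [NormedSpace ℝ B]

variable (I M) in
/-- An action that is smooth in the parameters of a local parametrization `q : B → T` of the
group. -/
structure IsSmoothParamAction (q : B → T) : Prop where
  surjective : Function.Surjective q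
  smooth : ContMDiff (𝓘(ℝ, B).prod I) I ∞ (fun x : B × M => q x.1 • x.2)

namespace IsSmoothParamAction

variable {q : B → T} (hq : IsSmoothParamAction I M q)

include hq

lemma contMDiff_smul (g : T) : ContMDiff I I ∞ (fun p : M => g • p) := by
  obtain ⟨b, rfl⟩ := hq.surjective g
  exact hq.smooth.comp (f := fun p : M => (b, p)) (contMDiff_const.prodMk contMDiff_id)

/-- The action of a group element, as a diffeomorphism. -/
def smulDiffeo (g : T) : PartialDiffeomorph I I M M ∞ where
  toFun p := g • p
  invFun p := g⁻¹ • p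
  source := univ
  target := univ
  map_source' := fun _ _ => mem_univ _
  map_target' := fun _ _ => mem_univ _
  left_inv' := fun p _ => inv_smul_smul g p
  right_inv' := fun p _ => smul_inv_smul g p
  open_source := isOpen_univ
  open_target := isOpen_univ
  contMDiffOn_toFun := (hq.contMDiff_smul g).contMDiffOn
  contMDiffOn_invFun := (hq.contMDiff_smul g⁻¹).contMDiffOn

lemma exists_equiv_smul (g : T) (p : M) :
    ∃ e : E ≃L[ℝ] E, (e : E →L[ℝ] E) = modelDeriv I I (fun p => g • p) p :=
  (hq.smulDiffeo g).isInvertible_mfderiv (x := p) (mem_univ _)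

lemma hasMFDerivAt_smul (g : T) (p : M) :
    HasMFDerivAt I I (fun p : M => g • p) p (modelDeriv (E := E) (E' := E) I I (fun p => g • p) p) :=
  ((hq.contMDiff_smul g).mdifferentiableAt (by simp)).hasMFDerivAt

lemma modelDeriv_mul (g h : T) (p : M) : modelDeriv I I (fun p : M => (g * h) • p) p
    = (modelDeriv I I (fun p => g • p) (h • p)).comp (modelDeriv I I (fun p => h • p) p) := by
  have h1 := (hq.hasMFDerivAt_smul g (h • p)).comp p (hq.hasMFDerivAt_smul h p)
  have h2 : ((fun p : M => g • p) ∘ fun p => h • p) = fun p => (g * h) • p :=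
    funext fun p => (mul_smul g h p).symm
  rw [h2] at h1
  exact h1.mfderiv

/-- The translate of a vector field by a group element. -/
def translate (V : M → E) (g : T) (p : M) : E :=
  (modelDeriv I I (fun p => g • p) p).inverse (V (g • p))

omit hq in
lemma translate_def (V : M → E) (g : T) (p : M) : translate (I := I) V g p
    = (modelDeriv I I (fun p => g • p) p).inverse (V (g • p)) := rfl

lemma modelDeriv_translate (V : M → E) (g : T) (p : M) :
    modelDeriv I I (fun p => g • p) p (translate (I := I) V g p) = V (g • p) := by
  obtain ⟨e, he⟩ := hq.exists_equiv_smul g p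
  rw [translate_def, ← he, ContinuousLinearMap.inverse_equiv]
  exact e.apply_symm_apply _

lemma translate_smul (V : M → E) (g h : T) (p : M) :
    translate (I := I) V g (h • p)
      = modelDeriv I I (fun p => h • p) p (translate (I := I) V (g * h) p) := by
  obtain ⟨e, he⟩ := hq.exists_equiv_smul g (h • p)
  apply e.injective
  change (e : E →L[ℝ] E) _ = (e : E →L[ℝ] E) _
  rw [he, hq.modelDeriv_translate]
  have := hq.modelDeriv_translate V (g * h) p
  rw [hq.modelDeriv_mul, ContinuousLinearMap.comp_apply] at this
  rw [this, mul_smul]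

/-- The translates of a smooth vector field, in a chart, depend smoothly on all parameters. -/
lemma contDiffAt_translate {V : M → E} (hV : IsSmoothField I V) {p₀ : M} {y : E}
    (hy : y ∈ (chartParam I p₀).source) (b : B) :
    ContDiffAt ℝ ∞ (fun x : B × E => (chartDeriv I p₀ x.2).inverse
      (translate (I := I) V (q x.1) (chartParam I p₀ x.2))) (b, y) := by
  have := FiniteDimensional.complete ℝ E
  set k := chartParam I p₀ with hk
  set p₁ := q b • k y with hp₁
  set k₁ := chartParam I p₁ with hk₁
  have hp₁t : p₁ ∈ k₁.target := mem_extChartAt_source p₁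
  have hact : ∀ x : B × E, x.2 ∈ k.source →
      ContMDiffAt 𝓘(ℝ, B × E) I ∞ (fun x : B × E => q x.1 • k x.2) x := by
    intro x hx
    have h1 : ContMDiffAt 𝓘(ℝ, B × E) I ∞ (fun x : B × E => k x.2) x :=
      ContMDiffAt.comp x (k.contMDiffAt hx) contDiff_snd.contMDiff.contMDiffAt
    exact ContMDiffAt.comp x (hq.smooth _) (contDiff_fst.contMDiff.contMDiffAt.prodMk h1)
  set α : B → E → E := fun b y => k₁.symm (q b • k y) with hα
  have hαs : ContDiffAt ℝ ∞ (fun x : B × E => α x.1 x.2) (b, y) :=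
    (ContMDiffAt.comp (b, y) (k₁.symm.contMDiffAt hp₁t) (hact (b, y) hy)).contDiffAt
  have hDα := contDiffAt_fderiv_param hαs
  set W : E → E := fun x => (VectorField.mpullback 𝓘(ℝ, E) I k₁ V x : E) with hW
  have hWs : ContDiffAt ℝ ∞ W (α b y) :=
    contDiffAt_param_of_vectorField k₁ (k₁.map_target hp₁t) (hV _)
  -- the derivative of the action in charts
  have key : ∀ x : B × E, x.2 ∈ k.source → q x.1 • k x.2 ∈ k₁.target →
      ∃ e : E ≃L[ℝ] E, (e : E →L[ℝ] E) = fderiv ℝ (α x.1) x.2 ∧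
        (chartDeriv I p₀ x.2).inverse (translate (I := I) V (q x.1) (k x.2))
          = e.symm (W (α x.1 x.2)) := by
    rintro ⟨b, y⟩ hy ht
    obtain ⟨e₀, he₀⟩ := exists_inverse_chartDeriv hy
    obtain ⟨e₁, he₁⟩ := hq.exists_equiv_smul (q b) (k y)
    obtain ⟨e₂, he₂⟩ : ∃ e : E ≃L[ℝ] E,
        (e : E →L[ℝ] E) = modelDeriv I 𝓘(ℝ, E) k₁.symm (q b • k y) :=
      k₁.symm.isInvertible_mfderiv (x := q b • k y) ht
    have hd : HasFDerivAt (α b) ((e₂ : E →L[ℝ] E).comp ((e₁ : E →L[ℝ] E).comp (e₀ : E →L[ℝ] E))) y := by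
      have d1 := (hq.hasMFDerivAt_smul (q b) (k y)).comp y (hasMFDerivAt_chartParam hy)
      have d2 := (k₁.symm.mdifferentiableAt' (x := q b • k y) ht).hasMFDerivAt.comp y d1
      rw [he₀, he₁]
      have d3 : HasFDerivAt (α b) _ y := hasMFDerivAt_iff_hasFDerivAt.1 d2
      rw [he₂]
      exact d3
    refine ⟨(e₀.trans e₁).trans e₂, ?_, ?_⟩
    · rw [hd.fderiv]; rfl
    · rw [← he₀, ContinuousLinearMap.inverse_equiv, translate_def, ← he₁,
        ContinuousLinearMap.inverse_equiv]
      change e₀.symm (e₁.symm (V (q b • k y))) = e₀.symm (e₁.symm (e₂.symm (W (α b y))))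
      congr 2
      apply e₂.injective
      rw [e₂.apply_symm_apply]
      have h1 : chartDeriv I p₁ (α b y) (W (α b y)) = V (k₁ (α b y)) :=
        mfderiv_mpullback V k₁ (k₁.map_target ht)
      have h2 : k₁ (α b y) = q b • k y := k₁.apply_symm_apply ht
      have h3 : modelDeriv I 𝓘(ℝ, E) k₁.symm (k₁ (α b y)) (chartDeriv I p₁ (α b y) (W (α b y)))
          = W (α b y) := k₁.mfderiv_symm_apply (k₁.map_target ht) _
      rw [h1, h2] at h3
      rw [← h3]
      exact DFunLike.congr_fun he₂ _
  have hcont : ContinuousAt (fun x : B × E => q x.1 • k x.2) (b, y) := (hact (b, y) hy).continuousAt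
  have hev : ∀ᶠ x : B × E in 𝓝 (b, y), x.2 ∈ k.source ∧ q x.1 • k x.2 ∈ k₁.target :=
    (continuousAt_snd.eventually (k.open_source.mem_nhds hy)).and
      (hcont.eventually (k₁.open_target.mem_nhds hp₁t))
  obtain ⟨e, he, -⟩ := key (b, y) hy hp₁t
  have hinv : ContDiffAt ℝ ∞ (fun x : B × E => (fderiv ℝ (α x.1) x.2).inverse) (b, y) := by
    refine ContDiffAt.comp (b, y) (g := ContinuousLinearMap.inverse) ?_ hDα
    change ContDiffAt ℝ ∞ ContinuousLinearMap.inverse (fderiv ℝ (α b) y)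
    rw [← he]
    exact contDiffAt_map_inverse e
  have hWc : ContDiffAt ℝ ∞ (fun x : B × E => W (α x.1 x.2)) (b, y) :=
    ContDiffAt.comp (b, y) (g := W) (f := fun x : B × E => α x.1 x.2) hWs hαs
  refine (hinv.clm_apply hWc).congr_of_eventuallyEq ?_
  filter_upwards [hev] with x hx
  obtain ⟨e, he, hval⟩ := key x hx.1 hx.2
  rw [hval, ← he, ContinuousLinearMap.inverse_equiv]
  rfl

variable [TopologicalSpace T] [IsTopologicalGroup T] [CompactSpace T] [MeasurableSpace T]
  [BorelSpace T] (μ : Measure T) [IsFiniteMeasureOnCompacts μ] [μ.IsMulRightInvariant]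
  [μ.IsOpenPosMeasure] (hq' : IsOpenQuotientMap q)

omit hq in
/-- The average of a vector field over the group. -/
def average (I : ModelWithCorners ℝ E H) (μ : Measure T) (V : M → E) (p : M) : E :=
  ∫ g, translate (I := I) V g p ∂μ

include hq' in
lemma contMDiff_average {V : M → E} (hV : IsSmoothField I V) :
    IsSmoothField I (average I μ V) := by
  have := FiniteDimensional.complete ℝ E
  intro p₀
  have hmem := mem_chartParam_source (I := I) p₀
  have h1 := contDiffOn_setIntegral_param (μ := μ) (K := univ) (q := q)
    (F := fun g y => (chartDeriv I p₀ y).inverse (translate (I := I) V g (chartParam I p₀ y)))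
    isCompact_univ MeasurableSet.univ hq' (chartParam I p₀).open_source
    (fun b _ y hy => hq.contDiffAt_translate hV hy b)
  rw [Measure.restrict_univ] at h1
  have h2 := contMDiffAt_vectorField_of_param (X := average I μ V) (chartParam I p₀) hmem
    (h1.contDiffAt ((chartParam I p₀).open_source.mem_nhds hmem)) ?_
  · rwa [chartParam_self] at h2
  · filter_upwards [(chartParam I p₀).open_source.mem_nhds hmem] with y hy
    obtain ⟨e, he⟩ := exists_inverse_chartDeriv hy
    change average I μ V (chartParam I p₀ y) = chartDeriv I p₀ y _
    simp only [← he, ContinuousLinearMap.inverse_equiv]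
    change _ = e (∫ g, e.symm _ ∂μ)
    rw [e.symm.integral_comp_comm, e.apply_symm_apply]
    rfl

lemma average_smul (V : M → E) (h : T) (p : M) :
    average I μ V (h • p) = modelDeriv I I (fun p => h • p) p (average I μ V p) := by
  obtain ⟨e, he⟩ := hq.exists_equiv_smul h p
  have h1 : average I μ V (h • p) = ∫ g, e (translate (I := I) V (g * h) p) ∂μ := by
    refine integral_congr_ae (Filter.Eventually.of_forall fun g => ?_)
    simp only
    rw [hq.translate_smul, ← he]
    rfl
  rw [h1, integral_mul_right_eq_self (fun g => e (translate (I := I) V g p)) h,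
    e.integral_comp_comm, ← he]
  rfl

include hq' in
lemma continuous_translate {V : M → E} (hV : IsSmoothField I V) (p : M) :
    Continuous (fun g : T => translate (I := I) V g p) := by
  have hmem := mem_chartParam_source (I := I) p
  obtain ⟨e, he⟩ := exists_inverse_chartDeriv hmem
  rw [continuous_iff_continuousAt]
  intro g
  obtain ⟨b, rfl⟩ := hq'.surjective g
  have h1 := continuousAt_uncurry_of_isOpenQuotientMap hq'
    (F := fun g y => (chartDeriv I p y).inverse (translate (I := I) V g (chartParam I p y)))
    (hq.contDiffAt_translate hV hmem b).continuousAt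
  have h2 := h1.comp (f := fun g : T => (g, extChartAt I p p)) (Continuous.prodMk_left _).continuousAt
  have h3 := (e : E →L[ℝ] E).continuous.continuousAt.comp h2
  refine h3.congr (Filter.Eventually.of_forall fun g => ?_)
  simp only [Function.comp]
  rw [chartParam_self, ← he, ContinuousLinearMap.inverse_equiv]
  exact e.apply_symm_apply _

include hq' in
lemma modelDeriv_average_pos {f : M → ℝ} (hf : ContMDiff I 𝓘(ℝ, ℝ) ∞ f)
    (hfg : ∀ (g : T) (p : M), f (g • p) = f p) {V : M → E} (hV : IsSmoothField I V)
    (hpos : ∀ p, f p = 0 → 0 < modelDeriv I 𝓘(ℝ, ℝ) f p (V p)) (p : M) (hp : f p = 0) :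
    0 < modelDeriv I 𝓘(ℝ, ℝ) f p (average I μ V p) := by
  have hc := hq.continuous_translate hq' hV p
  have hint : Integrable (fun g => translate (I := I) V g p) μ :=
    hc.integrable_of_hasCompactSupport (HasCompactSupport.of_compactSpace _)
  rw [average, ← ContinuousLinearMap.integral_comp_comm _ hint]
  have hval : ∀ g : T, 0 < modelDeriv I 𝓘(ℝ, ℝ) f p (translate (I := I) V g p) := by
    intro g
    have h1 : HasMFDerivAt I 𝓘(ℝ, ℝ) f (g • p) (modelDeriv (E' := ℝ) I 𝓘(ℝ, ℝ) f (g • p)) :=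
      (hf.mdifferentiableAt (by simp)).hasMFDerivAt
    have h2 := h1.comp p (hq.hasMFDerivAt_smul g p)
    have h3 : (f ∘ fun p => g • p) = f := funext fun p => hfg g p
    rw [h3] at h2
    have h4 : modelDeriv I 𝓘(ℝ, ℝ) f p = (modelDeriv I 𝓘(ℝ, ℝ) f (g • p)).comp
      (modelDeriv I I (fun p => g • p) p) := h2.mfderiv
    rw [h4, ContinuousLinearMap.comp_apply, hq.modelDeriv_translate]
    exact hpos _ (by rw [hfg, hp])
  have hc' : Continuous (fun g : T => modelDeriv I 𝓘(ℝ, ℝ) f p (translate (I := I) V g p)) :=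
    (modelDeriv I 𝓘(ℝ, ℝ) f p).continuous.comp hc
  rw [integral_pos_iff_support_of_nonneg (fun g => (hval g).le)
    (hc'.integrable_of_hasCompactSupport (HasCompactSupport.of_compactSpace _))]
  have : Function.support (fun g : T => modelDeriv I 𝓘(ℝ, ℝ) f p (translate (I := I) V g p)) = univ :=
    eq_univ_of_forall fun g => (hval g).ne'
  rw [this]
  exact isOpen_univ.measure_pos μ univ_nonempty

end IsSmoothParamAction

end Average

/-! ### Tubular neighbourhoods of a regular level -/

section TransverseFlow

variable {E : Type u} [NormedAddCommGroup E] [NormedSpace ℝ E] [FiniteDimensional ℝ E]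
  {H : Type*} [TopologicalSpace H] {I : ModelWithCorners ℝ E H} [I.Boundaryless]
  {M : Type*} [TopologicalSpace M] [ChartedSpace H M] [IsManifold I ∞ M]
  {f : M → ℝ}

/-- A flow that moves the levels of `f` at unit speed near `f = 0`. -/
structure IsLevelFlow (I : ModelWithCorners ℝ E H) (f : M → ℝ) (ε : ℝ) (φ : ℝ → M → M) : Prop where
  pos : 0 < ε
  zero : ∀ p, φ 0 p = p
  add : ∀ s t p, φ (s + t) p = φ s (φ t p)
  smooth : ContMDiff (𝓘(ℝ, ℝ).prod I) I ∞ (fun x : ℝ × M => φ x.1 x.2)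
  level : ∀ s p, |f p| < ε → |f p + s| < ε → f (φ s p) = f p + s

lemma exists_smooth_cutoff_inv [CompactSpace M] {w : M → ℝ} (hf : ContMDiff I 𝓘(ℝ, ℝ) ∞ f)
    (hw : ContMDiff I 𝓘(ℝ, ℝ) ∞ w) (hpos : ∀ p, f p = 0 → 0 < w p) :
    ∃ ε > 0, ∃ χ : ContDiffBump (0 : ℝ), χ.rIn = ε ∧
      ContMDiff I 𝓘(ℝ, ℝ) ∞ (fun p => χ (f p) / w p) ∧ ∀ p, χ (f p) / w p * w p = χ (f p) := by
  have hK : IsCompact {p | w p ≤ 0} := (isClosed_le hw.continuous continuous_const).isCompact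
  obtain ⟨ε, hε, hεK⟩ : ∃ ε > 0, ∀ p, |f p| < ε → 0 < w p := by
    rcases {p | w p ≤ 0}.eq_empty_or_nonempty with he | hne
    · exact ⟨1, one_pos, fun p _ => not_le.1 fun hp => (he ▸ hp : p ∈ (∅ : Set M))⟩
    · obtain ⟨p₀, hp₀, hmin⟩ := hK.exists_isMinOn hne
        (hf.continuous.abs.continuousOn : ContinuousOn (fun p => |f p|) _)
      refine ⟨|f p₀|, abs_pos.2 fun h => (hpos p₀ h).not_ge hp₀, fun p hp => not_le.1 fun hwp => ?_⟩
      exact hp.not_ge (hmin hwp)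
  let χ : ContDiffBump (0 : ℝ) := ⟨ε / 4, ε / 2, by linarith, by linarith⟩
  have hχ0 : ∀ t, ε / 2 ≤ |t| → χ t = 0 := fun s hs => χ.zero_of_le_dist (by
    rw [Real.dist_eq, sub_zero]; exact hs)
  refine ⟨ε / 4, by linarith, χ, rfl, fun p => ?_, fun p => ?_⟩
  · by_cases hp : |f p| < ε
    · exact ContMDiffAt.div₀ (χ.contDiff.contMDiff.contMDiffAt.comp p (hf p)) (hw p) (hεK p hp).ne'
    · refine (contMDiffAt_const (c := (0 : ℝ))).congr_of_eventuallyEq ?_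
      have hev : ∀ᶠ p in 𝓝 p, ε / 2 < |f p| :=
        hf.continuous.abs.continuousAt.eventually (lt_mem_nhds (by linarith [not_lt.1 hp]))
      filter_upwards [hev] with p' hp'
      rw [hχ0 _ hp'.le, zero_div]
  · by_cases hp : |f p| < ε
    · exact div_mul_cancel₀ _ (hεK p hp).ne'
    · rw [hχ0 _ (by linarith [not_lt.1 hp]), zero_div, zero_mul]

lemma modelDeriv_comp_eq {h : M → M} (hf : ContMDiff I 𝓘(ℝ, ℝ) ∞ f) (hh : ContMDiff I I ∞ h)
    (hfh : ∀ p, f (h p) = f p) (p : M) :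
    modelDeriv I 𝓘(ℝ, ℝ) f p = (modelDeriv I 𝓘(ℝ, ℝ) f (h p)).comp (modelDeriv I I h p) := by
  have h1 : HasMFDerivAt I 𝓘(ℝ, ℝ) f (h p) (modelDeriv (E' := ℝ) I 𝓘(ℝ, ℝ) f (h p)) :=
    (hf.mdifferentiableAt (by simp)).hasMFDerivAt
  have h0 : HasMFDerivAt I I h p (modelDeriv (E := E) (E' := E) I I h p) :=
    (hh.mdifferentiableAt (by simp)).hasMFDerivAt
  have h2 := h1.comp p h0
  have h3 : (f ∘ h) = f := funext hfh
  rw [h3] at h2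
  exact h2.mfderiv

/-- A vector field transverse to a regular level can be normalised to give a level flow. The flow
commutes with all the symmetries of the function and of the vector field. -/
theorem exists_isLevelFlow [T2Space M] [CompactSpace M] (hf : ContMDiff I 𝓘(ℝ, ℝ) ∞ f) {V : M → E}
    (hV : IsSmoothField I V) (hpos : ∀ p, f p = 0 → 0 < modelDeriv I 𝓘(ℝ, ℝ) f p (V p)) :
    ∃ ε φ, IsLevelFlow I f ε φ ∧ ∀ h : M → M, ContMDiff I I ∞ h → (∀ p, f (h p) = f p) →
      (∀ p, V (h p) = modelDeriv I I h p (V p)) → ∀ s p, φ s (h p) = h (φ s p) := by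
  have := FiniteDimensional.complete ℝ E
  obtain ⟨ε, hε, χ, hχ, hu, huw⟩ := exists_smooth_cutoff_inv hf (contMDiff_modelDeriv_apply hf hV)
    hpos
  set u : M → ℝ := fun p => χ (f p) / modelDeriv I 𝓘(ℝ, ℝ) f p (V p) with hu_def
  have hW : IsSmoothField I (fun p => u p • V p) := hV.smul hu
  obtain ⟨φ, h1, h2, h3, h4⟩ := exists_smooth_flow (I := I) hW isCompact_univ
    (fun p hp => absurd (mem_univ p) hp)
  refine ⟨ε, φ, ⟨hε, h1, h3, h4, fun s p hp hs => ?_⟩, fun h hh hfh hVh s p => ?_⟩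
  · have hd : ∀ s, HasDerivAt (fun s => f (φ s p)) (χ (f (φ s p))) s := by
      intro s
      have d1 : HasMFDerivAt I 𝓘(ℝ, ℝ) f (φ s p) (modelDeriv (E' := ℝ) I 𝓘(ℝ, ℝ) f (φ s p)) :=
        (hf.mdifferentiableAt (by simp)).hasMFDerivAt
      have d2 : HasFDerivAt (fun s => f (φ s p))
        ((modelDeriv I 𝓘(ℝ, ℝ) f (φ s p)).comp
          ((1 : ℝ →L[ℝ] ℝ).smulRight (u (φ s p) • V (φ s p)))) s :=
        hasMFDerivAt_iff_hasFDerivAt.1 (d1.comp s (h2 p s))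
      refine d2.hasDerivAt.congr_deriv ?_
      change modelDeriv I 𝓘(ℝ, ℝ) f (φ s p) ((1 : ℝ) • (u (φ s p) • V (φ s p))) = _
      rw [one_smul, map_smul]
      exact huw _
    obtain ⟨K, hK⟩ := (χ.contDiff (n := 1)).lipschitzWith_of_hasCompactSupport χ.hasCompactSupport
      (by simp)
    rw [abs_lt] at hp hs
    have := ODE_solution_unique_of_mem_Ioo (v := fun _ => χ) (s := fun _ => univ) (K := K)
      (a := -ε - f p) (b := ε - f p) (t₀ := 0) (f := fun s => f (φ s p)) (g := fun s => f p + s)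
      (fun t _ => hK.lipschitzOnWith) ⟨by linarith, by linarith⟩
      (fun t _ => ⟨hd t, mem_univ _⟩) (fun t ht => ⟨?_, mem_univ _⟩) (by simp [h1])
    · exact this ⟨by linarith, by linarith⟩
    · rw [χ.one_of_mem_closedBall (by
        rw [mem_closedBall_zero_iff, hχ]
        exact abs_le.2 ⟨by linarith [ht.1], by linarith [ht.2]⟩)]
      exact (hasDerivAt_id t).const_add (f p)
  · have hWh : ∀ p, u (h p) • V (h p) = modelDeriv I I h p (u p • V p) := by
      intro p
      have : u (h p) = u p := by
        simp only [hu_def]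
        rw [hfh, modelDeriv_comp_eq hf hh hfh p, ContinuousLinearMap.comp_apply, hVh]
      rw [this, hVh, map_smul]
    have hc : IsMIntegralCurve (I := I) (fun s => h (φ s p)) (fun p => (u p • V p : E)) := by
      intro s
      have d0 : HasMFDerivAt I I h (φ s p) (modelDeriv (E := E) (E' := E) I I h (φ s p)) :=
        (hh.mdifferentiableAt (by simp)).hasMFDerivAt
      have d1 := d0.comp s (h2 p s)
      have d2 : ((1 : ℝ →L[ℝ] ℝ).smulRight (u (h (φ s p)) • V (h (φ s p)) : E))
          = (modelDeriv I I h (φ s p)).comp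
            ((1 : ℝ →L[ℝ] ℝ).smulRight (u (φ s p) • V (φ s p) : E)) := by
        refine ContinuousLinearMap.ext_ring ?_
        change (1 : ℝ) • (u (h (φ s p)) • V (h (φ s p)) : E)
          = modelDeriv I I h (φ s p) ((1 : ℝ) • (u (φ s p) • V (φ s p)))
        rw [one_smul, one_smul]
        exact hWh _
      exact (congrArg (HasMFDerivAt 𝓘(ℝ, ℝ) I (fun s => h (φ s p)) s) d2).mpr d1
    have hW1 : ContMDiff I I.tangent 1 (fun p => (⟨p, (u p • V p : E)⟩ : TangentBundle I M)) :=
      ContMDiff.of_le hW (by exact_mod_cast le_top)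
    have := isMIntegralCurve_Ioo_eq_of_contMDiff_boundaryless (t₀ := 0) hW1 (h2 (h p)) hc
      (by simp [h1])
    exact congrFun this s

end TransverseFlow

section Tube

variable {E : Type u} [NormedAddCommGroup E] [NormedSpace ℝ E] [FiniteDimensional ℝ E]
  {H : Type*} [TopologicalSpace H] {I : ModelWithCorners ℝ E H} [I.Boundaryless]
  {M : Type*} [TopologicalSpace M] [ChartedSpace H M] [IsManifold I ∞ M]
  {F : Type*} [NormedAddCommGroup F] [NormedSpace ℝ F] {G : Type*} [TopologicalSpace G]
  {J : ModelWithCorners ℝ F G}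
  {Z : Type*} [TopologicalSpace Z] [ChartedSpace G Z] [IsManifold J ∞ Z]
  {f : M → ℝ} {ε : ℝ} {φ : ℝ → M → M} {ι : Z → M}

/-- The tubular neighbourhood of a regular level given by a level flow. -/
theorem IsLevelFlow.exists_tube [Nonempty Z] (hφ : IsLevelFlow I f ε φ)
    (hf : ContMDiff I 𝓘(ℝ, ℝ) ∞ f) (hι : Manifold.IsSmoothEmbedding J I ∞ ι)
    (hr : range ι = {p | f p = 0}) :
    ∃ tube : PartialDiffeomorph I (𝓘(ℝ, ℝ).prod J) M (ℝ × Z) ∞,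
      tube.source = {p | |f p| < ε} ∧ tube.target = Ioo (-ε) ε ×ˢ univ ∧
      (∀ p, (tube p).1 = f p) ∧ (∀ t z, tube.symm (t, z) = φ t (ι z)) := by
  classical
  have hfι : ∀ z, f (ι z) = 0 := fun z => (hr ▸ mem_range_self z : ι z ∈ {p | f p = 0})
  have hinj : Function.Injective ι := hι.isEmbedding.injective
  have hex : ∀ p, |f p| < ε → ∃ z, ι z = φ (-f p) p := by
    intro p hp
    have : φ (-f p) p ∈ range ι := by
      rw [hr]
      have := hφ.level (-f p) p hp (by rw [add_neg_cancel, abs_zero]; exact hφ.pos)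
      rw [add_neg_cancel] at this
      exact this
    exact this
  let ζ : M → Z := fun p => if h : |f p| < ε then (hex p h).choose else Classical.arbitrary Z
  have hζ : ∀ p, |f p| < ε → ι (ζ p) = φ (-f p) p := by
    intro p hp
    simp only [ζ, dif_pos hp]
    exact (hex p hp).choose_spec
  have hopen : IsOpen {p | |f p| < ε} := isOpen_lt hf.continuous.abs continuous_const
  have hret : ContMDiff I I ∞ (fun p => φ (-f p) p) :=
    hφ.smooth.comp (f := fun p => (-f p, p))
      (((contDiff_neg (𝕜 := ℝ) (F := ℝ)).contMDiff.comp hf).prodMk contMDiff_id)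
  have hζs : ContMDiffOn I J ∞ ζ {p | |f p| < ε} := by
    intro p hp
    have hev : (ι ∘ ζ) =ᶠ[𝓝 p] fun p => φ (-f p) p := by
      filter_upwards [hopen.mem_nhds hp] with q hq using hζ q hq
    have hs : ContMDiffAt I I ∞ (ι ∘ ζ) p := (hret p).congr_of_eventuallyEq hev
    refine (ContMDiffAt.contMDiffWithinAt ?_)
    rw [ContMDiffAt.iff_comp_isImmersionAt (hι.isImmersion.isImmersionAt (ζ p))]
    exact ⟨hι.isEmbedding.isInducing.continuousAt_iff.2 hs.continuousAt, hs⟩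
  have hlev : ∀ t z, |t| < ε → f (φ t (ι z)) = t := by
    intro t z ht
    have := hφ.level t (ι z) (by rw [hfι, abs_zero]; exact hφ.pos) (by rwa [hfι, zero_add])
    rwa [hfι, zero_add] at this
  refine ⟨{ toFun := fun p => (f p, ζ p)
            invFun := fun x => φ x.1 (ι x.2)
            source := {p | |f p| < ε}
            target := Ioo (-ε) ε ×ˢ univ
            map_source' := fun p hp => ⟨abs_lt.1 hp, mem_univ _⟩
            map_target' := fun x hx => ?_
            left_inv' := fun p hp => ?_
            right_inv' := fun x hx => ?_
            open_source := hopen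
            open_target := isOpen_Ioo.prod isOpen_univ
            contMDiffOn_toFun := hf.contMDiffOn.prodMk hζs
            contMDiffOn_invFun := ?_ }, rfl, rfl, fun p => rfl, fun t z => rfl⟩
  · change |f (φ x.1 (ι x.2))| < ε
    rw [hlev _ _ (abs_lt.2 hx.1)]
    exact abs_lt.2 hx.1
  · change φ (f p) (ι (ζ p)) = p
    rw [hζ p hp, ← hφ.add, add_neg_cancel, hφ.zero]
  · have h1 := hlev x.1 x.2 (abs_lt.2 hx.1)
    refine Prod.ext h1 (hinj ?_)
    change ι (ζ (φ x.1 (ι x.2))) = ι x.2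
    rw [hζ _ (by rw [h1]; exact abs_lt.2 hx.1), h1, ← hφ.add, neg_add_cancel, hφ.zero]
  · exact (hφ.smooth.comp (f := fun x : ℝ × Z => (x.1, ι x.2))
      (contMDiff_fst.prodMk (hι.contMDiff.comp contMDiff_snd))).contMDiffOn

end Tube

/-! ### Torus actions -/

section TorusAction

variable {k : ℕ}

/-- The universal covering of the torus. -/
def torusExp (k : ℕ) (θ : Fin k → ℝ) : Torus k := fun i => Circle.exp (θ i)

lemma isOpenQuotientMap_torusExp : IsOpenQuotientMap (torusExp k) := by
  have h1 : IsOpenQuotientMap Circle.exp :=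
    ⟨Circle.exp_surjective, Circle.exp.continuous, isLocalHomeomorph_circleExp.isOpenMap⟩
  exact IsOpenQuotientMap.piMap fun _ => h1

lemma contMDiff_torusExp : ContMDiff 𝓘(ℝ, Fin k → ℝ) (ModelWithCorners.pi (fun _ : Fin k => 𝓡 1)) ∞
    (torusExp k) := by
  intro θ
  rw [contMDiffAt_iff]
  refine ⟨isOpenQuotientMap_torusExp.continuous.continuousAt, ?_⟩
  refine contDiffWithinAt_pi.2 fun i => ?_
  have h1 : ContMDiffAt 𝓘(ℝ, ℝ) (𝓡 1) ∞ Circle.exp (θ i) := contMDiff_circleExp.contMDiffAt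
  have h2 := (contMDiffAt_iff.1 h1).2
  exact h2.comp (f := fun θ : Fin k → ℝ => θ i) θ (contDiff_apply ℝ ℝ i).contDiffWithinAt
    (fun _ _ => by simp)

lemma IsSmoothTorusAction.isSmoothParamAction {n : ℕ} {M : Type*} [TopologicalSpace M]
    [ChartedSpace (EuclideanSpace ℝ (Fin n)) M] [MulAction (Torus k) M]
    (h : IsSmoothTorusAction n k M) : IsSmoothParamAction (𝓡 n) M (torusExp k) where
  surjective := isOpenQuotientMap_torusExp.surjective
  smooth := h.comp (f := fun x : (Fin k → ℝ) × M => (torusExp k x.1, x.2))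
    ((contMDiff_torusExp.comp contMDiff_fst).prodMk contMDiff_snd)

variable {d : ℕ} {M : Type*} [TopologicalSpace M] [ChartedSpace (EuclideanSpace ℝ (Fin (d + 1))) M]
  [IsManifold (𝓡 (d + 1)) ∞ M]
  {Z : Type*} [TopologicalSpace Z] [ChartedSpace (EuclideanSpace ℝ (Fin d)) Z]
  [IsManifold (𝓡 d) ∞ Z] {ι : Z → M} {f : M → ℝ}

/-- The tubular neighbourhood theorem for the zero set of an invariant function. -/
theorem IsTransverseZero.exists_equivariant_tube [T2Space M] [CompactSpace M] [Nonempty Z]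
    [MulAction (Torus k) M] [MulAction (Torus k) Z] (hf : IsTransverseZero d ι f)
    (hT : IsSmoothTorusAction (d + 1) k M) (hι : ∀ (g : Torus k) (z : Z), ι (g • z) = g • ι z)
    (hfT : ∀ (g : Torus k) (p : M), f (g • p) = f p) :
    ∃ ε > 0, ∃ tube : PartialDiffeomorph (𝓡 (d + 1)) (𝓘(ℝ, ℝ).prod (𝓡 d)) M (ℝ × Z) ∞,
      tube.source = {p | |f p| < ε} ∧ tube.target = Ioo (-ε) ε ×ˢ univ ∧
      (∀ p, (tube p).1 = f p) ∧ (∀ z, tube (ι z) = (0, z)) ∧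
      ∀ (g : Torus k) (p : M), |f p| < ε → tube (g • p) = ((tube p).1, g • (tube p).2) := by
  have hq := hT.isSmoothParamAction
  have hreg : ∀ p, f p = 0 → modelDeriv (𝓡 (d + 1)) 𝓘(ℝ, ℝ) f p ≠ 0 := by
    intro p hp
    have : p ∈ range ι := hf.range_eq ▸ hp
    obtain ⟨z, rfl⟩ := this
    exact hf.transverse z
  obtain ⟨V₀, hV₀, hpos₀⟩ := exists_transverse_field hf.smooth hreg
  let _ : MeasurableSpace (Torus k) := borel _
  have : BorelSpace (Torus k) := ⟨rfl⟩
  let μ : MeasureTheory.Measure (Torus k) := MeasureTheory.Measure.haar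
  have hV := hq.contMDiff_average μ isOpenQuotientMap_torusExp hV₀
  obtain ⟨ε, φ, hφ, hsymm⟩ := exists_isLevelFlow hf.smooth hV
    (hq.modelDeriv_average_pos μ isOpenQuotientMap_torusExp hf.smooth hfT hV₀ hpos₀)
  have hequiv : ∀ (g : Torus k) s p, φ s (g • p) = g • φ s p := fun g =>
    hsymm _ (hq.contMDiff_smul g) (hfT g) (fun p => hq.average_smul μ V₀ g p)
  obtain ⟨tube, hs, ht, h1, h2⟩ := hφ.exists_tube hf.smooth hf.embedding hf.range_eq
  have hmem : ∀ t z, |t| < ε → (t, z) ∈ tube.target := fun t z h => by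
    rw [ht]; exact ⟨abs_lt.1 h, mem_univ _⟩
  refine ⟨ε, hφ.pos, tube, hs, ht, h1, fun z => ?_, fun g p hp => ?_⟩
  · have h3 := tube.apply_symm_apply (hmem 0 z (by rw [abs_zero]; exact hφ.pos))
    rwa [h2, hφ.zero] at h3
  · have hps : p ∈ tube.source := by rw [hs]; exact hp
    have h3 := tube.symm_apply_apply hps
    obtain ⟨t, z, htz⟩ : ∃ t z, tube p = (t, z) := ⟨_, _, rfl⟩
    have ht' : |t| < ε := by
      have := h1 p
      rw [htz] at this
      change t = f p at this
      rwa [this]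
    rw [htz, h2] at h3
    rw [htz, ← h3, ← hequiv, ← hι, ← h2, tube.apply_symm_apply (hmem t _ ht')]

lemma IsTransverseZero.t2Space [T2Space M] (hf : IsTransverseZero d ι f) : T2Space Z :=
  hf.embedding.isEmbedding.t2Space

lemma IsTransverseZero.compactSpace [CompactSpace M] (hf : IsTransverseZero d ι f) :
    CompactSpace Z := by
  have : Topology.IsClosedEmbedding ι := ⟨hf.embedding.isEmbedding, by
    rw [hf.range_eq]; exact isClosed_eq hf.smooth.continuous continuous_const⟩
  exact this.compactSpace

end TorusAction

/-! ### Forms in adapted frames -/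

section Alternating

variable {X V : Type*} [NormedAddCommGroup X] [NormedSpace ℝ X] [NormedAddCommGroup V]
  [NormedSpace ℝ V]

/-- A map to alternating maps is smooth if all its values are. -/
lemma contDiffOn_alternatingMap [FiniteDimensional ℝ V] {k : ℕ} {F : X → V [⋀^Fin k]→L[ℝ] ℝ}
    {s : Set X} {n : WithTop ℕ∞} (h : ∀ v, ContDiffOn ℝ n (fun x => F x v) s) :
    ContDiffOn ℝ n F s := by
  let e := Module.finBasis ℝ V
  refine contDiffOn_of_injective_comp
    (L := fun (i : Fin k → Fin (Module.finrank ℝ V)) =>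
      { toFun := fun G : V [⋀^Fin k]→L[ℝ] ℝ => G fun j => e (i j)
        map_add' := fun _ _ => rfl
        map_smul' := fun _ _ => rfl }) (fun G hG => ?_) fun i => h _
  refine ContinuousAlternatingMap.toContinuousMultilinearMap_injective
    (ContinuousMultilinearMap.toMultilinearMap_injective ?_)
  exact Module.Basis.ext_multilinear (fun _ => e) fun v => hG v

/-- The bilinear form of an alternating form of degree two. -/
def altBilin (W : V [⋀^Fin 2]→L[ℝ] ℝ) : V →L[ℝ] V →L[ℝ] ℝ :=
  ((ContinuousAlternatingMap.ofSubsingletonLIE (𝕜 := ℝ) (E := V) (F := ℝ) (0 : Fin 1)).symm.toContinuousLinearEquiv :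
    (V [⋀^Fin 1]→L[ℝ] ℝ) →L[ℝ] V →L[ℝ] ℝ).comp W.curryLeft

lemma altBilin_apply (W : V [⋀^Fin 2]→L[ℝ] ℝ) (u w : V) : altBilin W u w = W ![u, w] := by
  change W (Fin.cons u fun _ => w) = _
  congr 1
  ext i
  fin_cases i <;> rfl

end Alternating

section AdaptedFrame

variable {n : ℕ} {M : Type*} [TopologicalSpace M] [ChartedSpace (EuclideanSpace ℝ (Fin n)) M]
  [IsManifold (𝓡 n) ∞ M] {f : M → ℝ} {m : ℕ}
  {F : Type*} [NormedAddCommGroup F] [NormedSpace ℝ F] [FiniteDimensional ℝ F]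
  {G : Type*} [TopologicalSpace G] {J : ModelWithCorners ℝ (ℝ × F) G}
  {P : Type*} [TopologicalSpace P] [ChartedSpace G P]

/-- The frame of the `bᵐ`-tangent bundle given by a parametrization in which `f` is the first
coordinate. -/
def bmFrame (J : ModelWithCorners ℝ (ℝ × F) G) (f : M → ℝ) (m : ℕ) (Φ : P → M) (x : P) :
    ℝ × F →L[ℝ] EuclideanSpace ℝ (Fin n) × ℝ :=
  ((modelDeriv J (𝓡 n) Φ x).comp ((f (Φ x) ^ m • ContinuousLinearMap.fst ℝ ℝ F).prod
    (ContinuousLinearMap.snd ℝ ℝ F))).prod (ContinuousLinearMap.fst ℝ ℝ F)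

lemma bmFrame_apply (Φ : P → M) (x : P) (u : ℝ × F) : bmFrame J f m Φ x u
    = (modelDeriv J (𝓡 n) Φ x (f (Φ x) ^ m * u.1, u.2), u.1) := rfl

variable (n) in
/-- The parametrization `Φ` has `f` as its first coordinate, at the point `x`. -/
def IsAdaptedAt (J : ModelWithCorners ℝ (ℝ × F) G) (f : M → ℝ) (Φ : P → M) (x : P) : Prop :=
  ∀ u : ℝ × F, modelDeriv (𝓡 n) 𝓘(ℝ, ℝ) f (Φ x) (modelDeriv J (𝓡 n) Φ x u) = u.1

lemma IsAdaptedAt.mem {Φ : P → M} {x : P} (h : IsAdaptedAt n J f Φ x) (u : ℝ × F) :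
    (bmFrame J f m Φ x u : TangentSpace (𝓡 n) (Φ x) × ℝ) ∈ bmTangent f m (Φ x) := by
  change modelDeriv (𝓡 n) 𝓘(ℝ, ℝ) f (Φ x) (modelDeriv J (𝓡 n) Φ x (f (Φ x) ^ m * u.1, u.2))
    = u.1 * f (Φ x) ^ m
  rw [h, mul_comm]

/-- The frame as a map to the fibre of the `bᵐ`-tangent bundle. -/
def bmFrameL {Φ : P → M} {x : P} (h : IsAdaptedAt n J f Φ x) (m : ℕ) :
    ℝ × F →L[ℝ] bmTangent (n := n) f m (Φ x) :=
  ContinuousLinearMap.codRestrict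
    (bmFrame J f m Φ x : ℝ × F →L[ℝ] TangentSpace (𝓡 n) (Φ x) × ℝ) (bmTangent f m (Φ x)) h.mem

variable (J) in
open Classical in
/-- The coefficients of a `bᵐ`-form in an adapted frame. -/
def frameCoeff (Ω : BmTwoForm n f m) (Φ : P → M) (x : P) : (ℝ × F) [⋀^Fin 2]→L[ℝ] ℝ :=
  if h : IsAdaptedAt n J f Φ x then (Ω (Φ x)).compContinuousLinearMap (bmFrameL h m) else 0

variable {Ω : BmTwoForm n f m} {Φ : P → M} {x : P}

lemma IsAdaptedAt.frameCoeff_apply (h : IsAdaptedAt n J f Φ x) (v : Fin 2 → ℝ × F) :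
    frameCoeff J Ω Φ x v = Ω (Φ x) fun i => bmFrameL h m (v i) := by
  rw [frameCoeff, dif_pos h]
  rfl

lemma IsAdaptedAt.frameCoeff_apply₂ (h : IsAdaptedAt n J f Φ x) (u w : ℝ × F) :
    frameCoeff J Ω Φ x ![u, w] = Ω (Φ x) ![bmFrameL h m u, bmFrameL h m w] := by
  rw [h.frameCoeff_apply]
  congr 1
  ext i : 1
  fin_cases i <;> rfl

lemma bmLift_apply {p : M} (hp : f p ≠ 0) (v : TangentSpace (𝓡 n) p) :
    (bmLift f m p v : TangentSpace (𝓡 n) p × ℝ) = (v, (f p ^ m)⁻¹ * differential f p v) := by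
  rw [bmLift, dif_pos hp]
  rfl

lemma IsAdaptedAt.restrict_apply (h : IsAdaptedAt n J f Φ x) (hx : f (Φ x) ≠ 0) (u w : ℝ × F) :
    Ω.restrict (Φ x) ![modelDeriv J (𝓡 n) Φ x u, modelDeriv J (𝓡 n) Φ x w]
      = frameCoeff J Ω Φ x ![((f (Φ x) ^ m)⁻¹ * u.1, u.2), ((f (Φ x) ^ m)⁻¹ * w.1, w.2)] := by
  have key : ∀ u : ℝ × F, bmLift f m (Φ x) (modelDeriv J (𝓡 n) Φ x u)
      = bmFrameL h m ((f (Φ x) ^ m)⁻¹ * u.1, u.2) := by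
    intro u
    refine Subtype.ext ?_
    refine (bmLift_apply (m := m) hx (modelDeriv J (𝓡 n) Φ x u : EuclideanSpace ℝ (Fin n))).trans ?_
    change (modelDeriv J (𝓡 n) Φ x u, (f (Φ x) ^ m)⁻¹ * modelDeriv (𝓡 n) 𝓘(ℝ, ℝ) f (Φ x)
      (modelDeriv J (𝓡 n) Φ x u)) = bmFrame J f m Φ x ((f (Φ x) ^ m)⁻¹ * u.1, u.2)
    rw [bmFrame_apply, h, mul_inv_cancel_left₀ (pow_ne_zero m hx)]
  rw [h.frameCoeff_apply₂, ← key, ← key]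
  change Ω (Φ x) _ = _
  congr 1
  ext i : 1
  fin_cases i <;> rfl

/-- Change of the parametrization of a level. -/
lemma frameCoeff_comp {G' : Type*} [TopologicalSpace G'] {J' : ModelWithCorners ℝ (ℝ × F) G'}
    {P' : Type*} [TopologicalSpace P'] [ChartedSpace G' P'] {K : P' → P} {x : P'} {D : F →L[ℝ] F}
    (h : IsAdaptedAt n J f Φ (K x))
    (hD : modelDeriv J' (𝓡 n) (fun x => Φ (K x)) x = (modelDeriv J (𝓡 n) Φ (K x)).comp
      ((ContinuousLinearMap.fst ℝ ℝ F).prod (D.comp (ContinuousLinearMap.snd ℝ ℝ F))))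
    (u w : ℝ × F) :
    frameCoeff J' Ω (fun x => Φ (K x)) x ![u, w]
      = frameCoeff J Ω Φ (K x) ![(u.1, D u.2), (w.1, D w.2)] := by
  have h' : IsAdaptedAt n J' f (fun x => Φ (K x)) x := by
    intro u
    rw [hD]
    exact h _
  rw [h.frameCoeff_apply₂, h'.frameCoeff_apply₂]
  have key : ∀ u : ℝ × F, bmFrameL h' m u = bmFrameL h m (u.1, D u.2) := by
    intro u
    refine Subtype.ext ?_
    change bmFrame J' f m (fun x => Φ (K x)) x u = bmFrame J f m Φ (K x) (u.1, D u.2)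
    rw [bmFrame_apply, bmFrame_apply, hD]
    rfl
  rw [key, key]

end AdaptedFrame

section AdaptedSmooth

variable {n : ℕ} {M : Type*} [TopologicalSpace M] [ChartedSpace (EuclideanSpace ℝ (Fin n)) M]
  [IsManifold (𝓡 n) ∞ M] {f : M → ℝ} {m : ℕ} [T2Space M]
  {F : Type*} [NormedAddCommGroup F] [NormedSpace ℝ F] [FiniteDimensional ℝ F]
  {Φ : PartialDiffeomorph 𝓘(ℝ, ℝ × F) (𝓡 n) (ℝ × F) M ∞} {Ω : BmTwoForm n f m}

/-- The local frames of the `bᵐ`-tangent bundle extend to sections. -/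
lemma exists_bmVectorField (hf : ContMDiff (𝓡 n) 𝓘(ℝ, ℝ) ∞ f)
    (hΦ : ∀ x ∈ Φ.source, IsAdaptedAt n 𝓘(ℝ, ℝ × F) f Φ x) {x₀ : ℝ × F} (hx₀ : x₀ ∈ Φ.source)
    (u : ℝ × F) : ∃ V : BmVectorField (n := n) f m, ∀ᶠ x in 𝓝 x₀,
      (V.X (Φ x), V.a (Φ x)) = bmFrame 𝓘(ℝ, ℝ × F) f m Φ x u := by
  have := FiniteDimensional.complete ℝ F
  have hp₀ : Φ x₀ ∈ Φ.target := Φ.map_source hx₀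
  obtain ⟨ρ, -, hρ⟩ := (SmoothBumpFunction.nhds_basis_tsupport (I := 𝓡 n) (Φ x₀)).mem_iff.1
    (Φ.open_target.mem_nhds hp₀)
  let X : M → EuclideanSpace ℝ (Fin n) := fun p =>
    ρ p • modelDeriv 𝓘(ℝ, ℝ × F) (𝓡 n) Φ (Φ.symm p) (f p ^ m * u.1, u.2)
  have hoff : ∀ p ∉ Φ.target, ρ p = 0 := fun p hp =>
    image_eq_zero_of_notMem_tsupport fun h => hp (hρ h)
  refine ⟨⟨X, fun p => ρ p * u.1, fun p => ?_, ρ.contMDiff.mul contMDiff_const, fun p => ?_⟩, ?_⟩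
  · by_cases hp : p ∈ Φ.target
    · have hps : Φ.symm p ∈ Φ.source := Φ.map_target hp
      have hc1 : ContDiffAt ℝ ∞ (fun x => ρ (Φ x)) (Φ.symm p) :=
        (ContMDiffAt.comp _ (ρ.contMDiff _) (Φ.contMDiffAt hps)).contDiffAt
      have hc2 : ContDiffAt ℝ ∞ (fun x => f (Φ x)) (Φ.symm p) :=
        (ContMDiffAt.comp _ (hf _) (Φ.contMDiffAt hps)).contDiffAt
      have h1 := contMDiffAt_vectorField_of_param (X := X) Φ hps
        (Y := fun x => ρ (Φ x) • ((f (Φ x) ^ m * u.1, u.2) : ℝ × F))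
        (hc1.smul (((hc2.pow m).mul contDiffAt_const).prodMk contDiffAt_const)) ?_
      · have h2 : Φ (Φ.symm p) = p := Φ.apply_symm_apply hp
        rw [h2] at h1
        exact h1
      · filter_upwards [Φ.open_source.mem_nhds hps] with x hx
        have h2 : Φ.symm (Φ x) = x := Φ.symm_apply_apply hx
        change ρ (Φ x) • modelDeriv 𝓘(ℝ, ℝ × F) (𝓡 n) Φ (Φ.symm (Φ x)) (f (Φ x) ^ m * u.1, u.2)
          = modelDeriv 𝓘(ℝ, ℝ × F) (𝓡 n) Φ x (ρ (Φ x) • ((f (Φ x) ^ m * u.1, u.2) : ℝ × F))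
        rw [h2, map_smul]
    · have hps : p ∉ tsupport ρ := fun h => hp (hρ h)
      have hev : ∀ᶠ q in 𝓝 p, ρ q = 0 := notMem_tsupport_iff_eventuallyEq.1 hps
      refine (Bundle.contMDiff_zeroSection ℝ
        (TangentSpace (𝓡 n) : M → Type _) p).congr_of_eventuallyEq ?_
      filter_upwards [hev] with q hq
      have : X q = 0 := by simp only [X, hq, zero_smul]
      exact congrArg (fun v : EuclideanSpace ℝ (Fin n) => (⟨q, v⟩ : TangentBundle (𝓡 n) M)) this
  · change modelDeriv (𝓡 n) 𝓘(ℝ, ℝ) f p (X p) = ρ p * u.1 * f p ^ m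
    by_cases hp : p ∈ Φ.target
    · have hps : Φ.symm p ∈ Φ.source := Φ.map_target hp
      have h1 := hΦ _ hps (f p ^ m * u.1, u.2)
      have h2 : Φ (Φ.symm p) = p := Φ.apply_symm_apply hp
      rw [h2] at h1
      simp only [X]
      rw [map_smul, h1, smul_eq_mul]
      ring
    · have : X p = 0 := by simp only [X, hoff p hp, zero_smul]
      rw [this, map_zero, hoff p hp]
      ring
  · have h1 : ∀ᶠ x in 𝓝 x₀, ρ (Φ x) = 1 :=
      (Φ.contMDiffAt hx₀).continuousAt.eventually ρ.eventuallyEq_one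
    filter_upwards [h1, Φ.open_source.mem_nhds hx₀] with x hx hxs
    have h2 : Φ.symm (Φ x) = x := Φ.symm_apply_apply hxs
    rw [bmFrame_apply]
    change (ρ (Φ x) • modelDeriv 𝓘(ℝ, ℝ × F) (𝓡 n) Φ (Φ.symm (Φ x)) (f (Φ x) ^ m * u.1, u.2),
      ρ (Φ x) * u.1) = _
    rw [h2, hx, one_smul, one_mul]

/-- The coefficients of a smooth form are smooth. -/
lemma BmTwoForm.IsSmooth.contDiffOn_frameCoeff (hΩ : Ω.IsSmooth) (hf : ContMDiff (𝓡 n) 𝓘(ℝ, ℝ) ∞ f)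
    (hΦ : ∀ x ∈ Φ.source, IsAdaptedAt n 𝓘(ℝ, ℝ × F) f Φ x) :
    ContDiffOn ℝ ∞ (frameCoeff 𝓘(ℝ, ℝ × F) Ω Φ) Φ.source := by
  refine contDiffOn_alternatingMap fun v x₀ hx₀ => ContDiffAt.contDiffWithinAt ?_
  obtain ⟨V, hV⟩ := exists_bmVectorField (m := m) hf hΦ hx₀ (v 0)
  obtain ⟨W, hW⟩ := exists_bmVectorField (m := m) hf hΦ hx₀ (v 1)
  have h1 : ContDiffAt ℝ ∞ (fun x => Ω (Φ x) ![V.val (Φ x), W.val (Φ x)]) x₀ :=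
    (ContMDiffAt.comp x₀ (hΩ V W _) (Φ.contMDiffAt hx₀)).contDiffAt
  refine h1.congr_of_eventuallyEq ?_
  filter_upwards [hV, hW, Φ.open_source.mem_nhds hx₀] with x hxV hxW hxs
  have h2 : v = ![v 0, v 1] := by ext i : 1; fin_cases i <;> rfl
  rw [h2, (hΦ x hxs).frameCoeff_apply₂]
  have h3 : bmFrameL (hΦ x hxs) m (v 0) = V.val (Φ x) := Subtype.ext hxV.symm
  have h4 : bmFrameL (hΦ x hxs) m (v 1) = W.val (Φ x) := Subtype.ext hxW.symm
  rw [h3, h4]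

end AdaptedSmooth

/-! ### The coefficients of a symplectic form in a tubular neighbourhood -/

section PullbackClosed

variable {n k : ℕ} {M : Type*} [TopologicalSpace M] [ChartedSpace (EuclideanSpace ℝ (Fin n)) M]
  [IsManifold (𝓡 n) ∞ M]
  {F : Type*} [NormedAddCommGroup F] [NormedSpace ℝ F]

/-- The pullback of a form under a parametrization of an open set. -/
def formPullback (σ : DiffForm n k M) (Φ : F → M) (x : F) : F [⋀^Fin k]→L[ℝ] ℝ :=
  (show EuclideanSpace ℝ (Fin n) [⋀^Fin k]→L[ℝ] ℝ from σ (Φ x)).compContinuousLinearMap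
    (modelDeriv 𝓘(ℝ, F) (𝓡 n) Φ x)

/-- Pullbacks of closed forms are closed. -/
lemma DiffForm.IsClosedOn.extDeriv_formPullback {σ : DiffForm n k M} {S : Set M}
    (hσ : σ.IsClosedOn S) (Φ : PartialDiffeomorph 𝓘(ℝ, F) (𝓡 n) F M ∞) {x₀ : F}
    (hx₀ : x₀ ∈ Φ.source) (hS : Φ x₀ ∈ S) (hd : DifferentiableAt ℝ (formPullback σ Φ) x₀) :
    extDeriv (formPullback σ Φ) x₀ = 0 := by
  set p₀ := Φ x₀ with hp₀
  set y₀ := extChartAt (𝓡 n) p₀ p₀ with hy₀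
  set k := chartParam (𝓡 n) p₀ with hk
  have hy₀s : y₀ ∈ k.source := mem_chartParam_source p₀
  have hky₀ : k y₀ = p₀ := chartParam_self p₀
  let θ : EuclideanSpace ℝ (Fin n) → F := fun y => Φ.symm (k y)
  have hθy₀ : θ y₀ = x₀ := by
    change Φ.symm (k y₀) = x₀
    rw [hky₀]
    exact Φ.symm_apply_apply hx₀
  have hp₀t : k y₀ ∈ Φ.target := by rw [hky₀]; exact Φ.map_source hx₀
  have hθ : ContDiffAt ℝ ∞ θ y₀ :=
    (ContMDiffAt.comp y₀ (Φ.symm.contMDiffAt hp₀t) (k.contMDiffAt hy₀s)).contDiffAt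
  have hderiv : ∀ y ∈ k.source, k y ∈ Φ.target → fderiv ℝ θ y
      = (modelDeriv (𝓡 n) 𝓘(ℝ, F) Φ.symm (k y)).comp (chartDeriv (𝓡 n) p₀ y) := by
    intro y hy ht
    have h1 : HasMFDerivAt (𝓡 n) 𝓘(ℝ, F) Φ.symm (k y)
      (modelDeriv (E' := F) (𝓡 n) 𝓘(ℝ, F) Φ.symm (k y)) :=
      (Φ.symm.mdifferentiableAt' (x := k y) ht).hasMFDerivAt
    have h2 : HasFDerivAt θ
      ((modelDeriv (𝓡 n) 𝓘(ℝ, F) Φ.symm (k y)).comp (chartDeriv (𝓡 n) p₀ y)) y :=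
      hasMFDerivAt_iff_hasFDerivAt.1 (h1.comp y (hasMFDerivAt_chartParam hy))
    exact h2.fderiv
  have hev : σ.inChart p₀ =ᶠ[𝓝 y₀]
      fun y => (formPullback σ Φ (θ y)).compContinuousLinearMap (fderiv ℝ θ y) := by
    filter_upwards [k.open_source.mem_nhds hy₀s,
      (k.contMDiffAt hy₀s).continuousAt.eventually (Φ.open_target.mem_nhds hp₀t)] with y hy ht
    have h1 : Φ (θ y) = k y := Φ.apply_symm_apply ht
    rw [hderiv y hy ht]
    have h2 : ∀ v, modelDeriv 𝓘(ℝ, F) (𝓡 n) Φ (θ y)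
        (modelDeriv (𝓡 n) 𝓘(ℝ, F) Φ.symm (k y) (chartDeriv (𝓡 n) p₀ y v))
        = chartDeriv (𝓡 n) p₀ y v := by
      intro v
      rw [← h1]
      exact Φ.mfderiv_apply_symm (x := θ y) (Φ.map_target ht) _
    ext v
    change (show EuclideanSpace ℝ (Fin n) [⋀^Fin _]→L[ℝ] ℝ from σ (k y))
        (fun i => chartDeriv (𝓡 n) p₀ y (v i))
      = (show EuclideanSpace ℝ (Fin n) [⋀^Fin _]→L[ℝ] ℝ from σ (Φ (θ y)))
        (fun i => modelDeriv 𝓘(ℝ, F) (𝓡 n) Φ (θ y)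
          (modelDeriv (𝓡 n) 𝓘(ℝ, F) Φ.symm (k y) (chartDeriv (𝓡 n) p₀ y (v i))))
    simp only [h2]
    rw [h1]
  have h0 := hσ p₀ y₀ hy₀s (by
    change k y₀ ∈ S
    rw [hky₀]
    exact hS)
  rw [hev.extDeriv_eq, extDeriv_pullback (r := ∞) (by rw [hθy₀]; exact hd) hθ
    (by simpa using (ENat.LEInfty.out : (2 : WithTop ℕ∞) ≤ ∞)), hθy₀] at h0
  have hsurj : Function.Surjective (fderiv ℝ θ y₀) := by
    rw [hderiv y₀ hy₀s hp₀t]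
    have h1 : Function.Surjective (modelDeriv (𝓡 n) 𝓘(ℝ, F) Φ.symm (k y₀)) := by
      obtain ⟨e, he⟩ : ∃ e : EuclideanSpace ℝ (Fin n) ≃L[ℝ] F, (e : _ →L[ℝ] F)
          = modelDeriv (𝓡 n) 𝓘(ℝ, F) Φ.symm (k y₀) := Φ.symm.isInvertible_mfderiv (x := k y₀) hp₀t
      rw [← he]
      exact e.surjective
    exact h1.comp (bijective_chartDeriv hy₀s).2
  ext v
  choose w hw using fun i => hsurj (v i)
  have h2 := DFunLike.congr_fun h0 w
  have h3 : (fun i => fderiv ℝ θ y₀ (w i)) = v := funext hw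
  rw [← h3]
  exact h2

end PullbackClosed

section Coefficients

lemma contDiffOn_alternatingMap_apply {X V : Type*} [NormedAddCommGroup X] [NormedSpace ℝ X]
    [NormedAddCommGroup V] [NormedSpace ℝ V] {k : ℕ} {W : X → V [⋀^Fin k]→L[ℝ] ℝ} {s : Set X}
    {n : WithTop ℕ∞} (hW : ContDiffOn ℝ n W s) (v : Fin k → V) :
    ContDiffOn ℝ n (fun x => W x v) s :=
  (ContinuousAlternatingMap.apply ℝ V ℝ v).contDiff.comp_contDiffOn hW

variable {F : Type*} [NormedAddCommGroup F] [NormedSpace ℝ F]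

/-- The one-form `a` of a two-form `dt ∧ a + b` on `ℝ × F`. -/
def coeffA (W : (ℝ × F) [⋀^Fin 2]→L[ℝ] ℝ) : F →L[ℝ] ℝ :=
  (altBilin W (1, 0)).comp (ContinuousLinearMap.inr ℝ ℝ F)

/-- The two-form `b` of a two-form `dt ∧ a + b` on `ℝ × F`. -/
def coeffB (W : (ℝ × F) [⋀^Fin 2]→L[ℝ] ℝ) : F →L[ℝ] F →L[ℝ] ℝ :=
  (altBilin W).bilinearComp (ContinuousLinearMap.inr ℝ ℝ F) (ContinuousLinearMap.inr ℝ ℝ F)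

variable (W : (ℝ × F) [⋀^Fin 2]→L[ℝ] ℝ)

lemma coeffA_apply (v : F) : coeffA W v = W ![(1, 0), (0, v)] := altBilin_apply W _ _

lemma coeffB_apply (v w : F) : coeffB W v w = W ![(0, v), (0, w)] := altBilin_apply W _ _

lemma altBilin_skew {V : Type*} [NormedAddCommGroup V] [NormedSpace ℝ V] (W : V [⋀^Fin 2]→L[ℝ] ℝ)
    (u w : V) : altBilin W u w = -altBilin W w u := by
  rw [altBilin_apply, altBilin_apply]
  have := W.toAlternatingMap.map_swap ![w, u] (i := 0) (j := 1) (by decide)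
  have h2 : ![w, u] ∘ Equiv.swap (0 : Fin 2) 1 = ![u, w] := by
    ext i : 1
    fin_cases i <;> rfl
  rw [h2] at this
  exact this

lemma frameForm_coeff [FiniteDimensional ℝ F] (x y : ℝ × F) : frameForm (coeffA W) (coeffB W) x y = W ![x, y] := by
  obtain ⟨c, v⟩ := x
  obtain ⟨e, w⟩ := y
  have h1 : ((c, v) : ℝ × F) = c • (1, 0) + (0, v) := by simp
  have h2 : ((e, w) : ℝ × F) = e • (1, 0) + (0, w) := by simp
  have h3 := altBilin_skew W (1, 0) (1, 0)
  have h4 := altBilin_skew W (0, v) (1, 0)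
  rw [← altBilin_apply, frameForm_apply]
  change c * altBilin W (1, 0) (0, w) - e * altBilin W (1, 0) (0, v) + altBilin W (0, v) (0, w) = _
  conv_rhs => rw [h1, h2]
  simp only [map_add, map_smul, add_apply, smul_apply, smul_eq_mul]
  rw [h4, show altBilin W (1, 0) (1, 0) = 0 by linarith]
  ring

/-- The rescaling between the ordinary frame and the `bᵐ`-frame. -/
def bScale (F : Type*) [NormedAddCommGroup F] [NormedSpace ℝ F] (m : ℕ) (t : ℝ) :
    ℝ × F →L[ℝ] ℝ × F :=
  ((t ^ m)⁻¹ • ContinuousLinearMap.fst ℝ ℝ F).prod (ContinuousLinearMap.snd ℝ ℝ F)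

lemma bScale_apply (m : ℕ) (t : ℝ) (u : ℝ × F) : bScale F m t u = ((t ^ m)⁻¹ * u.1, u.2) := rfl

variable [FiniteDimensional ℝ F] {m : ℕ} {ε : ℝ} {U : Set F}

lemma contDiffOn_scaled {W : ℝ × F → (ℝ × F) [⋀^Fin 2]→L[ℝ] ℝ} {s : Set (ℝ × F)}
    (hW : ContDiffOn ℝ ∞ W s) (h0 : ∀ x ∈ s, x.1 ≠ 0) :
    ContDiffOn ℝ ∞ (fun x => (W x).compContinuousLinearMap (bScale F m x.1)) s := by
  refine contDiffOn_alternatingMap fun v => ?_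
  have hS : ∀ u : ℝ × F, ContDiffOn ℝ ∞ (fun x : ℝ × F => bScale F m x.1 u) s := fun u =>
    (((contDiffOn_fst.pow m).inv fun x hx => pow_ne_zero m (h0 x hx)).mul contDiffOn_const).prodMk
      contDiffOn_const
  have hB : ContDiffOn ℝ ∞ (fun x => altBilin (W x)) s := by
    refine contDiffOn_clm_apply.2 fun u => contDiffOn_clm_apply.2 fun w => ?_
    simp only [altBilin_apply]
    exact contDiffOn_alternatingMap_apply hW _
  refine ((hB.clm_apply (hS (v 0))).clm_apply (hS (v 1))).congr fun x _ => ?_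
  rw [altBilin_apply]
  change W x _ = W x _
  congr 1
  ext i : 1
  fin_cases i <;> rfl

lemma fderiv_scaled_apply {W : ℝ × F → (ℝ × F) [⋀^Fin 2]→L[ℝ] ℝ} {x : ℝ × F} (hx : x.1 ≠ 0)
    (hW : DifferentiableAt ℝ W x) (v w : F) :
    fderiv ℝ (fun x => (W x).compContinuousLinearMap (bScale F m x.1) ![(1, 0), (0, w)]) x (0, v)
      = (x.1 ^ m)⁻¹ * fderiv ℝ (fun x => coeffA (W x) w) x (0, v) := by
  have h1 : (fun x : ℝ × F =>
      (W x).compContinuousLinearMap (bScale F m x.1) ![(1, 0), (0, w)])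
      = fun x => (x.1 ^ m)⁻¹ * coeffA (W x) w := by
    funext x
    rw [← smul_eq_mul, ← smul_apply, coeffA, ← ContinuousLinearMap.smul_comp,
      ← map_smul, ContinuousLinearMap.comp_apply, altBilin_apply]
    change W x _ = W x _
    congr 1
    ext i : 1
    fin_cases i
    · exact Prod.ext rfl (by simp [bScale_apply])
    · exact Prod.ext (by simp [bScale_apply]) rfl
  have hA : DifferentiableAt ℝ (fun x => coeffA (W x) w) x := by
    simp only [coeffA_apply]
    exact ((ContinuousAlternatingMap.apply ℝ (ℝ × F) ℝ _).differentiableAt).comp x hW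
  have hg : DifferentiableAt ℝ (fun t : ℝ => (t ^ m)⁻¹) x.1 :=
    (differentiableAt_pow m).fun_inv (pow_ne_zero m hx)
  have hs : HasFDerivAt (fun x : ℝ × F => (x.1 ^ m)⁻¹) _ x :=
    hg.hasFDerivAt.comp x hasFDerivAt_fst
  rw [h1]
  refine (DFunLike.congr_fun (hs.mul hA.hasFDerivAt).fderiv (0, v)).trans ?_
  simp

/-- If the two-form with coefficients `a`, `b` in the frame of the `bᵐ`-tangent bundle is closed,
then its coefficients form a closed pair. -/
lemma isClosedPair_coeff {W : ℝ × F → (ℝ × F) [⋀^Fin 2]→L[ℝ] ℝ} (hU : IsOpen U)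
    (hW : ContDiffOn ℝ ∞ W (Ioo (-ε) ε ×ˢ U))
    (hd : ∀ x ∈ Ioo (-ε) ε ×ˢ U, x.1 ≠ 0 →
      extDeriv (fun x => (W x).compContinuousLinearMap (bScale F m x.1)) x = 0) :
    IsClosedPair m ε U (fun x => coeffA (W x)) (fun x => coeffB (W x)) := by
  have hAs : ContDiffOn ℝ ∞ (fun x => coeffA (W x)) (Ioo (-ε) ε ×ˢ U) := by
    refine contDiffOn_clm_apply.2 fun u => ?_
    simp only [coeffA_apply]
    exact contDiffOn_alternatingMap_apply hW _
  have hBs : ContDiffOn ℝ ∞ (fun x => coeffB (W x)) (Ioo (-ε) ε ×ˢ U) := by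
    refine contDiffOn_clm_apply.2 fun u => contDiffOn_clm_apply.2 fun w => ?_
    simp only [coeffB_apply]
    exact contDiffOn_alternatingMap_apply hW _
  have hopen : IsOpen (Ioo (-ε) ε ×ˢ U) := isOpen_Ioo.prod hU
  have hWd : ∀ x ∈ Ioo (-ε) ε ×ˢ U, DifferentiableAt ℝ W x := fun x hx =>
    (hW.contDiffAt (hopen.mem_nhds hx)).differentiableAt (by simp)
  have hAd : ∀ x ∈ Ioo (-ε) ε ×ˢ U, DifferentiableAt ℝ (fun x => coeffA (W x)) x := fun x hx =>
    (hAs.contDiffAt (hopen.mem_nhds hx)).differentiableAt (by simp)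
  have hBd : ∀ x ∈ Ioo (-ε) ε ×ˢ U, DifferentiableAt ℝ (fun x => coeffB (W x)) x := fun x hx =>
    (hBs.contDiffAt (hopen.mem_nhds hx)).differentiableAt (by simp)
  have hσd : ∀ x ∈ Ioo (-ε) ε ×ˢ U, x.1 ≠ 0 →
      DifferentiableAt ℝ (fun x => (W x).compContinuousLinearMap (bScale F m x.1)) x := by
    intro x hx h0
    have ho : IsOpen ((Ioo (-ε) ε ×ˢ U) ∩ {x | x.1 ≠ 0}) :=
      hopen.inter (isOpen_ne_fun continuous_fst continuous_const)
    exact ((contDiffOn_scaled (hW.mono inter_subset_left) fun x hx => hx.2).contDiffAt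
      (ho.mem_nhds ⟨hx, h0⟩)).differentiableAt (by simp)
  have hA' : ∀ x ∈ Ioo (-ε) ε ×ˢ U, ∀ ξ w,
      fderiv ℝ (fun x => coeffA (W x) w) x ξ = fderiv ℝ (fun x => coeffA (W x)) x ξ w := by
    intro x hx ξ w
    rw [fderiv_clm_apply (hAd x hx) (differentiableAt_const w)]
    simp
  have hB' : ∀ x ∈ Ioo (-ε) ε ×ˢ U, ∀ ξ v w,
      fderiv ℝ (fun x => coeffB (W x) v w) x ξ = fderiv ℝ (fun x => coeffB (W x)) x ξ v w := by
    intro x hx ξ v w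
    rw [fderiv_clm_apply ((hBd x hx).clm_apply (differentiableAt_const v))
      (differentiableAt_const w), fderiv_clm_apply (hBd x hx) (differentiableAt_const v)]
    simp
  have hBsc : ∀ v w : F, (fun x : ℝ × F =>
      (W x).compContinuousLinearMap (bScale F m x.1) ![(0, v), (0, w)])
      = fun x => coeffB (W x) v w := by
    intro v w
    funext x
    rw [coeffB_apply]
    change W x _ = W x _
    congr 1
    ext i : 1
    fin_cases i <;> exact Prod.ext (by simp [bScale_apply]) rfl
  refine ⟨hAs, hBs, fun t ht h0 y hy v w => ?_, fun t ht h0 y hy u v w => ?_⟩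
  · have hx : (t, y) ∈ Ioo (-ε) ε ×ˢ U := ⟨ht, hy⟩
    have h1 : extDeriv (fun x => (W x).compContinuousLinearMap (bScale F m x.1)) (t, y)
        ![(1, 0), (0, v), (0, w)] = 0 := by
      rw [hd (t, y) hx h0]
      rfl
    rw [extDeriv_apply (hσd _ hx h0), Fin.sum_univ_three] at h1
    have r0 : (0 : Fin 3).removeNth ![((1, 0) : ℝ × F), (0, v), (0, w)] = ![(0, v), (0, w)] := by
      ext i : 1
      fin_cases i <;> rfl
    have r1 : (1 : Fin 3).removeNth ![((1, 0) : ℝ × F), (0, v), (0, w)] = ![(1, 0), (0, w)] := by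
      ext i : 1
      fin_cases i <;> rfl
    have r2 : (2 : Fin 3).removeNth ![((1, 0) : ℝ × F), (0, v), (0, w)] = ![(1, 0), (0, v)] := by
      ext i : 1
      fin_cases i <;> rfl
    simp only [r0, r1, r2] at h1
    have e0 : ![((1, 0) : ℝ × F), (0, v), (0, w)] 0 = (1, 0) := rfl
    have e1 : ![((1, 0) : ℝ × F), (0, v), (0, w)] 1 = (0, v) := rfl
    have e2 : ![((1, 0) : ℝ × F), (0, v), (0, w)] 2 = (0, w) := rfl
    rw [e0, e1, e2, hBsc, fderiv_scaled_apply h0 (hWd _ hx), fderiv_scaled_apply h0 (hWd _ hx),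
      hA' _ hx, hA' _ hx, hB' _ hx] at h1
    have h2 : t ^ m ≠ 0 := pow_ne_zero m h0
    simp only [Fin.val_zero, Fin.val_one, Fin.val_two, pow_zero, pow_one, one_smul, neg_smul,
      even_two, Even.neg_pow, one_pow] at h1
    rw [curl]
    field_simp at h1
    linarith
  · have hx : (t, y) ∈ Ioo (-ε) ε ×ˢ U := ⟨ht, hy⟩
    have h1 : extDeriv (fun x => (W x).compContinuousLinearMap (bScale F m x.1)) (t, y)
        ![(0, u), (0, v), (0, w)] = 0 := by
      rw [hd (t, y) hx h0]
      rfl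
    rw [extDeriv_apply (hσd _ hx h0), Fin.sum_univ_three] at h1
    have r0 : (0 : Fin 3).removeNth ![((0, u) : ℝ × F), (0, v), (0, w)] = ![(0, v), (0, w)] := by
      ext i : 1
      fin_cases i <;> rfl
    have r1 : (1 : Fin 3).removeNth ![((0, u) : ℝ × F), (0, v), (0, w)] = ![(0, u), (0, w)] := by
      ext i : 1
      fin_cases i <;> rfl
    have r2 : (2 : Fin 3).removeNth ![((0, u) : ℝ × F), (0, v), (0, w)] = ![(0, u), (0, v)] := by
      ext i : 1
      fin_cases i <;> rfl
    simp only [r0, r1, r2] at h1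
    have e0 : ![((0, u) : ℝ × F), (0, v), (0, w)] 0 = (0, u) := rfl
    have e1 : ![((0, u) : ℝ × F), (0, v), (0, w)] 1 = (0, v) := rfl
    have e2 : ![((0, u) : ℝ × F), (0, v), (0, w)] 2 = (0, w) := rfl
    rw [e0, e1, e2, hBsc, hBsc, hBsc, hB' _ hx, hB' _ hx, hB' _ hx] at h1
    have h3 : (fun x => coeffB (W x) u w) = fun x => -coeffB (W x) w u := by
      funext x
      rw [coeffB, ContinuousLinearMap.bilinearComp_apply, ContinuousLinearMap.bilinearComp_apply,
        altBilin_skew]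
    have h4 := hB' _ hx (0, v) u w
    rw [h3, fderiv_fun_neg, neg_apply, hB' _ hx] at h4
    simp only [Fin.val_zero, Fin.val_one, Fin.val_two, pow_zero, pow_one, one_smul, neg_smul,
      even_two, Even.neg_pow, one_pow] at h1
    linarith

lemma IsClosedPair.congr {A A' : ℝ × F → F →L[ℝ] ℝ} {B B' : ℝ × F → F →L[ℝ] F →L[ℝ] ℝ}
    (h : IsClosedPair m ε U A B) (hU : IsOpen U) (hA : EqOn A' A (Ioo (-ε) ε ×ˢ U))
    (hB : EqOn B' B (Ioo (-ε) ε ×ˢ U)) : IsClosedPair m ε U A' B' where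
  smooth_A := h.smooth_A.congr hA
  smooth_B := h.smooth_B.congr hB
  closed_A t ht h0 y hy v w := by
    have hn := (isOpen_Ioo.prod hU).mem_nhds (show (t, y) ∈ Ioo (-ε) ε ×ˢ U from ⟨ht, hy⟩)
    rw [(hA.eventuallyEq_of_mem hn).fderiv_eq, (hB.eventuallyEq_of_mem hn).fderiv_eq]
    exact h.closed_A t ht h0 y hy v w
  closed_B t ht h0 y hy u v w := by
    have hn := (isOpen_Ioo.prod hU).mem_nhds (show (t, y) ∈ Ioo (-ε) ε ×ˢ U from ⟨ht, hy⟩)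
    rw [(hB.eventuallyEq_of_mem hn).fderiv_eq]
    exact h.closed_B t ht h0 y hy u v w

end Coefficients

section Continuity

variable {E : Type u} [NormedAddCommGroup E] [NormedSpace ℝ E] [FiniteDimensional ℝ E]
  {H : Type*} [TopologicalSpace H] {I : ModelWithCorners ℝ E H} [I.Boundaryless]
  {Z : Type*} [TopologicalSpace Z] [ChartedSpace H Z] [IsManifold I ∞ Z]
  {m : ℕ} {ε : ℝ} {a : ℝ → Z → E →L[ℝ] ℝ} {b : ℝ → Z → E →L[ℝ] E →L[ℝ] ℝ}

lemma IsSymplecticFamily.continuousOn_apply₂ (h : IsSymplecticFamily I m ε a b) (z : Z) (v w : E) :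
    ContinuousOn (fun t => b t z v w) (Ioo (-ε) ε) := by
  obtain ⟨e, he⟩ := exists_inverse_chartDeriv (mem_chartParam_source (I := I) z)
  have h1 : ContinuousOn (fun t => chartB I b z (t, extChartAt I z z)) (Ioo (-ε) ε) :=
    (h.closed z).smooth_B.continuousOn.comp (by fun_prop) fun t ht =>
      ⟨ht, mem_chartParam_source z⟩
  refine ((h1.clm_apply (continuousOn_const (c := e.symm v))).clm_apply
    (continuousOn_const (c := e.symm w))).congr fun t _ => ?_
  simp only [chartB, chartParam_self, ContinuousLinearMap.bilinearComp_apply, ← he]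
  simp

end Continuity

section TubeCoefficients

variable {d m : ℕ} {ε : ℝ}
  {M : Type*} [TopologicalSpace M] [ChartedSpace (EuclideanSpace ℝ (Fin (d + 1))) M]
  [IsManifold (𝓡 (d + 1)) ∞ M]
  {Z : Type*} [TopologicalSpace Z] [ChartedSpace (EuclideanSpace ℝ (Fin d)) Z]
  [IsManifold (𝓡 d) ∞ Z] {f : M → ℝ}
  {Φ : PartialDiffeomorph (𝓘(ℝ, ℝ).prod (𝓡 d)) (𝓡 (d + 1)) (ℝ × Z) M ∞}
  {Ω : BmTwoForm (d + 1) f m}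

/-- The parametrization `Φ` is the inverse of a tubular neighbourhood of width `ε`. -/
structure IsTubeParam (f : M → ℝ) (ε : ℝ)
    (Φ : PartialDiffeomorph (𝓘(ℝ, ℝ).prod (𝓡 d)) (𝓡 (d + 1)) (ℝ × Z) M ∞) : Prop where
  smooth : ContMDiff (𝓡 (d + 1)) 𝓘(ℝ, ℝ) ∞ f
  source : Φ.source = Ioo (-ε) ε ×ˢ univ
  level : ∀ x ∈ Φ.source, f (Φ x) = x.1

/-- The one-forms of a `bᵐ`-form in a tubular neighbourhood. -/
def tubeA (Ω : BmTwoForm (d + 1) f m)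
    (Φ : PartialDiffeomorph (𝓘(ℝ, ℝ).prod (𝓡 d)) (𝓡 (d + 1)) (ℝ × Z) M ∞) (t : ℝ) (z : Z) :
    EuclideanSpace ℝ (Fin d) →L[ℝ] ℝ :=
  coeffA (frameCoeff (𝓘(ℝ, ℝ).prod (𝓡 d)) Ω Φ (t, z))

/-- The two-forms of a `bᵐ`-form in a tubular neighbourhood. -/
def tubeB (Ω : BmTwoForm (d + 1) f m)
    (Φ : PartialDiffeomorph (𝓘(ℝ, ℝ).prod (𝓡 d)) (𝓡 (d + 1)) (ℝ × Z) M ∞) (t : ℝ) (z : Z) :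
    EuclideanSpace ℝ (Fin d) →L[ℝ] EuclideanSpace ℝ (Fin d) →L[ℝ] ℝ :=
  coeffB (frameCoeff (𝓘(ℝ, ℝ).prod (𝓡 d)) Ω Φ (t, z))

namespace IsTubeParam

variable (hΦ : IsTubeParam f ε Φ)

include hΦ

lemma mem_source {t : ℝ} (ht : t ∈ Ioo (-ε) ε) (z : Z) : (t, z) ∈ Φ.source := by
  rw [hΦ.source]; exact ⟨ht, mem_univ _⟩

lemma isAdaptedAt {x : ℝ × Z} (hx : x ∈ Φ.source) :
    IsAdaptedAt (d + 1) (𝓘(ℝ, ℝ).prod (𝓡 d)) f Φ x := by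
  intro u
  have h1 : HasMFDerivAt (𝓡 (d + 1)) 𝓘(ℝ, ℝ) f (Φ x)
      (modelDeriv (E' := ℝ) (𝓡 (d + 1)) 𝓘(ℝ, ℝ) f (Φ x)) :=
    (hΦ.smooth.mdifferentiableAt (by simp)).hasMFDerivAt
  have h2 : HasMFDerivAt (𝓘(ℝ, ℝ).prod (𝓡 d)) (𝓡 (d + 1)) Φ x
      (modelDeriv (E' := EuclideanSpace ℝ (Fin (d + 1))) (𝓘(ℝ, ℝ).prod (𝓡 d)) (𝓡 (d + 1)) Φ x) :=
    (Φ.mdifferentiableAt' hx).hasMFDerivAt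
  have h3 := (h1.comp x h2).mfderiv
  have h4 : (f ∘ Φ) =ᶠ[𝓝 x] Prod.fst := by
    filter_upwards [Φ.open_source.mem_nhds hx] with y hy using hΦ.level y hy
  rw [h4.mfderiv_eq, mfderiv_fst] at h3
  exact (DFunLike.congr_fun h3 u).symm

/-- The parametrization of the tubular neighbourhood by the product of the line and a chart. -/
def _root_.tubeChart (Φ : PartialDiffeomorph (𝓘(ℝ, ℝ).prod (𝓡 d)) (𝓡 (d + 1)) (ℝ × Z) M ∞) (z₀ : Z) :
    PartialDiffeomorph 𝓘(ℝ, ℝ × EuclideanSpace ℝ (Fin d)) (𝓡 (d + 1))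
      (ℝ × EuclideanSpace ℝ (Fin d)) M ∞ :=
  (chartParam (𝓘(ℝ, ℝ).prod (𝓡 d)) ((0 : ℝ), z₀)).trans Φ

lemma tubeChart_source (z₀ : Z) :
    (tubeChart Φ z₀).source = Ioo (-ε) ε ×ˢ (chartParam (𝓡 d) z₀).source := by
  change (chartParam (𝓘(ℝ, ℝ).prod (𝓡 d)) ((0 : ℝ), z₀)).source
    ∩ (chartParam (𝓘(ℝ, ℝ).prod (𝓡 d)) ((0 : ℝ), z₀)) ⁻¹' Φ.source = _
  ext x
  rw [chartParam_prod_source, hΦ.source, mem_inter_iff, mem_preimage, chartParam_prod_apply]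
  simp only [mem_prod, mem_univ, true_and, and_true]
  exact and_comm

lemma modelDeriv_tubeChart {z₀ : Z} {x : ℝ × EuclideanSpace ℝ (Fin d)}
    (hx : x ∈ (tubeChart Φ z₀).source) :
    modelDeriv 𝓘(ℝ, ℝ × EuclideanSpace ℝ (Fin d)) (𝓡 (d + 1))
        (fun x => Φ (chartParam (𝓘(ℝ, ℝ).prod (𝓡 d)) ((0 : ℝ), z₀) x)) x
      = (modelDeriv (𝓘(ℝ, ℝ).prod (𝓡 d)) (𝓡 (d + 1)) Φ
          (chartParam (𝓘(ℝ, ℝ).prod (𝓡 d)) ((0 : ℝ), z₀) x)).comp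
        ((ContinuousLinearMap.fst ℝ ℝ _).prod
          ((chartDeriv (𝓡 d) z₀ x.2).comp (ContinuousLinearMap.snd ℝ ℝ _))) := by
  have hx1 : chartParam (𝓘(ℝ, ℝ).prod (𝓡 d)) ((0 : ℝ), z₀) x ∈ Φ.source := hx.2
  rw [hΦ.tubeChart_source] at hx
  have h2 : HasMFDerivAt (𝓘(ℝ, ℝ).prod (𝓡 d)) (𝓡 (d + 1)) Φ
      (chartParam (𝓘(ℝ, ℝ).prod (𝓡 d)) ((0 : ℝ), z₀) x)
      (modelDeriv (E' := EuclideanSpace ℝ (Fin (d + 1))) (𝓘(ℝ, ℝ).prod (𝓡 d)) (𝓡 (d + 1)) Φ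
        (chartParam (𝓘(ℝ, ℝ).prod (𝓡 d)) ((0 : ℝ), z₀) x)) :=
    (Φ.mdifferentiableAt' hx1).hasMFDerivAt
  exact (h2.comp x (hasMFDerivAt_chartParam_prod (p₀ := ((0 : ℝ), z₀)) hx.2)).mfderiv

lemma isAdaptedAt_tubeChart {z₀ : Z} {x : ℝ × EuclideanSpace ℝ (Fin d)}
    (hx : x ∈ (tubeChart Φ z₀).source) :
    IsAdaptedAt (d + 1) 𝓘(ℝ, ℝ × EuclideanSpace ℝ (Fin d)) f (tubeChart Φ z₀) x := by
  intro u
  have h1 := hΦ.modelDeriv_tubeChart hx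
  change modelDeriv _ _ f _ (modelDeriv _ _
    (fun x => Φ (chartParam (𝓘(ℝ, ℝ).prod (𝓡 d)) ((0 : ℝ), z₀) x)) x u) = _
  rw [h1]
  exact hΦ.isAdaptedAt hx.2 _

lemma frameCoeff_tubeChart {z₀ : Z} {x : ℝ × EuclideanSpace ℝ (Fin d)}
    (hx : x ∈ (tubeChart Φ z₀).source) (u w : ℝ × EuclideanSpace ℝ (Fin d)) :
    frameCoeff 𝓘(ℝ, ℝ × EuclideanSpace ℝ (Fin d)) Ω (tubeChart Φ z₀) x ![u, w]
      = frameCoeff (𝓘(ℝ, ℝ).prod (𝓡 d)) Ω Φ (x.1, chartParam (𝓡 d) z₀ x.2)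
        ![(u.1, chartDeriv (𝓡 d) z₀ x.2 u.2), (w.1, chartDeriv (𝓡 d) z₀ x.2 w.2)] := by
  have h1 := frameCoeff_comp (Ω := Ω) (Φ := Φ)
    (K := chartParam (𝓘(ℝ, ℝ).prod (𝓡 d)) ((0 : ℝ), z₀)) (hΦ.isAdaptedAt hx.2)
    (hΦ.modelDeriv_tubeChart hx) u w
  rw [chartParam_prod_apply] at h1
  exact h1

lemma chartA_eq {z₀ : Z} {x : ℝ × EuclideanSpace ℝ (Fin d)} (hx : x ∈ (tubeChart Φ z₀).source) :
    chartA (𝓡 d) (tubeA Ω Φ) z₀ x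
      = coeffA (frameCoeff 𝓘(ℝ, ℝ × EuclideanSpace ℝ (Fin d)) Ω (tubeChart Φ z₀) x) := by
  ext v
  rw [coeffA_apply, hΦ.frameCoeff_tubeChart hx, chartA, ContinuousLinearMap.comp_apply, tubeA,
    coeffA_apply]
  simp only [map_zero]

lemma chartB_eq {z₀ : Z} {x : ℝ × EuclideanSpace ℝ (Fin d)} (hx : x ∈ (tubeChart Φ z₀).source) :
    chartB (𝓡 d) (tubeB Ω Φ) z₀ x
      = coeffB (frameCoeff 𝓘(ℝ, ℝ × EuclideanSpace ℝ (Fin d)) Ω (tubeChart Φ z₀) x) := by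
  ext v w
  rw [coeffB_apply, hΦ.frameCoeff_tubeChart hx, chartB, ContinuousLinearMap.bilinearComp_apply,
    tubeB, coeffB_apply]

lemma isClosedPair [T2Space M] (hΩ : Ω.IsSymplectic) (z₀ : Z) :
    IsClosedPair m ε (chartParam (𝓡 d) z₀).source (chartA (𝓡 d) (tubeA Ω Φ) z₀)
      (chartB (𝓡 d) (tubeB Ω Φ) z₀) := by
  have hs := hΦ.tubeChart_source z₀
  have hU := (chartParam (𝓡 d) z₀).open_source
  have hW := hΩ.smooth.contDiffOn_frameCoeff hΦ.smooth
    (fun x hx => hΦ.isAdaptedAt_tubeChart (z₀ := z₀) hx)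
  have hlev : ∀ x ∈ (tubeChart Φ z₀).source, f (tubeChart Φ z₀ x) = x.1 := by
    intro x hx
    exact (hΦ.level _ hx.2).trans (congrArg Prod.fst (chartParam_prod_apply _ _ _))
  refine IsClosedPair.congr (isClosedPair_coeff (m := m) hU (hs ▸ hW) fun x hx h0 => ?_) hU
    (fun x hx => hΦ.chartA_eq (hs ▸ hx)) (fun x hx => hΦ.chartB_eq (hs ▸ hx))
  rw [← hs] at hx
  have hopen : IsOpen ((tubeChart Φ z₀).source ∩ {x | x.1 ≠ 0}) :=
    (tubeChart Φ z₀).open_source.inter (isOpen_ne_fun continuous_fst continuous_const)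
  have hev : (fun x => (frameCoeff 𝓘(ℝ, ℝ × EuclideanSpace ℝ (Fin d)) Ω (tubeChart Φ z₀) x
      ).compContinuousLinearMap (bScale (EuclideanSpace ℝ (Fin d)) m x.1))
      =ᶠ[𝓝 x] formPullback Ω.restrict (tubeChart Φ z₀) := by
    filter_upwards [hopen.mem_nhds ⟨hx, h0⟩] with y hy
    have h1 := hlev y hy.1
    ext v
    have h2 := (hΦ.isAdaptedAt_tubeChart hy.1).restrict_apply (Ω := Ω) (by rw [h1]; exact hy.2)
      (v 0) (v 1)
    rw [h1] at h2
    refine Eq.trans ?_ (h2.symm.trans ?_)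
    · change frameCoeff _ _ _ _ _ = _
      congr 1
      ext i : 1
      fin_cases i <;> rfl
    · change _ = Ω.restrict _ _
      congr 1
      ext i : 1
      fin_cases i <;> rfl
  have hd : DifferentiableAt ℝ (formPullback Ω.restrict (tubeChart Φ z₀)) x :=
    (((contDiffOn_scaled (m := m) (hW.mono inter_subset_left) fun x hx => hx.2).contDiffAt
      (hopen.mem_nhds ⟨hx, h0⟩)).differentiableAt (by simp)).congr_of_eventuallyEq hev.symm
  rw [hev.extDeriv_eq]
  exact hΩ.closed.extDeriv_formPullback (tubeChart Φ z₀) hx (by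
    change f _ ≠ 0
    rw [hlev x hx]
    exact h0) hd

lemma exists_equiv_modelDeriv {x : ℝ × Z} (hx : x ∈ Φ.source) :
    ∃ e : (ℝ × EuclideanSpace ℝ (Fin d)) ≃L[ℝ] EuclideanSpace ℝ (Fin (d + 1)),
      (e : _ →L[ℝ] EuclideanSpace ℝ (Fin (d + 1)))
        = modelDeriv (𝓘(ℝ, ℝ).prod (𝓡 d)) (𝓡 (d + 1)) Φ x :=
  Φ.isInvertible_mfderiv hx

lemma bijective_bmFrameL {x : ℝ × Z} (hx : x ∈ Φ.source) (hx0 : x.1 = 0) (hm : m ≠ 0) :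
    Function.Bijective (bmFrameL (hΦ.isAdaptedAt hx) m) := by
  obtain ⟨e, he⟩ := hΦ.exists_equiv_modelDeriv hx
  have hf : f (Φ x) ^ m = 0 := by rw [hΦ.level x hx, hx0, zero_pow hm]
  have hv : ∀ u, bmFrame (𝓘(ℝ, ℝ).prod (𝓡 d)) f m Φ x u = (e (0, u.2), u.1) := by
    intro u
    rw [bmFrame_apply, hf, zero_mul, ← he]
    rfl
  constructor
  · intro u w h
    have h1 : bmFrame (𝓘(ℝ, ℝ).prod (𝓡 d)) f m Φ x u = bmFrame (𝓘(ℝ, ℝ).prod (𝓡 d)) f m Φ x w :=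
      congrArg Subtype.val h
    rw [hv, hv, Prod.mk.injEq] at h1
    exact Prod.ext h1.2 (Prod.ext_iff.1 (e.injective h1.1)).2
  · rintro ⟨⟨X, c⟩, h⟩
    have h' : modelDeriv (𝓡 (d + 1)) 𝓘(ℝ, ℝ) f (Φ x) X = c * f (Φ x) ^ m := h
    rw [hf, mul_zero] at h'
    obtain ⟨⟨s, v⟩, rfl⟩ := e.surjective X
    have h2 := hΦ.isAdaptedAt hx (s, v)
    rw [← he] at h2
    have h3 : s = 0 := h2.symm.trans h'
    subst h3
    refine ⟨(c, v), Subtype.ext ?_⟩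
    exact hv (c, v)

theorem isSymplecticFamily [T2Space M] (hΩ : Ω.IsSymplectic) (hm : m ≠ 0) (hε : 0 < ε) :
    IsSymplecticFamily (𝓡 d) m ε (tubeA Ω Φ) (tubeB Ω Φ) where
  closed := hΦ.isClosedPair hΩ
  skew t _ z v w := by
    rw [tubeB, coeffB, ContinuousLinearMap.bilinearComp_apply,
      ContinuousLinearMap.bilinearComp_apply, altBilin_skew]
  nondeg z u hu := by
    have hx := hΦ.mem_source (t := 0) ⟨by linarith, hε⟩ z
    have hb := hΦ.bijective_bmFrameL hx rfl hm
    refine (map_eq_zero_iff _ hb.1).1 (hΩ.nondegenerate _ _ fun w => ?_)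
    obtain ⟨w, rfl⟩ := hb.2 w
    rw [← (hΦ.isAdaptedAt hx).frameCoeff_apply₂, ← frameForm_coeff]
    exact hu w

section Symmetry

variable {g : M → M} {h : Z → Z}

lemma frameCoeff_symmetry (hg : MDifferentiable (𝓡 (d + 1)) (𝓡 (d + 1)) g)
    (hh : MDifferentiable (𝓡 d) (𝓡 d) h) (hgh : ∀ x ∈ Φ.source, Φ (x.1, h x.2) = g (Φ x))
    (hinv : Ω.restrict.IsInvariantOn g {p | f p ≠ 0}) {x : ℝ × Z} (hx : x ∈ Φ.source)
    (hx0 : x.1 ≠ 0) (u w : ℝ × EuclideanSpace ℝ (Fin d)) :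
    frameCoeff (𝓘(ℝ, ℝ).prod (𝓡 d)) Ω Φ x ![u, w]
      = frameCoeff (𝓘(ℝ, ℝ).prod (𝓡 d)) Ω Φ (x.1, h x.2)
        ![(u.1, modelDeriv (𝓡 d) (𝓡 d) h x.2 u.2), (w.1, modelDeriv (𝓡 d) (𝓡 d) h x.2 w.2)] := by
  have hxH : (x.1, h x.2) ∈ Φ.source := by
    rw [hΦ.source] at hx ⊢
    exact ⟨hx.1, mem_univ _⟩
  have d1 : HasMFDerivAt (𝓘(ℝ, ℝ).prod (𝓡 d)) (𝓘(ℝ, ℝ).prod (𝓡 d))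
      (fun x : ℝ × Z => (x.1, h x.2)) x ((ContinuousLinearMap.fst ℝ ℝ (EuclideanSpace ℝ (Fin d))).prod
        ((modelDeriv (E := EuclideanSpace ℝ (Fin d)) (E' := EuclideanSpace ℝ (Fin d)) (𝓡 d) (𝓡 d) h
          x.2).comp (ContinuousLinearMap.snd ℝ ℝ (EuclideanSpace ℝ (Fin d))))) :=
    (hasMFDerivAt_fst x).prodMk (HasMFDerivAt.comp x (hh x.2).hasMFDerivAt (hasMFDerivAt_snd x))
  have d2 : HasMFDerivAt (𝓘(ℝ, ℝ).prod (𝓡 d)) (𝓡 (d + 1)) Φ (x.1, h x.2)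
      (modelDeriv (E' := EuclideanSpace ℝ (Fin (d + 1))) (𝓘(ℝ, ℝ).prod (𝓡 d)) (𝓡 (d + 1)) Φ
        (x.1, h x.2)) := (Φ.mdifferentiableAt' hxH).hasMFDerivAt
  have d3 : HasMFDerivAt (𝓘(ℝ, ℝ).prod (𝓡 d)) (𝓡 (d + 1)) Φ x
      (modelDeriv (E' := EuclideanSpace ℝ (Fin (d + 1))) (𝓘(ℝ, ℝ).prod (𝓡 d)) (𝓡 (d + 1)) Φ x) :=
    (Φ.mdifferentiableAt' hx).hasMFDerivAt
  have d4 : HasMFDerivAt (𝓡 (d + 1)) (𝓡 (d + 1)) g (Φ x)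
      (modelDeriv (E := EuclideanSpace ℝ (Fin (d + 1))) (E' := EuclideanSpace ℝ (Fin (d + 1)))
        (𝓡 (d + 1)) (𝓡 (d + 1)) g (Φ x)) := (hg _).hasMFDerivAt
  have hev : (fun x : ℝ × Z => Φ (x.1, h x.2)) =ᶠ[𝓝 x] fun x => g (Φ x) := by
    filter_upwards [Φ.open_source.mem_nhds hx] with y hy using hgh y hy
  have d5 := (HasMFDerivAt.comp x d2 d1).mfderiv
  have d6 := (HasMFDerivAt.comp x d4 d3).mfderiv
  have d7 := hev.mfderiv_eq (I := 𝓘(ℝ, ℝ).prod (𝓡 d)) (I' := 𝓡 (d + 1))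
  have hD : ∀ u : ℝ × EuclideanSpace ℝ (Fin d),
      modelDeriv (𝓘(ℝ, ℝ).prod (𝓡 d)) (𝓡 (d + 1)) Φ (x.1, h x.2)
        (u.1, modelDeriv (𝓡 d) (𝓡 d) h x.2 u.2)
      = modelDeriv (𝓡 (d + 1)) (𝓡 (d + 1)) g (Φ x)
        (modelDeriv (𝓘(ℝ, ℝ).prod (𝓡 d)) (𝓡 (d + 1)) Φ x u) := fun u =>
    DFunLike.congr_fun (d5.symm.trans (d7.trans d6)) u
  have key : ∀ u w : ℝ × EuclideanSpace ℝ (Fin d),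
      Ω.restrict (Φ x) ![modelDeriv (𝓘(ℝ, ℝ).prod (𝓡 d)) (𝓡 (d + 1)) Φ x u,
        modelDeriv (𝓘(ℝ, ℝ).prod (𝓡 d)) (𝓡 (d + 1)) Φ x w]
      = Ω.restrict (Φ (x.1, h x.2)) ![modelDeriv (𝓘(ℝ, ℝ).prod (𝓡 d)) (𝓡 (d + 1)) Φ (x.1, h x.2)
          (u.1, modelDeriv (𝓡 d) (𝓡 d) h x.2 u.2),
        modelDeriv (𝓘(ℝ, ℝ).prod (𝓡 d)) (𝓡 (d + 1)) Φ (x.1, h x.2)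
          (w.1, modelDeriv (𝓡 d) (𝓡 d) h x.2 w.2)] := by
    intro u w
    have h1 := hinv (Φ x) (by
      change f (Φ x) ≠ 0
      rwa [hΦ.level x hx])
    have h2 := DFunLike.congr_fun h1 ![modelDeriv (𝓘(ℝ, ℝ).prod (𝓡 d)) (𝓡 (d + 1)) Φ x u,
        modelDeriv (𝓘(ℝ, ℝ).prod (𝓡 d)) (𝓡 (d + 1)) Φ x w]
    let R : M → EuclideanSpace ℝ (Fin (d + 1)) [⋀^Fin 2]→L[ℝ] ℝ := fun p => Ω.restrict p
    have h3 : R (g (Φ x)) = R (Φ (x.1, h x.2)) := by rw [hgh x hx]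
    refine h2.symm.trans ?_
    change R (g (Φ x)) _ = R (Φ (x.1, h x.2)) _
    rw [h3]
    congr 1
    ext i : 1
    fin_cases i <;> exact (hD _).symm
  have hl := hΦ.level x hx
  have hlH := hΦ.level _ hxH
  have ht : x.1 ^ m ≠ 0 := pow_ne_zero m hx0
  have h1 := key (x.1 ^ m * u.1, u.2) (x.1 ^ m * w.1, w.2)
  rw [(hΦ.isAdaptedAt hx).restrict_apply (by rwa [hl]),
    (hΦ.isAdaptedAt hxH).restrict_apply (by rwa [hlH]), hl, hlH] at h1
  simpa only [inv_mul_cancel_left₀ ht] using h1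

variable [T2Space M]

lemma tubeA_symmetry (hΩ : Ω.IsSymplectic) (hm : m ≠ 0) (hε : 0 < ε)
    (hg : MDifferentiable (𝓡 (d + 1)) (𝓡 (d + 1)) g)
    (hh : MDifferentiable (𝓡 d) (𝓡 d) h) (hgh : ∀ x ∈ Φ.source, Φ (x.1, h x.2) = g (Φ x))
    (hinv : Ω.restrict.IsInvariantOn g {p | f p ≠ 0}) {t : ℝ} (ht : t ∈ Ioo (-ε) ε) (z : Z) :
    tubeA Ω Φ t z = (tubeA Ω Φ t (h z)).comp (modelDeriv (𝓡 d) (𝓡 d) h z) := by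
  have hfam := hΦ.isSymplecticFamily hΩ hm hε
  refine eq_of_eqOn_ne_zero (f := fun t => tubeA Ω Φ t z)
    (g := fun t => (tubeA Ω Φ t (h z)).comp (modelDeriv (𝓡 d) (𝓡 d) h z))
    (hfam.contDiffOn_apply z).continuousOn
    ((hfam.contDiffOn_apply (h z)).continuousOn.clm_comp continuousOn_const)
    (fun t ht h0 => ?_) ht
  ext v
  rw [ContinuousLinearMap.comp_apply, tubeA, tubeA, coeffA_apply, coeffA_apply,
    hΦ.frameCoeff_symmetry hg hh hgh hinv (hΦ.mem_source ht z) h0]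
  simp only [map_zero]

lemma tubeB_symmetry (hΩ : Ω.IsSymplectic) (hm : m ≠ 0) (hε : 0 < ε)
    (hg : MDifferentiable (𝓡 (d + 1)) (𝓡 (d + 1)) g)
    (hh : MDifferentiable (𝓡 d) (𝓡 d) h) (hgh : ∀ x ∈ Φ.source, Φ (x.1, h x.2) = g (Φ x))
    (hinv : Ω.restrict.IsInvariantOn g {p | f p ≠ 0}) {t : ℝ} (ht : t ∈ Ioo (-ε) ε) (z : Z) :
    tubeB Ω Φ t z = (tubeB Ω Φ t (h z)).bilinearComp (modelDeriv (𝓡 d) (𝓡 d) h z)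
      (modelDeriv (𝓡 d) (𝓡 d) h z) := by
  have hfam := hΦ.isSymplecticFamily hΩ hm hε
  ext v w
  refine eq_of_eqOn_ne_zero (f := fun t => tubeB Ω Φ t z v w)
    (g := fun t => tubeB Ω Φ t (h z) (modelDeriv (𝓡 d) (𝓡 d) h z v)
      (modelDeriv (𝓡 d) (𝓡 d) h z w))
    (hfam.continuousOn_apply₂ z v w) (hfam.continuousOn_apply₂ _ _ _) (fun t ht h0 => ?_) ht
  rw [tubeB, tubeB, coeffB_apply, coeffB_apply,
    hΦ.frameCoeff_symmetry hg hh hgh hinv (hΦ.mem_source ht z) h0]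

end Symmetry

end IsTubeParam

end TubeCoefficients

/-! ### The forms of the normal form -/

section FormsOnZ

variable {F : Type*} [NormedAddCommGroup F] [NormedSpace ℝ F]

lemma extDeriv_one_form {c : F → F [⋀^Fin 1]→L[ℝ] ℝ} {D : F →L[ℝ] F →L[ℝ] ℝ} {y : F}
    (hc : DifferentiableAt ℝ c y) (hD : ∀ v w, fderiv ℝ (fun y => c y ![w]) y v = D v w)
    (hcl : ∀ v w, D v w = D w v) : extDeriv c y = 0 := by
  ext v
  rw [extDeriv_apply hc, Fin.sum_univ_two]
  have r0 : (0 : Fin 2).removeNth v = ![v 1] := by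
    ext i : 1
    fin_cases i
    rfl
  have r1 : (1 : Fin 2).removeNth v = ![v 0] := by
    ext i : 1
    fin_cases i
    rfl
  simp only [r0, r1, hD, Fin.val_zero, Fin.val_one, pow_zero, pow_one, one_smul, neg_smul]
  rw [hcl (v 0) (v 1), add_neg_cancel]
  rfl

lemma extDeriv_two_form {c : F → F [⋀^Fin 2]→L[ℝ] ℝ} {D : F →L[ℝ] F →L[ℝ] F →L[ℝ] ℝ} {y : F}
    (hc : DifferentiableAt ℝ c y) (hD : ∀ u v w, fderiv ℝ (fun y => c y ![v, w]) y u = D u v w)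
    (hcl : ∀ u v w, D u v w + D v w u + D w u v = 0) : extDeriv c y = 0 := by
  have hskew : ∀ u v w, D u v w = -D u w v := by
    intro u v w
    rw [← hD, ← hD, ← neg_apply, ← fderiv_fun_neg]
    congr 2
    funext y
    rw [← altBilin_apply, ← altBilin_apply, altBilin_skew]
  ext v
  rw [extDeriv_apply hc, Fin.sum_univ_three]
  have r0 : (0 : Fin 3).removeNth v = ![v 1, v 2] := by
    ext i : 1
    fin_cases i <;> rfl
  have r1 : (1 : Fin 3).removeNth v = ![v 0, v 2] := by
    ext i : 1
    fin_cases i <;> rfl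
  have r2 : (2 : Fin 3).removeNth v = ![v 0, v 1] := by
    ext i : 1
    fin_cases i <;> rfl
  simp only [r0, r1, r2, hD, Fin.val_zero, Fin.val_one, Fin.val_two, pow_zero, pow_one, one_smul,
    neg_smul, even_two, Even.neg_pow, one_pow]
  have h1 := hcl (v 0) (v 1) (v 2)
  have h2 := hskew (v 1) (v 0) (v 2)
  change _ = (0 : ℝ)
  linarith

variable {d m : ℕ} {ε : ℝ} {Z : Type*} [TopologicalSpace Z]
  [ChartedSpace (EuclideanSpace ℝ (Fin d)) Z] [IsManifold (𝓡 d) ∞ Z]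
  {a : ℝ → Z → EuclideanSpace ℝ (Fin d) →L[ℝ] ℝ}
  {b : ℝ → Z → EuclideanSpace ℝ (Fin d) →L[ℝ] EuclideanSpace ℝ (Fin d) →L[ℝ] ℝ}

/-- The `i`-th Taylor coefficient of a family of one-forms, as a differential form. -/
def taylorForm (a : ℝ → Z → EuclideanSpace ℝ (Fin d) →L[ℝ] ℝ) (i : ℕ) : DiffForm d 1 Z := fun z =>
  (ContinuousAlternatingMap.ofSubsingleton ℝ (EuclideanSpace ℝ (Fin d)) ℝ (0 : Fin 1)
    (taylorQuot (fun t => a t z) i 0) : EuclideanSpace ℝ (Fin d) [⋀^Fin 1]→L[ℝ] ℝ)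

namespace IsSymplecticFamily

variable (h : IsSymplecticFamily (𝓡 d) m ε a b) (hε : 0 < ε)

include h hε

lemma inChart_taylorForm (i : ℕ) (z₀ : Z) (y : EuclideanSpace ℝ (Fin d))
    (v : Fin 1 → EuclideanSpace ℝ (Fin d)) :
    (taylorForm a i).inChart z₀ y v = IsClosedPair.quot (chartA (𝓡 d) a z₀) i (0, y) (v 0) := by
  have h1 := taylorQuot_comp (a := fun t => a t (chartParam (𝓡 d) z₀ y))
    (a' := fun t => chartA (𝓡 d) a z₀ (t, y)) (L := chartDeriv (𝓡 d) z₀ y) (ε := ε)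
    i (h.contDiffOn_apply _) (fun _ _ => rfl) (t := 0) ⟨by linarith, hε⟩
  rw [IsClosedPair.quot, h1]
  rfl

lemma isSmooth_taylorForm (i : ℕ) : (taylorForm a i).IsSmooth := by
  intro z₀
  refine contDiffOn_alternatingMap fun v => ?_
  simp only [h.inChart_taylorForm hε]
  have h1 : ContDiffOn ℝ ∞ (fun y => IsClosedPair.quot (chartA (𝓡 d) a z₀) i (0, y))
      (extChartAt (𝓡 d) z₀).target :=
    ContDiffOn.comp (f := fun y => ((0 : ℝ), y))
      ((h.closed z₀).smooth_quot (chartParam (𝓡 d) z₀).open_source i)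
      (contDiffOn_const.prodMk contDiffOn_id) fun y hy => ⟨⟨by linarith, hε⟩, hy⟩
  exact h1.clm_apply contDiffOn_const

lemma isClosedOn_taylorForm {i : ℕ} (hi : i < m) : (taylorForm a i).IsClosedOn univ := by
  intro z₀ y hy _
  have hU := (chartParam (𝓡 d) z₀).open_source
  have h0 : (0 : ℝ) ∈ Ioo (-ε) ε := ⟨by linarith, hε⟩
  have hx : ((0 : ℝ), y) ∈ Ioo (-ε) ε ×ˢ (chartParam (𝓡 d) z₀).source := ⟨h0, hy⟩
  have hq : DifferentiableAt ℝ (IsClosedPair.quot (chartA (𝓡 d) a z₀) i) (0, y) :=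
    (((h.closed z₀).smooth_quot hU i).contDiffAt
      ((isOpen_Ioo.prod hU).mem_nhds hx)).differentiableAt (by simp)
  refine extDeriv_one_form (D := (fderiv ℝ (IsClosedPair.quot (chartA (𝓡 d) a z₀) i) (0, y)).comp
    (ContinuousLinearMap.inr ℝ ℝ _)) ((((h.isSmooth_taylorForm hε i) z₀).contDiffAt
      (hU.mem_nhds hy)).differentiableAt (by simp)) (fun v w => ?_) fun v w => ?_
  · simp only [h.inChart_taylorForm hε]
    have h1 : HasFDerivAt (fun y : EuclideanSpace ℝ (Fin d) => ((0 : ℝ), y))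
      (ContinuousLinearMap.inr ℝ ℝ _) y := hasFDerivAt_prodMk_right 0 y
    have h2 := (hq.hasFDerivAt.comp y h1).clm_apply (hasFDerivAt_const w y)
    refine (DFunLike.congr_fun h2.fderiv v).trans ?_
    simp
  · have h1 := (h.closed z₀).curl_quot hU hi.le h0 hy v w
    rw [zero_pow (by omega), zero_mul, curl, sub_eq_zero] at h1
    exact h1

lemma isInvariantOn_taylorForm {g : Z → Z} (hg : ∀ t ∈ Ioo (-ε) ε, ∀ z,
      a t z = (a t (g z)).comp (modelDeriv (𝓡 d) (𝓡 d) g z)) (i : ℕ) :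
    (taylorForm a i).IsInvariantOn g univ := by
  intro z _
  have h1 := taylorQuot_comp (a := fun t => a t (g z)) (a' := fun t => a t z)
    (L := modelDeriv (𝓡 d) (𝓡 d) g z) (ε := ε)
    i (h.contDiffOn_apply _) (fun t ht => hg t ht z) (t := 0) ⟨by linarith, hε⟩
  refine ContinuousAlternatingMap.ext fun v => ?_
  exact (DFunLike.congr_fun h1 (v 0)).symm

end IsSymplecticFamily

end FormsOnZ

section TubeForm

variable {d m : ℕ} {ε : ℝ}
  {M : Type*} [TopologicalSpace M] [ChartedSpace (EuclideanSpace ℝ (Fin (d + 1))) M]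
  [IsManifold (𝓡 (d + 1)) ∞ M]
  {Z : Type*} [TopologicalSpace Z] [ChartedSpace (EuclideanSpace ℝ (Fin d)) Z]
  [IsManifold (𝓡 d) ∞ Z] {f : M → ℝ}
  {Φ : PartialDiffeomorph (𝓘(ℝ, ℝ).prod (𝓡 d)) (𝓡 (d + 1)) (ℝ × Z) M ∞}
  {Ω : BmTwoForm (d + 1) f m}

/-- The restriction to `Z` of the two-forms of a `bᵐ`-form, as a differential form. -/
def tubeForm (Ω : BmTwoForm (d + 1) f m)
    (Φ : PartialDiffeomorph (𝓘(ℝ, ℝ).prod (𝓡 d)) (𝓡 (d + 1)) (ℝ × Z) M ∞) : DiffForm d 2 Z :=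
  fun z => ((frameCoeff (𝓘(ℝ, ℝ).prod (𝓡 d)) Ω Φ (0, z)).compContinuousLinearMap
    (ContinuousLinearMap.inr ℝ ℝ (EuclideanSpace ℝ (Fin d))) :
      EuclideanSpace ℝ (Fin d) [⋀^Fin 2]→L[ℝ] ℝ)

lemma tubeForm_apply (z : Z) (v : Fin 2 → EuclideanSpace ℝ (Fin d)) :
    (show EuclideanSpace ℝ (Fin d) [⋀^Fin 2]→L[ℝ] ℝ from tubeForm Ω Φ z) v
      = tubeB Ω Φ 0 z (v 0) (v 1) := by
  rw [tubeB, coeffB_apply]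
  change frameCoeff _ _ _ _ _ = _
  congr 1
  ext i : 1
  fin_cases i <;> rfl

lemma inChart_tubeForm (z₀ : Z) (y : EuclideanSpace ℝ (Fin d))
    (v : Fin 2 → EuclideanSpace ℝ (Fin d)) :
    (tubeForm Ω Φ).inChart z₀ y v = chartB (𝓡 d) (tubeB Ω Φ) z₀ (0, y) (v 0) (v 1) :=
  tubeForm_apply (Ω := Ω) (Φ := Φ) (chartParam (𝓡 d) z₀ y) fun i => chartDeriv (𝓡 d) z₀ y (v i)

variable (h : IsSymplecticFamily (𝓡 d) m ε (tubeA Ω Φ) (tubeB Ω Φ)) (hε : 0 < ε)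

include h hε

lemma isSmooth_tubeForm : (tubeForm Ω Φ).IsSmooth := by
  intro z₀
  refine contDiffOn_alternatingMap fun v => ?_
  simp only [inChart_tubeForm]
  have h1 : ContDiffOn ℝ ∞ (fun y => chartB (𝓡 d) (tubeB Ω Φ) z₀ (0, y))
      (extChartAt (𝓡 d) z₀).target :=
    ContDiffOn.comp (f := fun y => ((0 : ℝ), y)) (h.closed z₀).smooth_B
      (contDiffOn_const.prodMk contDiffOn_id) fun y hy => ⟨⟨by linarith, hε⟩, hy⟩
  exact (h1.clm_apply contDiffOn_const).clm_apply contDiffOn_const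

lemma isClosedOn_tubeForm : (tubeForm Ω Φ).IsClosedOn univ := by
  intro z₀ y hy _
  have hU := (chartParam (𝓡 d) z₀).open_source
  have h0 : (0 : ℝ) ∈ Ioo (-ε) ε := ⟨by linarith, hε⟩
  have hx : ((0 : ℝ), y) ∈ Ioo (-ε) ε ×ˢ (chartParam (𝓡 d) z₀).source := ⟨h0, hy⟩
  have hq : DifferentiableAt ℝ (chartB (𝓡 d) (tubeB Ω Φ) z₀) (0, y) :=
    ((h.closed z₀).smooth_B.contDiffAt
      ((isOpen_Ioo.prod hU).mem_nhds hx)).differentiableAt (by simp)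
  refine extDeriv_two_form (D := (fderiv ℝ (chartB (𝓡 d) (tubeB Ω Φ) z₀) (0, y)).comp
    (ContinuousLinearMap.inr ℝ ℝ _)) (((isSmooth_tubeForm h hε z₀).contDiffAt
      (hU.mem_nhds hy)).differentiableAt (by simp)) (fun u v w => ?_) fun u v w => ?_
  · simp only [inChart_tubeForm]
    have h1 : HasFDerivAt (fun y : EuclideanSpace ℝ (Fin d) => ((0 : ℝ), y))
      (ContinuousLinearMap.inr ℝ ℝ _) y := hasFDerivAt_prodMk_right 0 y
    have h2 := ((hq.hasFDerivAt.comp y h1).clm_apply (hasFDerivAt_const v y)).clm_apply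
      (hasFDerivAt_const w y)
    refine (DFunLike.congr_fun h2.fderiv u).trans ?_
    simp
  · exact (h.closed z₀).closed_B' hU h0 hy u v w

omit h in
lemma isInvariantOn_tubeForm {g : Z → Z} (hg : ∀ t ∈ Ioo (-ε) ε, ∀ z,
      tubeB Ω Φ t z = (tubeB Ω Φ t (g z)).bilinearComp (modelDeriv (𝓡 d) (𝓡 d) g z)
        (modelDeriv (𝓡 d) (𝓡 d) g z)) :
    (tubeForm Ω Φ).IsInvariantOn g univ := by
  intro z _
  refine ContinuousAlternatingMap.ext fun v => ?_
  have h1 := tubeForm_apply (Ω := Ω) (Φ := Φ) z v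
  rw [hg 0 ⟨by linarith, hε⟩ z] at h1
  exact (tubeForm_apply (Ω := Ω) (Φ := Φ) (g z)
    fun i => modelDeriv (𝓡 d) (𝓡 d) g z (v i)).trans h1.symm

end TubeForm

section Laurent

variable {d m : ℕ} {Z : Type*}

/-- The expansion of the singular form of a truncated family in powers of `t⁻¹`. -/
lemma singularAt_truncFamily {E : Type u} [NormedAddCommGroup E] [NormedSpace ℝ E]
    [FiniteDimensional ℝ E] (a : ℝ → Z → E →L[ℝ] ℝ) (b : Z → E →L[ℝ] E →L[ℝ] ℝ) {p : ℝ × Z} (hp : p.1 ≠ 0) (v w : ℝ × E) :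
    singularAt m (truncFamily m a) (fun _ => b) p v w
      = (∑ j ∈ Finset.Icc 1 m, (p.1 ^ j)⁻¹ *
        (v.1 * taylorQuot (fun t => a t p.2) (m - j) 0 w.2
          - w.1 * taylorQuot (fun t => a t p.2) (m - j) 0 v.2)) + b p.2 v.2 w.2 := by
  have h1 : truncFamily m a p.1 p.2
      = ∑ i ∈ Finset.range m, p.1 ^ i • taylorQuot (fun t => a t p.2) i 0 := by
    rw [truncFamily, sub_eq_iff_eq_add]
    exact taylorQuot_expand (fun t => a t p.2) m p.1
  have h2 : ∀ u : E, (p.1 ^ m)⁻¹ * truncFamily m a p.1 p.2 u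
      = ∑ j ∈ Finset.Icc 1 m, (p.1 ^ j)⁻¹ * taylorQuot (fun t => a t p.2) (m - j) 0 u := by
    intro u
    rw [h1, sum_apply, Finset.mul_sum]
    refine Finset.sum_nbij' (fun i => m - i) (fun j => m - j) ?_ ?_ ?_ ?_ ?_
    · intro i hi
      rw [Finset.mem_range] at hi
      exact Finset.mem_Icc.2 (by omega)
    · intro j hj
      rw [Finset.mem_Icc] at hj
      exact Finset.mem_range.2 (by omega)
    · intro i hi
      rw [Finset.mem_range] at hi
      omega
    · intro j hj
      rw [Finset.mem_Icc] at hj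
      omega
    · intro i hi
      rw [Finset.mem_range] at hi
      have h3 : p.1 ^ m = p.1 ^ i * p.1 ^ (m - i) := by rw [← pow_add]; congr 1; omega
      rw [smul_apply, smul_eq_mul, show m - (m - i) = i by omega, h3]
      have := pow_ne_zero i hp
      have := pow_ne_zero (m - i) hp
      field_simp
  rw [singularAt, frameForm_apply, smul_apply, smul_apply, smul_eq_mul, smul_eq_mul, h2, h2,
    Finset.mul_sum, Finset.mul_sum, ← Finset.sum_sub_distrib]
  congr 1
  exact Finset.sum_congr rfl fun j _ => by ring

end Laurent

/-! ### The normal form -/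

section Assembly

variable {d m k : ℕ}
  {M : Type*} [TopologicalSpace M] [T2Space M] [CompactSpace M]
  [ChartedSpace (EuclideanSpace ℝ (Fin (d + 1))) M]
  [IsManifold (𝓡 (d + 1)) ∞ M]
  {Z : Type*} [TopologicalSpace Z] [Nonempty Z] [ChartedSpace (EuclideanSpace ℝ (Fin d)) Z]
  [IsManifold (𝓡 d) ∞ Z] {ι : Z → M} {f : M → ℝ}
  {ε δ : ℝ} {tube : PartialDiffeomorph (𝓡 (d + 1)) (𝓘(ℝ, ℝ).prod (𝓡 d)) M (ℝ × Z) ∞}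
  {ψ : PartialDiffeomorph (𝓘(ℝ, ℝ).prod (𝓡 d)) (𝓘(ℝ, ℝ).prod (𝓡 d)) (ℝ × Z) (ℝ × Z) ∞}
  {Ω : BmTwoForm (d + 1) f m}

/-- The transport of a diffeomorphism of `(-ε, ε) × Z` to the tubular neighbourhood. -/
def tubeConj (tube : PartialDiffeomorph (𝓡 (d + 1)) (𝓘(ℝ, ℝ).prod (𝓡 d)) M (ℝ × Z) ∞)
    (ψ : PartialDiffeomorph (𝓘(ℝ, ℝ).prod (𝓡 d)) (𝓘(ℝ, ℝ).prod (𝓡 d)) (ℝ × Z) (ℝ × Z) ∞) :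
    PartialDiffeomorph (𝓡 (d + 1)) (𝓡 (d + 1)) M M ∞ :=
  (tube.trans ψ).trans tube.symm

lemma tubeConj_apply (p : M) : tubeConj tube ψ p = tube.symm (ψ (tube p)) := rfl

lemma tubeConj_source (hs : ψ.source = tube.target) (ht : ψ.target = tube.target) :
    (tubeConj tube ψ).source = tube.source := by
  ext p
  refine ⟨fun h => h.1.1, fun h => ?_⟩
  have h1 : tube p ∈ ψ.source := hs ▸ tube.map_source h
  have h2 : ψ (tube p) ∈ tube.target := ht ▸ ψ.map_source h1
  exact ⟨⟨h, h1⟩, h2⟩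

lemma tubeConj_target (hs : ψ.source = tube.target) (ht : ψ.target = tube.target) :
    (tubeConj tube ψ).target = tube.source := by
  ext p
  refine ⟨fun h => h.1, fun h => ?_⟩
  have h1 : tube p ∈ ψ.target := ht ▸ tube.map_source h
  have h2 : ψ.symm (tube p) ∈ tube.target := hs ▸ ψ.map_target h1
  exact ⟨h, ⟨h1, h2⟩⟩

lemma modelDeriv_tubeConj {p : M} (hp : p ∈ (tubeConj tube ψ).source)
    (v : EuclideanSpace ℝ (Fin (d + 1))) :
    modelDeriv (𝓡 (d + 1)) (𝓡 (d + 1)) (tubeConj tube ψ) p v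
      = modelDeriv (𝓘(ℝ, ℝ).prod (𝓡 d)) (𝓡 (d + 1)) tube.symm (ψ (tube p))
        (modelDeriv (𝓘(ℝ, ℝ).prod (𝓡 d)) (𝓘(ℝ, ℝ).prod (𝓡 d)) ψ (tube p)
          (modelDeriv (𝓡 (d + 1)) (𝓘(ℝ, ℝ).prod (𝓡 d)) tube p v)) := by
  have h1 := (tube.mdifferentiableAt' hp.1.1).hasMFDerivAt
  have h2 := (ψ.mdifferentiableAt' (x := tube p) hp.1.2).hasMFDerivAt
  have h3 := (tube.symm.mdifferentiableAt' (x := ψ (tube p)) hp.2).hasMFDerivAt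
  exact DFunLike.congr_fun (h3.comp p (h2.comp p h1)).mfderiv v

lemma differential_eq_fst (h1 : ∀ p, (tube p).1 = f p) {p : M} (hp : p ∈ tube.source)
    (v : EuclideanSpace ℝ (Fin (d + 1))) :
    differential (n := d + 1) f p v = (modelDeriv (𝓡 (d + 1)) (𝓘(ℝ, ℝ).prod (𝓡 d)) tube p v).1 := by
  have h2 := ((hasMFDerivAt_fst (I := 𝓘(ℝ, ℝ)) (I' := 𝓡 d) (tube p)).comp p
    (tube.mdifferentiableAt' hp).hasMFDerivAt).mfderiv
  have h3 : (Prod.fst ∘ tube) = f := funext h1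
  rw [h3] at h2
  exact DFunLike.congr_fun h2 v

lemma mfderiv_snd_tube {p : M} (hp : p ∈ tube.source) (v : EuclideanSpace ℝ (Fin (d + 1))) :
    modelDeriv (𝓡 (d + 1)) (𝓡 d) (fun q => (tube q).2) p v
      = (modelDeriv (𝓡 (d + 1)) (𝓘(ℝ, ℝ).prod (𝓡 d)) tube p v).2 :=
  DFunLike.congr_fun ((hasMFDerivAt_snd (I := 𝓘(ℝ, ℝ)) (I' := 𝓡 d) (tube p)).comp p
    (tube.mdifferentiableAt' hp).hasMFDerivAt).mfderiv v

lemma IsTubeParam.restrict_eq_singularAt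
    {Φ : PartialDiffeomorph (𝓘(ℝ, ℝ).prod (𝓡 d)) (𝓡 (d + 1)) (ℝ × Z) M ∞}
    (hΦ : IsTubeParam f ε Φ) {x : ℝ × Z} (hx : x ∈ Φ.source) (hx0 : x.1 ≠ 0)
    (u w : ℝ × EuclideanSpace ℝ (Fin d)) :
    Ω.restrict (Φ x) ![modelDeriv (𝓘(ℝ, ℝ).prod (𝓡 d)) (𝓡 (d + 1)) Φ x u,
        modelDeriv (𝓘(ℝ, ℝ).prod (𝓡 d)) (𝓡 (d + 1)) Φ x w]
      = singularAt m (tubeA Ω Φ) (tubeB Ω Φ) x u w := by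
  have hl := hΦ.level x hx
  rw [(hΦ.isAdaptedAt hx).restrict_apply (by rwa [hl]), ← frameForm_coeff, hl, singularAt,
    frameForm_apply, frameForm_apply, smul_apply, smul_apply, smul_eq_mul, smul_eq_mul]
  change (x.1 ^ m)⁻¹ * u.1 * tubeA Ω Φ x.1 x.2 w.2 - (x.1 ^ m)⁻¹ * w.1 * tubeA Ω Φ x.1 x.2 u.2
    + tubeB Ω Φ x.1 x.2 u.2 w.2 = _
  ring

/-- The action on the hypersurface is smooth. -/
lemma contMDiff_smul_hypersurface [MulAction (Torus k) M] [MulAction (Torus k) Z]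
    (hι : ContMDiff (𝓡 d) (𝓡 (d + 1)) ∞ ι) (hT : IsSmoothTorusAction (d + 1) k M)
    (hmem : ∀ (g : Torus k) z, g • ι z ∈ tube.source)
    (htube : ∀ (g : Torus k) (z : Z), tube (g • ι z) = (0, g • z)) (g : Torus k) :
    ContMDiff (𝓡 d) (𝓡 d) ∞ (fun z : Z => g • z) := by
  have h1 : (fun z : Z => g • z) = fun z => (tube (g • ι z)).2 := funext fun z => by rw [htube]
  rw [h1]
  intro z
  have h2 : ContMDiffAt (𝓡 d) (𝓡 (d + 1)) ∞ (fun z => g • ι z) z :=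
    ((hT.isSmoothParamAction.contMDiff_smul g).comp hι) z
  exact (contMDiff_snd _).comp z (ContMDiffAt.comp z (tube.contMDiffAt (hmem g z)) h2)

lemma surjective_modelDeriv_smul [MulAction (Torus k) Z]
    (h : ∀ g : Torus k, ContMDiff (𝓡 d) (𝓡 d) ∞ (fun z : Z => g • z)) (g : Torus k) (z : Z) :
    Function.Surjective (modelDeriv (𝓡 d) (𝓡 d) (fun z : Z => g • z) z) := by
  have h1 : HasMFDerivAt (𝓡 d) (𝓡 d) (fun z : Z => g • z) z
      (modelDeriv (E := EuclideanSpace ℝ (Fin d)) (E' := EuclideanSpace ℝ (Fin d)) (𝓡 d) (𝓡 d)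
        (fun z : Z => g • z) z) := ((h g).mdifferentiableAt (by simp)).hasMFDerivAt
  have h2 : HasMFDerivAt (𝓡 d) (𝓡 d) (fun z : Z => g⁻¹ • z) (g • z)
      (modelDeriv (E := EuclideanSpace ℝ (Fin d)) (E' := EuclideanSpace ℝ (Fin d)) (𝓡 d) (𝓡 d)
        (fun z : Z => g⁻¹ • z) (g • z)) := ((h g⁻¹).mdifferentiableAt (by simp)).hasMFDerivAt
  have h3 := (h2.comp z h1).mfderiv
  have h4 : ((fun z : Z => g⁻¹ • z) ∘ fun z => g • z) = id := funext fun z => inv_smul_smul g z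
  rw [h4, mfderiv_id] at h3
  have h5 : Function.Injective (modelDeriv (𝓡 d) (𝓡 d) (fun z : Z => g • z) z) := by
    refine Function.LeftInverse.injective
      (g := modelDeriv (𝓡 d) (𝓡 d) (fun z : Z => g⁻¹ • z) (g • z)) fun v => ?_
    exact (DFunLike.congr_fun h3 v).symm
  exact (LinearMap.injective_iff_surjective (f := (modelDeriv (𝓡 d) (𝓡 d) (fun z : Z => g • z) z :
    EuclideanSpace ℝ (Fin d) →ₗ[ℝ] EuclideanSpace ℝ (Fin d)))).1 h5

/-- The equivariant normal form. -/
theorem exists_equivariant_bmNormalForm (hm : m ≠ 0) (hf : IsTransverseZero d ι f)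
    (hΩ : Ω.IsSymplectic) [MulAction (Torus k) M] [MulAction (Torus k) Z]
    (hT : IsSmoothTorusAction (d + 1) k M)
    (hι : ∀ (g : Torus k) (z : Z), ι (g • z) = g • ι z)
    (hfT : ∀ (g : Torus k) (p : M), f (g • p) = f p)
    (hΩT : ∀ g : Torus k, Ω.restrict.IsInvariantOn (fun p => g • p) {p | f p ≠ 0}) :
    ∃ N : BmNormalForm d ι f m Ω, N.IsEquivariant (Torus k) := by
  have := hf.t2Space
  have := hf.compactSpace
  obtain ⟨ε, hε, tube, hs, ht, h1, h0, hte⟩ := hf.exists_equivariant_tube hT hι hfT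
  have hmem : ∀ p, p ∈ tube.source ↔ |f p| < ε := fun p => by rw [hs]; rfl
  have hfι : ∀ z, f (ι z) = 0 := fun z => (hf.range_eq ▸ mem_range_self z : ι z ∈ {p | f p = 0})
  have hmι : ∀ (g : Torus k) z, g • ι z ∈ tube.source := fun g z => by
    rw [hmem, hfT, hfι, abs_zero]; exact hε
  have hΦ : IsTubeParam f ε tube.symm := ⟨hf.smooth, ht, fun x hx => by
    rw [← h1, tube.apply_symm_apply hx]⟩
  have hfam := hΦ.isSymplecticFamily hΩ hm hε
  obtain ⟨ψ, g, δ, hδ, hδε, hψs, hψt, hψ0, hg, hψg, hψne, hψn, hψe⟩ :=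
    hfam.exists_moser_diffeo hm hε
  have hsm := contMDiff_smul_hypersurface (k := k) (tube := tube) hf.embedding.contMDiff hT hmι
    fun g z => by
      rw [hte g _ (by rw [hfι, abs_zero]; exact hε), h0]
  have hgΦ : ∀ g : Torus k, ∀ x ∈ tube.symm.source,
      tube.symm (x.1, g • x.2) = g • tube.symm x := by
    intro g x hx
    have hp : tube.symm x ∈ tube.source := tube.map_target hx
    have h2 : |f (tube.symm x)| < ε := (hmem _).1 hp
    have h3 := hte g _ h2
    rw [tube.apply_symm_apply hx] at h3
    rw [← h3]
    exact tube.symm_apply_apply ((hmem _).2 (by rw [hfT]; exact h2))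
  have hA : ∀ (g : Torus k), ∀ t ∈ Ioo (-ε) ε, ∀ z : Z, tubeA Ω tube.symm t z
      = (tubeA Ω tube.symm t (g • z)).comp (modelDeriv (𝓡 d) (𝓡 d) (fun z => g • z) z) :=
    fun g t ht z => hΦ.tubeA_symmetry hΩ hm hε
      ((hT.isSmoothParamAction.contMDiff_smul g).mdifferentiable (by simp))
      ((hsm g).mdifferentiable (by simp)) (hgΦ g) (hΩT g) ht z
  have hB : ∀ (g : Torus k), ∀ t ∈ Ioo (-ε) ε, ∀ z : Z, tubeB Ω tube.symm t z
      = (tubeB Ω tube.symm t (g • z)).bilinearComp (modelDeriv (𝓡 d) (𝓡 d) (fun z => g • z) z)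
        (modelDeriv (𝓡 d) (𝓡 d) (fun z => g • z) z) :=
    fun g t ht z => hΦ.tubeB_symmetry hΩ hm hε
      ((hT.isSmoothParamAction.contMDiff_smul g).mdifferentiable (by simp))
      ((hsm g).mdifferentiable (by simp)) (hgΦ g) (hΩT g) ht z
  have hψs' : ψ.source = tube.target := hψs.trans ht.symm
  have hψt' : ψ.target = tube.target := hψt.trans ht.symm
  have hcs : (tubeConj tube ψ).source = tube.source := tubeConj_source hψs' hψt'
  have hψmem : ∀ p, |f p| < ε → ψ (tube p) ∈ tube.symm.source := fun p hp => by
    have h2 : p ∈ (tubeConj tube ψ).source := by rw [hcs, hmem]; exact hp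
    exact h2.2
  have hψι : ∀ z, tubeConj tube ψ (ι z) = ι z := by
    intro z
    rw [tubeConj_apply, h0, hψ0, ← h0]
    exact tube.symm_apply_apply (by rw [hmem, hfι, abs_zero]; exact hε)
  refine ⟨{ ε := ε
            ε_pos := hε
            tube := tube
            tube_source := hs
            tube_target := ht
            tube_fst := fun p _ => h1 p
            tube_zero := h0
            ψ := tubeConj tube ψ
            ψ_source := hcs.trans hs
            ψ_target := (tubeConj_target hψs' hψt').trans hs
            ψ_image := ?_
            ψ_germ := ⟨fun p => g (tube p), ?_, fun p hp => ?_⟩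
            α := fun j => taylorForm (tubeA Ω tube.symm) (m - j)
            β := tubeForm Ω tube.symm
            α_smooth := fun j _ => hfam.isSmooth_taylorForm hε _
            α_closed := fun j hj => hfam.isClosedOn_taylorForm hε (by
              rw [Finset.mem_Icc] at hj
              omega)
            β_smooth := isSmooth_tubeForm hfam hε
            β_closed := isClosedOn_tubeForm hfam hε
            δ := δ
            δ_pos := hδ
            δ_le := hδε
            normal := fun p hp hp0 v w => ?_ }, ⟨hte, fun g p hp => ?_,
              fun g j _ => hfam.isInvariantOn_taylorForm hε (hA g) _,
              fun g => isInvariantOn_tubeForm hε (hB g)⟩⟩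
  · rw [← range_comp]
    exact congrArg range (funext hψι)
  · rw [← hs]
    refine hg.comp tube.contMDiffOn_toFun fun p hp => ?_
    rw [← ht]
    exact tube.map_source hp
  · have h2 := hψg (tube p) (by rw [h1]; exact hp)
    rw [h1] at h2
    rw [← h2]
    exact hΦ.level _ (hψmem p hp)
  · have hpε := hp.trans_le hδε
    have hps : p ∈ tube.source := (hmem p).2 hpε
    have hx1 : |(tube p).1| < δ := by rw [h1]; exact hp
    have hx0 : (tube p).1 ≠ 0 := by rw [h1]; exact hp0
    have hD := modelDeriv_tubeConj (tube := tube) (ψ := ψ) (p := p) (by rw [hcs]; exact hps)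
    have e1 := hΦ.restrict_eq_singularAt (Ω := Ω) (hψmem p hpε)
      (hψne _ (hx1.trans_le hδε) hx0)
      (modelDeriv (𝓘(ℝ, ℝ).prod (𝓡 d)) (𝓘(ℝ, ℝ).prod (𝓡 d)) ψ (tube p)
          (modelDeriv (𝓡 (d + 1)) (𝓘(ℝ, ℝ).prod (𝓡 d)) tube p v))
      (modelDeriv (𝓘(ℝ, ℝ).prod (𝓡 d)) (𝓘(ℝ, ℝ).prod (𝓡 d)) ψ (tube p)
          (modelDeriv (𝓡 (d + 1)) (𝓘(ℝ, ℝ).prod (𝓡 d)) tube p w))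
    rw [hψn _ hx1 hx0, singularAt_truncFamily _ _ hx0, h1] at e1
    let R : M → EuclideanSpace ℝ (Fin (d + 1)) [⋀^Fin 2]→L[ℝ] ℝ := fun p => Ω.restrict p
    refine (Eq.trans (congrArg (R (tubeConj tube ψ p)) ?_) e1).trans ?_
    · ext i : 1
      fin_cases i
      · exact hD v
      · exact hD w
    have hdv := differential_eq_fst h1 hps v
    have hdw := differential_eq_fst h1 hps w
    have hsv := mfderiv_snd_tube hps v
    have hsw := mfderiv_snd_tube hps w
    rw [← hdv, ← hdw, ← hsv, ← hsw]
    refine congrArg₂ (· + ·) (Finset.sum_congr rfl fun j _ => rfl) ?_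
    exact (tubeForm_apply (Ω := Ω) (Φ := tube.symm) (tube p).2
      ![modelDeriv (𝓡 (d + 1)) (𝓡 d) (fun q => (tube q).2) p v,
        modelDeriv (𝓡 (d + 1)) (𝓡 d) (fun q => (tube q).2) p w]).symm
  · have h2 := hψe (fun z => g • z) ((hsm g).mdifferentiable (by simp))
      (surjective_modelDeriv_smul hsm g) (hA g) (hB g) (tube p) (by rw [h1]; exact hp)
    rw [tubeConj_apply, tubeConj_apply, hte g p hp, h2, hgΦ g _ (hψmem p hp)]

end Assembly

theorem mainTheorem3 {d m : ℕ} (hm : 1 ≤ m)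
    {M : Type*} [TopologicalSpace M] [T2Space M] [CompactSpace M]
    [ChartedSpace (EuclideanSpace ℝ (Fin (d + 1))) M] [IsManifold (𝓡 (d + 1)) ∞ M]
    {Z : Type*} [TopologicalSpace Z] [Nonempty Z]
    [ChartedSpace (EuclideanSpace ℝ (Fin d)) Z] [IsManifold (𝓡 d) ∞ Z]
    (ι : Z → M) (f : M → ℝ) (hf : IsTransverseZero d ι f)
    (Ω : BmTwoForm (d + 1) f m) (hΩ : Ω.IsSymplectic) :
    Nonempty (BmNormalForm d ι f m Ω) ∧
    ∀ (k : ℕ) [MulAction (Torus k) M] [MulAction (Torus k) Z],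
      IsSmoothTorusAction (d + 1) k M →
      (∀ (g : Torus k) (z : Z), ι (g • z) = g • ι z) →
      (∀ (g : Torus k) (p : M), f (g • p) = f p) →
      (∀ g : Torus k, Ω.restrict.IsInvariantOn (fun p => g • p) {p | f p ≠ 0}) →
      ∃ N : BmNormalForm d ι f m Ω, N.IsEquivariant (Torus k) := by
  have hm' : m ≠ 0 := by omega
  refine ⟨?_, fun k _ _ hT hι hfT hΩT =>
    exists_equivariant_bmNormalForm hm' hf hΩ hT hι hfT hΩT⟩
  let _ : MulAction (Torus 0) M :=
    { smul := fun _ p => p, one_smul := fun _ => rfl, mul_smul := fun _ _ _ => rfl }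
  let _ : MulAction (Torus 0) Z :=
    { smul := fun _ p => p, one_smul := fun _ => rfl, mul_smul := fun _ _ _ => rfl }
  have hT : IsSmoothTorusAction (d + 1) 0 M := contMDiff_snd
  have hid : Ω.restrict.IsInvariantOn (fun p => p) {p | f p ≠ 0} := fun p _ => by
    have h : mfderiv (𝓡 (d + 1)) (𝓡 (d + 1)) (fun q : M => q) p
      = ContinuousLinearMap.id ℝ (EuclideanSpace ℝ (Fin (d + 1))) := mfderiv_id
    ext v
    exact congrArg (Ω.restrict p) (funext fun i => DFunLike.congr_fun h (v i))
  obtain ⟨N, -⟩ := exists_equivariant_bmNormalForm (k := 0) hm' hf hΩ hT (fun _ _ => rfl)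
    (fun _ _ => rfl) fun _ => hid
  exact ⟨N⟩

end
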